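/- Let $k$ be an algebraically closed field of characteristic $0$, let $A=k[X,Y]$, let $f\in A$ be an irreducible polynomial, and let $R=A/(f)$. Let $J=(f_X,f_Y)$ and $\mathrm{Jac}=(f,f_X,f_Y)$ in $A$. For a point $Q$ of the curve $f=0$, that is, a maximal ideal $Q$ of $A$ with $f\in Q$, let $Q'=Q/(f)$, let $\overline{R_{Q'}}$ be the integral closure of the local ring $R_{Q'}$ in its quotient field, and let $\mathfrak C(f;Q)=\{u\in R_{Q'} : u\,\overline{R_{Q'}}\subseteq R_{Q'}\}$ be the conductor. Writing $l$ for length, put $$C(f;Q)=l\bigl(\overline{R_{Q'}}/\mathfrak C(f;Q)\bigr),\qquad \mu(f;Q)=l\bigl(A_Q/J A_Q\bigr),$$ $$\delta(f;Q)=l\bigl(\mathrm{Jac}\,A_Q/J A_Q\bigr)=\mu(f;Q)-l\bigl(A_Q/\mathrm{Jac}\,A_Q\bigr),\qquad Z(f;Q)=l\bigl(\mathfrak C(f;Q)/J R_{Q'}\bigr),$$ and $\overline\chi(f;Q)=\chi(f;Q)-1$, where $\chi(f;Q)$ is the number of branches of $f$ at $Q$, i.e. the number of places of the function field of the curve centered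 at $Q$ (valuation rings of the function field that dominate $R_{Q'}$). Let $C(f),\mu(f),\delta(f),Z(f),\overline\chi(f)$ be the sums of these local numbers over all points $Q$ of the curve. Then these five numbers are finite, and $$C(f)=\mu(f)+\overline\chi(f)=\tfrac12 C(f)+Z(f)+\delta(f)+\overline\chi(f).$$ In particular, $$\tfrac12 C(f)-Z(f)=\delta(f)+\overline\chi(f).$$ -/

import Mathlib

noncomputable section

namespace PlaneCurve

/-! ### Lengths of quotients of ideals -/

section Length

variable {S : Type*} [CommRing S]

/-- For ideals `I ≤ J` of `S`, the length of the `S`-module `J / I`. -/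
def lengthBetween (I J : Ideal S) : ℕ∞ :=
  Module.length S (J ⧸ Submodule.submoduleOf I J)

theorem length_quotient_eq_add {I J : Ideal S} (h : I ≤ J) :
    Module.length S (S ⧸ I) = Module.length S (S ⧸ J) + lengthBetween I J := by
  rw [add_comm]
  refine Module.length_eq_add_of_exact
    (Submodule.mapQ (Submodule.submoduleOf I J) I (Submodule.subtype J) le_rfl)
    (Submodule.factor h) ?_ ?_ ?_
  · rw [injective_iff_map_eq_zero]
    intro x hx
    obtain ⟨x, rfl⟩ := Submodule.Quotient.mk_surjective _ x
    have hx' : (x : S) ∈ I := (Submodule.Quotient.mk_eq_zero I).1 hx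
    exact (Submodule.Quotient.mk_eq_zero _).2 hx'
  · exact Submodule.factor_surjective h
  · rw [LinearMap.exact_iff]
    ext x
    obtain ⟨x, rfl⟩ := Submodule.Quotient.mk_surjective _ x
    constructor
    · intro hx
      have hx' : x ∈ J := (Submodule.Quotient.mk_eq_zero J).1 hx
      exact ⟨Submodule.Quotient.mk ⟨x, hx'⟩, rfl⟩
    · rintro ⟨y, hy⟩
      obtain ⟨y, rfl⟩ := Submodule.Quotient.mk_surjective _ y
      rw [← hy]
      exact (Submodule.Quotient.mk_eq_zero J).2 y.2

end Length

/-! ### Conductor and branches of a local domain -/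

section LocalRing

variable (S : Type*) [CommRing S]

/-- The integral closure of `S` in its total ring of fractions (its quotient field, if `S` is a
domain). -/
abbrev Normalization : Type _ := integralClosure S (FractionRing S)

/-- The conductor of `S` in its normalization `S'`: the ideal `{u ∈ S | u S' ⊆ S}` of `S`. -/
def conductorIdeal : Ideal S where
  carrier := {u | ∀ t : Normalization S, ∃ s : S,
    algebraMap S (Normalization S) u * t = algebraMap S (Normalization S) s}
  zero_mem' t := ⟨0, by simp⟩
  add_mem' := by
    intro a b ha hb t
    obtain ⟨s, hs⟩ := ha t
    obtain ⟨s', hs'⟩ := hb t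
    exact ⟨s + s', by rw [map_add, map_add, add_mul, hs, hs']⟩
  smul_mem' := by
    intro c u hu t
    obtain ⟨s, hs⟩ := hu t
    exact ⟨c * s, by rw [smul_eq_mul, map_mul, map_mul, mul_assoc, hs]⟩

/-- The conductor, seen inside the normalization `S'` (as an `S`-submodule; it is in fact an
ideal of `S'`, see `mul_mem_conductorInNormalization`). -/
def conductorInNormalization : Submodule S (Normalization S) :=
  Submodule.map (Algebra.linearMap S (Normalization S)) (conductorIdeal S)

theorem mul_mem_conductorInNormalization {u : Normalization S}
    (hu : u ∈ conductorInNormalization S) (t : Normalization S) :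
    u * t ∈ conductorInNormalization S := by
  obtain ⟨a, ha, rfl⟩ := hu
  obtain ⟨s, hs⟩ := ha t
  refine ⟨s, fun t' => ?_, ?_⟩
  · obtain ⟨s', hs'⟩ := ha (t * t')
    exact ⟨s', by rw [← hs, mul_assoc, hs']⟩
  · simpa using hs.symm

/-- The branches of the local domain `S`: the places of its quotient field centered at `S`, that
is, the valuation rings `V` of the quotient field which contain `S` and whose maximal ideal lies
over the maximal ideal of `S`. -/
def branches [IsDomain S] [IsLocalRing S] : Set (ValuationSubring (FractionRing S)) :=
  {V | ∀ s : S, algebraMap S (FractionRing S) s ∈ V ∧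
    (algebraMap S (FractionRing S) s ∈ V.nonunits ↔ s ∈ IsLocalRing.maximalIdeal S)}

theorem branches_nonempty [IsDomain S] [IsLocalRing S] : (branches S).Nonempty := by
  obtain ⟨V, hle, hloc⟩ :=
    (LocalSubring.range (algebraMap S (FractionRing S))).exists_le_valuationSubring
  have hmem : ∀ s : S, algebraMap S (FractionRing S) s ∈ V := fun s => hle ⟨s, rfl⟩
  refine ⟨V, fun s => ⟨hmem s, ?_⟩⟩
  rw [ValuationSubring.mem_nonunits_iff_or, IsLocalRing.mem_maximalIdeal, mem_nonunits_iff]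
  constructor
  · rintro h hs
    obtain ⟨u, rfl⟩ := hs
    rcases h with h | h
    · exact (u.isUnit.map (algebraMap S (FractionRing S))).ne_zero h
    · apply h
      rw [← map_units_inv]
      exact hmem _
  · intro hs
    by_contra! h
    apply hs
    let x : (LocalSubring.range (algebraMap S (FractionRing S))).toSubring :=
      ⟨algebraMap S (FractionRing S) s, ⟨s, rfl⟩⟩
    have hx : IsUnit (Subring.inclusion hle x) := by
      refine IsUnit.of_mul_eq_one ⟨_, h.2⟩ ?_
      exact Subtype.ext (mul_inv_cancel₀ h.1)
    obtain ⟨y, hy⟩ := (hloc.map_nonunit x hx).exists_right_inv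
    obtain ⟨y, ⟨t, rfl⟩⟩ := y
    refine IsUnit.of_mul_eq_one t ?_
    apply IsFractionRing.injective S (FractionRing S)
    simpa [x] using congrArg Subtype.val hy

end LocalRing

/-! ### The curve and its points -/

variable {k : Type*} [Field k] (f : MvPolynomial (Fin 2) k)

/-- The coordinate ring `R = k[X, Y] / (f)`, where `X` and `Y` are the variables `0` and `1`. -/
abbrev CoordinateRing : Type _ := MvPolynomial (Fin 2) k ⧸ Ideal.span {f}

/-- The points `Q` (maximal ideals of `k[X, Y]`) through which `f` passes. -/
def Point : Type _ := {Q : MaximalSpectrum (MvPolynomial (Fin 2) k) // f ∈ Q.asIdeal}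

namespace Point

variable {f} (Q : Point f)

/-- The maximal ideal `Q` of `k[X, Y]`. -/
abbrev ideal : Ideal (MvPolynomial (Fin 2) k) := Q.1.asIdeal

instance : Q.ideal.IsMaximal := Q.1.isMaximal

/-- The image `Q'` of `Q` in the coordinate ring. -/
abbrev imageIdeal : Ideal (CoordinateRing f) := Q.ideal.map (Ideal.Quotient.mk (Ideal.span {f}))

instance : Q.imageIdeal.IsMaximal :=
  Ideal.IsMaximal.map_of_surjective_of_ker_le Ideal.Quotient.mk_surjective
    (by simpa [Ideal.mk_ker, Ideal.span_singleton_le_iff_mem] using Q.2)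

/-- The local ring `A_Q` of the plane at `Q`. -/
abbrev PlaneLocalRing : Type _ := Localization.AtPrime Q.ideal

/-- The local ring `R_{Q'}` of the curve at `Q`. -/
abbrev CurveLocalRing : Type _ := Localization.AtPrime Q.imageIdeal

end Point

instance [hf : Fact (Irreducible f)] : (Ideal.span {f}).IsPrime :=
  (Ideal.span_singleton_prime hf.out.ne_zero).2 hf.out.prime

/-- The ideal `J_f = (f_X, f_Y)` of `k[X, Y]`. -/
def jacobianIdeal : Ideal (MvPolynomial (Fin 2) k) :=
  Ideal.span {MvPolynomial.pderiv 0 f, MvPolynomial.pderiv 1 f}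

/-- The ideal `Jac_f = (f, f_X, f_Y)` of `k[X, Y]`. -/
def tjurinaIdeal : Ideal (MvPolynomial (Fin 2) k) := Ideal.span {f} ⊔ jacobianIdeal f

/-! ### Local invariants

All lengths take values in `ℕ∞`. -/

section Local

variable {f} (Q : Point f)

/-- `J_f A_Q`. -/
abbrev localJacobianIdeal : Ideal Q.PlaneLocalRing :=
  (jacobianIdeal f).map (algebraMap _ Q.PlaneLocalRing)

/-- `Jac_f A_Q`. -/
abbrev localTjurinaIdeal : Ideal Q.PlaneLocalRing :=
  (tjurinaIdeal f).map (algebraMap _ Q.PlaneLocalRing)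

/-- `μ(f; Q)`, the length of `A_Q / J_f A_Q`. -/
def milnorAt : ℕ∞ := Module.length Q.PlaneLocalRing (Q.PlaneLocalRing ⧸ localJacobianIdeal Q)

/-- `ν(f; Q)`, the length of `A_Q / Jac_f A_Q`. -/
def tjurinaAt : ℕ∞ := Module.length Q.PlaneLocalRing (Q.PlaneLocalRing ⧸ localTjurinaIdeal Q)

/-- `δ(f; Q)`, the length of `Jac_f A_Q / J_f A_Q`; it is the difference `μ(f; Q) - ν(f; Q)`,
see `milnorAt_eq`. -/
def defectAt : ℕ∞ := lengthBetween (localJacobianIdeal Q) (localTjurinaIdeal Q)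

theorem milnorAt_eq : milnorAt Q = tjurinaAt Q + defectAt Q :=
  length_quotient_eq_add (Ideal.map_mono le_sup_right)

/-- `C(f; Q)`, the length as an `R`-module of the normalization of `R_{Q'}` modulo the conductor. -/
def conductorLengthAt : ℕ∞ := Module.length (CoordinateRing f)
  (Normalization Q.CurveLocalRing ⧸ conductorInNormalization Q.CurveLocalRing)

/-- The ideal of `R_{Q'}` generated by `f_X` and `f_Y`. -/
abbrev curveJacobianIdeal : Ideal Q.CurveLocalRing :=
  ((jacobianIdeal f).map (Ideal.Quotient.mk (Ideal.span {f}))).map (algebraMap _ Q.CurveLocalRing)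

/-- `Z(f; Q)`, the length of the conductor of `R_{Q'}` modulo the ideal generated by
`f_X` and `f_Y` (which is contained in the conductor). -/
def zariskiAt : ℕ∞ := lengthBetween (curveJacobianIdeal Q) (conductorIdeal Q.CurveLocalRing)

variable [Fact (Irreducible f)]

/-- `χ(f; Q)`, the number of branches of `f` at `Q`. -/
def numBranchesAt : ℕ∞ := (branches Q.CurveLocalRing).encard

theorem one_le_numBranchesAt : 1 ≤ numBranchesAt Q :=
  Set.one_le_encard_iff_nonempty.2 (branches_nonempty _)

/-- `χ(f; Q) - 1`. The subtraction does not truncate, by `one_le_numBranchesAt`. -/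
def chiBarAt : ℕ∞ := numBranchesAt Q - 1

end Local

/-! ### Global invariants: sums over all points of the curve

Every family in `ℕ∞` is summable, with sum the supremum of the finite partial sums. -/

theorem hasSum_enat {ι : Type*} (g : ι → ℕ∞) : HasSum g (⨆ s : Finset ι, ∑ i ∈ s, g i) :=
  tendsto_atTop_iSup fun _ _ h => Finset.sum_le_sum_of_subset h

/-- `C(f)`. -/
def conductorLength : ℕ∞ := ∑' Q : Point f, conductorLengthAt Q

/-- `μ(f)`, the affine Milnor number. -/
def milnor : ℕ∞ := ∑' Q : Point f, milnorAt Q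

/-- `δ(f)`, the affine defect. -/
def defect : ℕ∞ := ∑' Q : Point f, defectAt Q

/-- `Z(f)`, the affine Zariski number. -/
def zariski : ℕ∞ := ∑' Q : Point f, zariskiAt Q

/-- The sum of `χ(f; Q) - 1` over all points `Q` of the curve. -/
def chiBar [Fact (Irreducible f)] : ℕ∞ := ∑' Q : Point f, chiBarAt Q

end PlaneCurve

end

/-! After an automorphism of the plane the curve is `F = 0` with `F` monic in `Y`. In `k[X][X]` the
coordinates are `C X` and `X`; `derivative` is the partial derivative in `Y` and `Dx` the one in
`X`. Let `B` be the normalization of `R`, a Dedekind domain finite over the line `k[X]`, with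
conductor 𝔠 and different 𝔇 over `k[X]`. Fix a point `Q`, on the line `X = c` say, and write (G, H)
for the length of `k[X][X] / (G, H)` at `Q`.

The equality C = μ + χ - 1 holds at each point, because of four facts. (1) (F, F_Y) = (F_X, F_Y) +
(X - c, F_Y): this is Teissier's formula `locLength_polar`, obtained from the chain rule along each
component of the polar curve F_Y = 0. (2) (X - c, F) = (X - c, F_Y) + 1, since in characteristic 0
differentiation lowers the multiplicity of a root by one (`locLength_fiber`). (3) F_Y B = 𝔠𝔇, since
R is generated over `k[X]` by one element with minimal polynomial `F`
(`conductorOf_mul_differentIdeal`). (4) 𝔇 has order e - 1 at a prime of `B` where X - c has order e,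
ramification being tame (`count_differentIdeal_add_one`). Colengths of ideals of `B` count prime
factors, and (F, H) can be computed on `B` (`locLength_pair_eq_countOver`). With d the number of
prime factors of 𝔇 over `Q`, (4) reads (X - c, F) = d + χ, so C + d = (F, F_Y) = μ + (X - c, F_Y) =
μ + d + χ - 1.

For the other equality, JR lies in 𝔠, so the length of A/Jac at `Q` is that of R/𝔠 plus Z, and μ is
the length of R/𝔠 at `Q` plus Z + δ. The ring `R` is Gorenstein: by the trace form, N ↦ (R : N) is
an involution on lattices (`one_div_one_div`), so B/𝔠 has twice the length of R/𝔠. This is proved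
globally; both lengths are finite, hence equal to the sums of their local contributions. Finiteness
of C(f) then forces that of the other numbers. -/

noncomputable section

namespace PlaneCurve

/-! ### Lengths of localizations at a prime. -/

section LocLength

variable {S : Type*} [CommRing S] (Q : Ideal S) [Q.IsPrime]

/-- The length of the localization at a prime `Q` of a module. -/
def locLength (M : Type*) [AddCommGroup M] [Module S M] : ℕ∞ :=
  Module.length S (LocalizedModule Q.primeCompl M)

variable {M N P : Type*} [AddCommGroup M] [Module S M] [AddCommGroup N] [Module S N]
  [AddCommGroup P] [Module S P]

theorem locLength_eq_length (g : M →ₗ[S] N) [IsLocalizedModule Q.primeCompl g] :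
    locLength Q M = Module.length S N :=
  (IsLocalizedModule.iso Q.primeCompl g).length_eq

theorem locLength_congr (e : M ≃ₗ[S] N) : locLength Q M = locLength Q N :=
  locLength_eq_length Q (LocalizedModule.mkLinearMap Q.primeCompl N ∘ₗ e.toLinearMap)

theorem locLength_add (f : N →ₗ[S] M) (g : M →ₗ[S] P) (hf : Function.Injective f)
    (hg : Function.Surjective g) (H : Function.Exact f g) :
    locLength Q M = locLength Q N + locLength Q P :=
  Module.length_eq_add_of_exact (LocalizedModule.map Q.primeCompl f |>.restrictScalars S)
    (LocalizedModule.map Q.primeCompl g |>.restrictScalars S)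
    (LocalizedModule.map_injective _ f hf) (LocalizedModule.map_surjective _ g hg)
    (LocalizedModule.map_exact _ f g H)

theorem locLength_eq_add_quotient (N : Submodule S M) :
    locLength Q M = locLength Q N + locLength Q (M ⧸ N) :=
  locLength_add Q N.subtype N.mkQ N.injective_subtype N.mkQ_surjective
    (LinearMap.exact_subtype_mkQ N)

theorem locLength_le_of_surjective (f : M →ₗ[S] N) (hf : Function.Surjective f) :
    locLength Q N ≤ locLength Q M :=
  Module.length_le_of_surjective (LocalizedModule.map Q.primeCompl f |>.restrictScalars S)
    (LocalizedModule.map_surjective _ f hf)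

theorem locLength_eq_zero {s : S} (hs : s ∉ Q) (h : ∀ m : M, s • m = 0) : locLength Q M = 0 := by
  have : Subsingleton (LocalizedModule Q.primeCompl M) := by
    rw [LocalizedModule.subsingleton_iff]
    exact fun m => ⟨s, hs, h m⟩
  exact Module.length_eq_zero

theorem locLength_eq_zero_of_subsingleton [Subsingleton M] : locLength Q M = 0 :=
  locLength_eq_zero Q (s := 1) (fun h => Ideal.IsPrime.ne_top' ((Ideal.eq_top_iff_one _).2 h))
    (fun _ => Subsingleton.elim _ _)

/-- Modulo the maximal ideal `Q`, an element outside `Q` has an inverse, so it already acts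
invertibly and the module is its own localization. -/
theorem locLength_eq_length_of_smul [hQ : Q.IsMaximal] (h : ∀ a ∈ Q, ∀ m : M, a • m = 0) :
    locLength Q M = Module.length S M := by
  have : IsLocalizedModule Q.primeCompl (LinearMap.id : M →ₗ[S] M) := by
    refine ⟨fun s => ?_, fun y => ⟨⟨y, 1⟩, by simp⟩, fun {x y} hxy => ⟨1, by simpa using hxy⟩⟩
    obtain ⟨t, q, hq, ht⟩ := hQ.exists_inv s.2
    have key (m : M) : (s : S) • t • m = m := by
      rw [smul_smul, mul_comm]
      conv_rhs => rw [← one_smul S m, ← ht, add_smul, h q hq, add_zero]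
    refine (Module.End.isUnit_iff _).2 ⟨fun x y hxy => ?_, fun m => ⟨t • m, key m⟩⟩
    have hxy' : (s : S) • x = (s : S) • y := hxy
    rw [← key x, ← key y, smul_comm, hxy', smul_comm]
  exact locLength_eq_length Q LinearMap.id

/-- Lengths over `S` and over its localization at a maximal ideal agree. -/
theorem length_eq_length_localization [hQ : Q.IsMaximal] (Sq : Type*) [CommRing Sq] [Algebra S Sq]
    [IsLocalization.AtPrime Sq Q] (M : Type*) [AddCommGroup M] [Module S M] [Module Sq M]
    [IsScalarTower S Sq M] : Module.length S M = Module.length Sq M := by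
  by_cases hM : IsFiniteLength Sq M
  · have : IsLocalRing Sq := IsLocalization.AtPrime.isLocalRing Sq Q
    suffices ∀ (M : Type _) [AddCommGroup M] [Module Sq M], IsFiniteLength Sq M →
        ∀ [Module S M] [IsScalarTower S Sq M], Module.length S M = Module.length Sq M from
      this M hM
    intro M _ _ hM
    induction hM with
    | of_subsingleton => intros; simp
    | @of_simple_quotient M _ _ N hs _ ih =>
      intro _ _
      rw [Module.length_eq_add_of_exact N.subtype N.mkQ N.injective_subtype N.mkQ_surjective
        (LinearMap.exact_subtype_mkQ N), Module.length_eq_add_of_exact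
        (N.subtype.restrictScalars S) (N.mkQ.restrictScalars S) N.injective_subtype
        N.mkQ_surjective (LinearMap.exact_subtype_mkQ N), ih]
      congr 1
      rw [Module.length_eq_one_iff.2 hs, Module.length_eq_one_iff]
      have hann : Module.annihilator Sq (M ⧸ N) = IsLocalRing.maximalIdeal Sq :=
        IsLocalRing.eq_maximalIdeal (IsSimpleModule.annihilator_isMaximal)
      rw [isSimpleModule_iff_toSpanSingleton_surjective] at hs ⊢
      refine ⟨hs.1, fun x hx y => ?_⟩
      obtain ⟨c, rfl⟩ := hs.2 x hx y
      -- `S / Q` is the residue field of `Sq`, so on a simple `Sq`-module every scalar acts like an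
      -- element of `S`.
      obtain ⟨s, hsc⟩ : ∃ s : S, algebraMap S Sq s - c ∈ IsLocalRing.maximalIdeal Sq := by
        obtain ⟨z, hz⟩ := (IsLocalization.AtPrime.equivQuotMaximalIdeal Q Sq).surjective
          (Ideal.Quotient.mk _ c)
        obtain ⟨s, rfl⟩ := Ideal.Quotient.mk_surjective z
        exact ⟨s, Ideal.Quotient.eq.1 hz⟩
      refine ⟨s, ?_⟩
      rw [← hann, Module.mem_annihilator] at hsc
      have := hsc x
      rwa [sub_smul, algebraMap_smul, sub_eq_zero] at this
  -- Every `Sq`-submodule is an `S`-submodule, so infinite length over `Sq` forces infinite length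
  -- over `S`.
  · rw [← Module.length_ne_top_iff, not_not] at hM
    rw [hM, eq_top_iff, ← hM, ← Module.length_top (R := Sq), ← Module.length_top (R := S)]
    exact Submodule.length_le_length_restrictScalars (A := S) (⊤ : Submodule Sq M)

/-- A finite length module is the sum of its localizations, up to length. -/
theorem tsum_locLength (hM : IsFiniteLength S M) :
    ∑' m : MaximalSpectrum S, locLength m.asIdeal M = Module.length S M := by
  induction hM with
  | of_subsingleton => simp [locLength_eq_zero_of_subsingleton]
  | @of_simple_quotient M _ _ N hs _ ih =>
    have hadd : ∀ (f g : MaximalSpectrum S → ℕ∞), ∑' i, (f i + g i) = ∑' i, f i + ∑' i, g i :=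
      fun f g => ((hasSum_enat f).summable.hasSum.add (hasSum_enat g).summable.hasSum).tsum_eq
    simp_rw [fun m : MaximalSpectrum S => locLength_eq_add_quotient m.asIdeal N]
    rw [hadd, ih, Module.length_eq_add_of_exact N.subtype N.mkQ N.injective_subtype
      N.mkQ_surjective (LinearMap.exact_subtype_mkQ N)]
    congr 1
    obtain ⟨q, hq, ⟨e⟩⟩ := isSimpleModule_iff_quot_maximal.1 hs
    -- The simple quotient is `S / q`: it survives, with length one, only in the localization at
    -- `q`.
    rw [tsum_eq_single ⟨q, hq⟩]
    · refine locLength_eq_length_of_smul q fun a ha m => e.injective ?_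
      obtain ⟨b, hb⟩ := Ideal.Quotient.mk_surjective (e m)
      rw [map_smul, map_zero, ← hb, ← Ideal.Quotient.mk_eq_mk, ← Submodule.Quotient.mk_smul]
      exact (Submodule.Quotient.mk_eq_zero q).2 (q.mul_mem_right b ha)
    · intro m hm
      obtain ⟨a, ha, ham⟩ : ∃ a ∈ q, a ∉ m.asIdeal := by
        by_contra! h
        exact hm (MaximalSpectrum.ext (hq.eq_of_le m.isMaximal.ne_top h).symm)
      refine locLength_eq_zero _ ham fun m => e.injective ?_
      obtain ⟨b, hb⟩ := Ideal.Quotient.mk_surjective (e m)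
      rw [map_smul, map_zero, ← hb, ← Ideal.Quotient.mk_eq_mk, ← Submodule.Quotient.mk_smul]
      exact (Submodule.Quotient.mk_eq_zero q).2 (q.mul_mem_right b ha)

theorem length_localization_quotient [hQ : Q.IsMaximal] (Sq : Type*) [CommRing Sq] [Algebra S Sq]
    [IsLocalization.AtPrime Sq Q] (I : Ideal S) :
    Module.length Sq (Sq ⧸ I.map (algebraMap S Sq)) = locLength Q (S ⧸ I) := by
  rw [← length_eq_length_localization Q Sq, locLength_eq_length Q
    (Submodule.toLocalizedQuotient' Sq Q.primeCompl (Algebra.linearMap S Sq) I),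
    Ideal.localized'_eq_map]

end LocLength
end PlaneCurve
end

noncomputable section

namespace PlaneCurve

open UniqueFactorizationMonoid

/-! ### Colengths of ideals in a Dedekind domain. -/

section CountOver

variable {S B : Type*} [CommRing S] [CommRing B] [IsDedekindDomain B] [Algebra S B]

open Classical in
/-- The number of prime factors of an ideal lying over `Q`, counted with multiplicity. -/
def countOver (Q : Ideal S) (I : Ideal B) : ℕ :=
  (normalizedFactors I).countP (fun p => p.comap (algebraMap S B) = Q)

theorem countOver_mul (Q : Ideal S) {I J : Ideal B} (hI : I ≠ ⊥) (hJ : J ≠ ⊥) :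
    countOver Q (I * J) = countOver Q I + countOver Q J := by
  rw [countOver, normalizedFactors_mul hI hJ, Multiset.countP_add]
  rfl

theorem countOver_prime (Q : Ideal S) {p : Ideal B} (hp : Prime p) [Decidable (p.comap (algebraMap S B) = Q)] :
    countOver Q p = if p.comap (algebraMap S B) = Q then 1 else 0 := by
  classical
  rw [countOver, normalizedFactors_irreducible hp.irreducible, normalize_eq, Multiset.countP_eq_card_filter,
    Multiset.filter_singleton]
  split_ifs <;> simp

theorem countOver_top (Q : Ideal S) : countOver Q (⊤ : Ideal B) = 0 := by
  rw [countOver, ← Ideal.one_eq_top, normalizedFactors_one, Multiset.countP_zero]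

/-- Every nonzero prime of `B` has residue field `k`. -/
def HasResidueField (k B : Type*) [Field k] [CommRing B] [Algebra k B] : Prop :=
  ∀ p : Ideal B, p.IsMaximal → p ≠ ⊥ → ∀ b : B, ∃ c : k, b - algebraMap k B c ∈ p

variable {k : Type*} [Field k] [Algebra k S] [Algebra k B] [IsScalarTower k S B]

omit [IsDedekindDomain B] in
theorem HasResidueField.surjective (h : HasResidueField k B) (S : Type*) [CommRing S] [Algebra k S] [Algebra S B]
    [IsScalarTower k S B] {p : Ideal B} (hp : p.IsMaximal) (hp0 : p ≠ ⊥) :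
    Function.Surjective (algebraMap S (B ⧸ p)) := by
  intro x
  obtain ⟨b, rfl⟩ := Ideal.Quotient.mk_surjective x
  obtain ⟨c, hc⟩ := h p hp hp0 b
  refine ⟨algebraMap k S c, ?_⟩
  rw [← IsScalarTower.algebraMap_apply k S (B ⧸ p)]
  exact (Ideal.Quotient.eq.2 hc).symm

/-- Since `B / p` is a quotient of `S`, it is simple over `S` and supported at the contraction of
`p`. -/
theorem locLength_quotient_prime (h : HasResidueField k B) (Q : Ideal S) [hQ : Q.IsMaximal] {p : Ideal B}
    (hp : p.IsMaximal) (hp0 : p ≠ ⊥) : locLength Q (B ⧸ p) = countOver Q p := by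
  classical
  have hsurj := h.surjective S hp hp0
  rw [countOver_prime Q (Ideal.prime_of_isPrime hp0 hp.isPrime)]
  have hker : p.comap (algebraMap S B) = RingHom.ker (algebraMap S (B ⧸ p)) := by
    ext s
    rw [RingHom.mem_ker, Ideal.mem_comap, IsScalarTower.algebraMap_apply S B (B ⧸ p)]
    exact Ideal.Quotient.eq_zero_iff_mem.symm
  have hsmul : ∀ a ∈ p.comap (algebraMap S B), ∀ m : B ⧸ p, a • m = 0 := by
    intro a ha m
    rw [Algebra.smul_def, show algebraMap S (B ⧸ p) a = 0 by rwa [hker] at ha, zero_mul]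
  split_ifs with hpQ
  · subst hpQ
    rw [locLength_eq_length_of_smul _ hsmul, Module.length_eq_of_surjective hsurj]
    let _ := Ideal.Quotient.field p
    simp
  · have hmax : (p.comap (algebraMap S B)).IsMaximal := by
      rw [hker]
      let _ := Ideal.Quotient.field p
      exact RingHom.ker_isMaximal_of_surjective _ hsurj
    obtain ⟨a, ha, haQ⟩ : ∃ a ∈ p.comap (algebraMap S B), a ∉ Q := by
      by_contra! hle
      exact hpQ (hmax.eq_of_le hQ.ne_top hle)
    simpa using locLength_eq_zero Q haQ (hsmul a ha)

/-- The length of `B / I` at `Q` is the number of prime factors of `I` over `Q`. -/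
theorem locLength_quotient_ideal (h : HasResidueField k B) (Q : Ideal S) [Q.IsMaximal] {I : Ideal B}
    (hI : I ≠ ⊥) : locLength Q (B ⧸ I) = countOver Q I := by
  induction I using UniqueFactorizationMonoid.induction_on_prime with
  | h₁ => exact absurd rfl hI
  | h₂ I hu =>
    rw [Ideal.isUnit_iff.1 hu, countOver_top]
    exact locLength_eq_zero_of_subsingleton Q
  | h₃ J p hJ hp ih =>
    have hp0 : p ≠ ⊥ := hp.ne_zero
    have hpm : p.IsMaximal := (Ideal.isPrime_of_prime hp).isMaximal hp0
    have hlt : p * J < J := by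
      refine lt_of_le_of_ne Ideal.mul_le_right fun heq => hpm.ne_top ?_
      rw [← Ideal.one_eq_top]
      exact mul_right_cancel₀ hJ (heq.trans (one_mul J).symm)
    -- No ideal lies strictly between `p * J` and `J`, so `x` generates `J` modulo `p * J`.
    -- Multiplication by `x` then embeds `B / p` in `B / (p * J)` with cokernel `B / J`.
    obtain ⟨x, hxJ, hx⟩ := SetLike.exists_of_lt hlt
    have hspan : Ideal.span {x} ⊔ p * J = J := by
      have hle : Ideal.span {x} ⊔ p * J ≤ J :=
        sup_le ((Ideal.span_singleton_le_iff_mem _).2 hxJ) hlt.le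
      obtain ⟨L, hL⟩ := Ideal.dvd_iff_le.2 hle
      have hpL : p ≤ L := by
        rw [← Ideal.dvd_iff_le, ← mul_dvd_mul_iff_left hJ, ← hL, Ideal.dvd_iff_le, mul_comm]
        exact le_sup_right
      rcases hpm.out.le_iff.1 hpL with h1 | h1
      · rw [hL, h1, Ideal.mul_top]
      · refine absurd ?_ hx
        rw [mul_comm, ← h1, ← hL]
        exact Ideal.mem_sup_left (Ideal.mem_span_singleton_self x)
    let f : (B ⧸ p) →ₗ[S] (B ⧸ p * J) :=
      (Submodule.mapQ p (p * J) (LinearMap.mulLeft B x) (fun b hb => by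
        rw [Submodule.mem_comap, LinearMap.mulLeft_apply, mul_comm x]
        exact Ideal.mul_mem_mul hb hxJ)).restrictScalars S
    let g : (B ⧸ p * J) →ₗ[S] (B ⧸ J) := (Submodule.factor hlt.le).restrictScalars S
    rw [locLength_add Q f g, ih hJ, locLength_quotient_prime h Q hpm hp0, countOver_mul Q hp0 hJ,
      Nat.cast_add]
    · rw [injective_iff_map_eq_zero]
      intro b hb
      obtain ⟨b, rfl⟩ := Ideal.Quotient.mk_surjective b
      have hb' : x * b ∈ p * J := (Submodule.Quotient.mk_eq_zero _).1 hb
      by_contra hbp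
      have hbp' : b ∉ p := fun hh => hbp (Ideal.Quotient.eq_zero_iff_mem.2 hh)
      obtain ⟨c, q, hq, hc⟩ := hpm.exists_inv hbp'
      apply hx
      rw [← mul_one x, ← hc, mul_add, mul_left_comm]
      exact add_mem (Ideal.mul_mem_left _ c hb') (mul_comm x q ▸ Ideal.mul_mem_mul hq hxJ)
    · exact Submodule.factor_surjective hlt.le
    · intro y
      obtain ⟨y, rfl⟩ := Ideal.Quotient.mk_surjective y
      constructor
      · intro hy
        have hy' : y ∈ J := (Submodule.Quotient.mk_eq_zero J).1 hy
        rw [← hspan] at hy'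
        obtain ⟨z, hz, w, hw, rfl⟩ := Submodule.mem_sup.1 hy'
        obtain ⟨b, rfl⟩ := Ideal.mem_span_singleton'.1 hz
        refine ⟨Ideal.Quotient.mk p b, (Submodule.Quotient.eq _).2 ?_⟩
        rw [LinearMap.mulLeft_apply, mul_comm b, sub_add_cancel_left]
        exact neg_mem hw
      · rintro ⟨b, hb⟩
        obtain ⟨b, rfl⟩ := Ideal.Quotient.mk_surjective b
        rw [← hb]
        exact (Submodule.Quotient.mk_eq_zero J).2 (J.mul_mem_right b hxJ)

end CountOver
end PlaneCurve
end

noncomputable section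

namespace PlaneCurve

/-! ### Additivity of colengths. -/

section Quotients

variable {S : Type*} [CommRing S] (Q : Ideal S) [Q.IsPrime]

theorem locLength_quotient_comp {L M N : Type*} [AddCommGroup L] [Module S L] [AddCommGroup M]
    [Module S M] [AddCommGroup N] [Module S N] (f : N →ₗ[S] M) (g : M →ₗ[S] L)
    (hg : Function.Injective g) : locLength Q (L ⧸ LinearMap.range (g ∘ₗ f)) =
      locLength Q (M ⧸ LinearMap.range f) + locLength Q (L ⧸ LinearMap.range g) := by
  have hle : LinearMap.range (g ∘ₗ f) ≤ LinearMap.range g := LinearMap.range_comp_le_range f g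
  have hle' : LinearMap.range f ≤ (LinearMap.range (g ∘ₗ f)).comap g := by
    rintro _ ⟨x, rfl⟩
    exact ⟨x, rfl⟩
  refine locLength_add Q (Submodule.mapQ _ _ g hle') (Submodule.factor hle) ?_
    (Submodule.factor_surjective hle) ?_
  · rw [injective_iff_map_eq_zero]
    intro x hx
    obtain ⟨x, rfl⟩ := Submodule.Quotient.mk_surjective _ x
    obtain ⟨y, hy⟩ := (Submodule.Quotient.mk_eq_zero _).1 hx
    exact (Submodule.Quotient.mk_eq_zero _).2 ⟨y, hg hy⟩
  · intro x
    obtain ⟨x, rfl⟩ := Submodule.Quotient.mk_surjective _ x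
    constructor
    · intro hx
      obtain ⟨y, rfl⟩ := (Submodule.Quotient.mk_eq_zero (LinearMap.range g)).1 hx
      exact ⟨Submodule.Quotient.mk y, rfl⟩
    · rintro ⟨y, hy⟩
      obtain ⟨y, rfl⟩ := Submodule.Quotient.mk_surjective _ y
      rw [← hy]
      exact (Submodule.Quotient.mk_eq_zero (LinearMap.range g)).2 ⟨y, rfl⟩

/-- The colength in `M` of `i (f N) = g (i N)` is computed along `N` and along `g M`. The colength
of `N` in `M` occurs in both results and, being finite, cancels. -/
theorem locLength_quotient_range_eq {M N : Type*} [AddCommGroup M]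
    [Module S M] [AddCommGroup N] [Module S N] (i : N →ₗ[S] M) (hi : Function.Injective i)
    (f : N →ₗ[S] N) (g : M →ₗ[S] M) (hg : Function.Injective g) (h : i ∘ₗ f = g ∘ₗ i)
    (hfin : locLength Q (M ⧸ LinearMap.range i) ≠ ⊤) :
    locLength Q (N ⧸ LinearMap.range f) = locLength Q (M ⧸ LinearMap.range g) := by
  have h1 := locLength_quotient_comp Q f i hi
  rw [h, locLength_quotient_comp Q i g hg, add_comm] at h1
  exact (ENat.add_left_injective_of_ne_top hfin h1).symm

variable {D : Type*} [CommRing D] [Algebra S D]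

theorem locLength_quotient_span_singleton (a : D) : locLength Q (D ⧸ Ideal.span {a}) =
    locLength Q (D ⧸ LinearMap.range (LinearMap.mulLeft S a)) := by
  refine locLength_congr Q ((Submodule.Quotient.restrictScalarsEquiv S (Ideal.span {a})).symm ≪≫ₗ
    Submodule.quotEquivOfEq _ _ ?_)
  ext x
  rw [Submodule.restrictScalars_mem, Ideal.mem_span_singleton', LinearMap.mem_range]
  simp [mul_comm]

theorem locLength_quotient_mul {a : D} (ha : IsLeftRegular a) (b : D) :
    locLength Q (D ⧸ Ideal.span {a * b}) =
      locLength Q (D ⧸ Ideal.span {a}) + locLength Q (D ⧸ Ideal.span {b}) := by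
  rw [locLength_quotient_span_singleton, locLength_quotient_span_singleton,
    locLength_quotient_span_singleton, add_comm, ← locLength_quotient_comp Q _ _ ha,
    LinearMap.mulLeft_mul]

theorem locLength_quotient_span_pair (hsurj : Function.Surjective (algebraMap S D)) {g : S}
    (hker : RingHom.ker (algebraMap S D) = Ideal.span {g}) (h : S) :
    locLength Q (D ⧸ Ideal.span {algebraMap S D h}) = locLength Q (S ⧸ Ideal.span {g, h}) := by
  let φ : S →ₗ[S] (D ⧸ Ideal.span {algebraMap S D h}) := Algebra.linearMap S _
  have hφ : Function.Surjective φ := by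
    intro x
    obtain ⟨x, rfl⟩ := Ideal.Quotient.mk_surjective x
    obtain ⟨y, rfl⟩ := hsurj x
    exact ⟨y, rfl⟩
  have hkerφ : LinearMap.ker φ = Ideal.span {g, h} := by
    ext x
    have h1 : x ∈ LinearMap.ker φ ↔ algebraMap S D x ∈ Ideal.span {algebraMap S D h} :=
      Ideal.Quotient.eq_zero_iff_mem
    rw [h1, Ideal.mem_span_singleton', Ideal.mem_span_pair]
    constructor
    · rintro ⟨d, hd⟩
      obtain ⟨b, rfl⟩ := hsurj d
      have h2 : x - b * h ∈ RingHom.ker (algebraMap S D) := by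
        rw [RingHom.mem_ker, map_sub, map_mul, hd, sub_self]
      rw [hker, Ideal.mem_span_singleton'] at h2
      obtain ⟨a, ha⟩ := h2
      exact ⟨a, b, by rw [ha]; ring⟩
    · rintro ⟨a, b, rfl⟩
      have h2 : g ∈ RingHom.ker (algebraMap S D) := hker ▸ Ideal.mem_span_singleton_self g
      rw [RingHom.mem_ker] at h2
      exact ⟨algebraMap S D b, by rw [map_add, map_mul, map_mul, h2, mul_zero, zero_add]⟩
  exact (locLength_congr Q (Submodule.quotEquivOfEq _ _ hkerφ.symm ≪≫ₗ
    φ.quotKerEquivOfSurjective hφ)).symm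

/-- Multiplicativity of `locLength Q (S ⧸ (g, h))` in `g`. -/
theorem locLength_quotient_pair_mul {a b h : S} (ha : ∀ x, h ∣ a * x → h ∣ x) :
    locLength Q (S ⧸ Ideal.span {h, a * b}) =
      locLength Q (S ⧸ Ideal.span {h, a}) + locLength Q (S ⧸ Ideal.span {h, b}) := by
  have hsurj : Function.Surjective (algebraMap S (S ⧸ Ideal.span {h})) :=
    Ideal.Quotient.mk_surjective
  have hker : RingHom.ker (algebraMap S (S ⧸ Ideal.span {h})) = Ideal.span {h} := Ideal.mk_ker
  rw [← locLength_quotient_span_pair Q hsurj hker, ← locLength_quotient_span_pair Q hsurj hker,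
    ← locLength_quotient_span_pair Q hsurj hker, map_mul]
  refine locLength_quotient_mul Q ?_ _
  intro x y hxy
  obtain ⟨x, rfl⟩ := Ideal.Quotient.mk_surjective x
  obtain ⟨y, rfl⟩ := Ideal.Quotient.mk_surjective y
  have h1 : Ideal.Quotient.mk (Ideal.span {h}) (a * x) = Ideal.Quotient.mk _ (a * y) := by
    rw [map_mul, map_mul]
    exact hxy
  rw [Ideal.Quotient.eq, ← mul_sub, Ideal.mem_span_singleton] at h1
  exact Ideal.Quotient.eq.2 (Ideal.mem_span_singleton.2 (ha _ h1))

/-- Multiplication by `a` kills the kernel of `S / (h, a * b) → S / (h, b)`, and `a` is a unit at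
`Q`: a component that misses the point does not count. -/
theorem locLength_quotient_pair_mul_of_notMem {a b h : S} (ha : a ∉ Q) :
    locLength Q (S ⧸ Ideal.span {h, a * b}) = locLength Q (S ⧸ Ideal.span {h, b}) := by
  have hle : Ideal.span {h, a * b} ≤ Ideal.span {h, b} := by
    rw [Ideal.span_le]
    rintro x (rfl | rfl)
    · exact Ideal.subset_span (by simp)
    · exact Ideal.mul_mem_left _ _ (Ideal.subset_span (by simp))
  rw [locLength_add Q (LinearMap.ker (Submodule.factor hle)).subtype (Submodule.factor hle)
    (Submodule.injective_subtype _) (Submodule.factor_surjective hle)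
    (LinearMap.exact_subtype_ker_map _), locLength_eq_zero Q ha, zero_add]
  rintro ⟨m, hm⟩
  obtain ⟨m, rfl⟩ := Ideal.Quotient.mk_surjective m
  have hm' : m ∈ Ideal.span {h, b} := (Submodule.Quotient.mk_eq_zero _).1 hm
  refine Subtype.ext ((Submodule.Quotient.mk_eq_zero (Ideal.span {h, a * b})).2 ?_)
  obtain ⟨c, d, rfl⟩ := Ideal.mem_span_pair.1 hm'
  exact Ideal.mem_span_pair.2 ⟨a * c, d, by dsimp only; rw [smul_eq_mul]; ring⟩

end Quotients

/-! ### Comparison of a ring with its normalization. -/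

section Normalization

variable {k S R B : Type*} [Field k] [CommRing S] [CommRing R] [CommRing B] [IsDedekindDomain B]
  [Algebra k S] [Algebra S R] [Algebra k B] [Algebra S B] [IsScalarTower k S B] [Algebra R B]
  [IsScalarTower S R B]

/-- The ideal of elements `b` of `B` with `b B ⊆ R`. -/
def conductorOf (R B : Type*) [CommRing R] [CommRing B] [Algebra R B] : Ideal B where
  carrier := {b | ∀ t : B, b * t ∈ (algebraMap R B).range}
  zero_mem' t := by simp
  add_mem' ha hb t := by
    rw [add_mul]
    exact add_mem (ha t) (hb t)
  smul_mem' c x hx t := by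
    rw [smul_eq_mul, mul_assoc, mul_left_comm]
    exact hx _

omit [IsDedekindDomain B] in
theorem mem_conductorOf {b : B} :
    b ∈ conductorOf R B ↔ ∀ t : B, b * t ∈ (algebraMap R B).range := Iff.rfl

-- Finitely many generators of `B` have a common denominator, namely the product of their
-- denominators.
omit [IsDedekindDomain B] in
theorem exists_algebraMap_mem_conductorOf [IsDomain R] [Module.Finite R B]
    (h : ∀ b : B, ∃ r : R, r ≠ 0 ∧ algebraMap R B r * b ∈ (algebraMap R B).range) :
    ∃ d : R, d ≠ 0 ∧ algebraMap R B d ∈ conductorOf R B := by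
  classical
  obtain ⟨s, hs⟩ := Module.Finite.fg_top (R := R) (M := B)
  choose r hr0 hr using h
  refine ⟨∏ b ∈ s, r b, Finset.prod_ne_zero_iff.2 fun b _ => hr0 b, fun t => ?_⟩
  have ht : t ∈ Submodule.span R (s : Set B) := hs ▸ Submodule.mem_top
  induction ht using Submodule.span_induction with
  | mem b hb =>
    rw [← Finset.prod_erase_mul s r hb, map_mul, mul_assoc]
    exact mul_mem ⟨_, rfl⟩ (hr b)
  | zero => simp
  | add x y _ _ hx hy =>
    rw [mul_add]
    exact add_mem hx hy
  | smul c x _ hx =>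
    rw [Algebra.smul_def, mul_left_comm]
    exact mul_mem ⟨_, rfl⟩ hx

/-- If `d` is a nonzero element of the conductor, `B / R` is a quotient of `B / dB`, whose local
length is a number of prime factors. -/
theorem locLength_normalization_quotient_ne_top (hres : HasResidueField k B) (Q : Ideal S)
    [Q.IsMaximal] [IsDomain R] (hinj : Function.Injective (algebraMap R B))
    {d : R} (hd : d ≠ 0) (hdc : algebraMap R B d ∈ conductorOf R B) :
    locLength Q (B ⧸ LinearMap.range (Algebra.linearMap R B |>.restrictScalars S)) ≠ ⊤ := by
  have hd' : Ideal.span {algebraMap R B d} ≠ ⊥ := by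
    rw [Ne, Ideal.span_singleton_eq_bot]
    exact fun h => hd (hinj (h.trans (map_zero _).symm))
  refine ne_top_of_le_ne_top (b := locLength Q (B ⧸ Ideal.span {algebraMap R B d})) ?_ ?_
  · rw [locLength_quotient_ideal hres Q hd']
    exact ENat.natCast_ne_top _
  · rw [locLength_quotient_span_singleton]
    have hle : LinearMap.range (LinearMap.mulLeft S (algebraMap R B d)) ≤
        LinearMap.range (Algebra.linearMap R B |>.restrictScalars S) := by
      rintro _ ⟨x, rfl⟩
      obtain ⟨y, hy⟩ := hdc x
      exact ⟨y, hy⟩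
    exact locLength_le_of_surjective Q _ (Submodule.factor_surjective hle)

/-- Multiplication by `a` acts on `R` and on `B`, and `B / R` has finite length at `Q`, so the two
cokernels have equal length. This moves intersection numbers from a singular curve to its
normalization. -/
theorem locLength_quotient_normalization (hres : HasResidueField k B) (Q : Ideal S)
    [Q.IsMaximal] [IsDomain R] [Module.Finite R B] (hinj : Function.Injective (algebraMap R B))
    (h : ∀ b : B, ∃ r : R, r ≠ 0 ∧ algebraMap R B r * b ∈ (algebraMap R B).range)
    {a : R} (ha : a ≠ 0) :
    locLength Q (R ⧸ Ideal.span {a}) = countOver Q (Ideal.span {algebraMap R B a}) := by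
  have ha' : algebraMap R B a ≠ 0 := fun h => ha (hinj (h.trans (map_zero _).symm))
  obtain ⟨d, hd, hdc⟩ := exists_algebraMap_mem_conductorOf h
  rw [← locLength_quotient_ideal hres Q (by rwa [Ne, Ideal.span_singleton_eq_bot]),
    locLength_quotient_span_singleton, locLength_quotient_span_singleton]
  exact locLength_quotient_range_eq Q (Algebra.linearMap R B |>.restrictScalars S) hinj _ _
    (mul_right_injective₀ ha') (by ext x; simp)
    (locLength_normalization_quotient_ne_top hres Q hinj hd hdc)

end Normalization
end PlaneCurve
end

noncomputable section

namespace PlaneCurve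

open Polynomial

/-! ### Orders of vanishing along polynomial approximations of a branch. -/

section Order

variable {k : Type*} [Field k]

theorem bivariate_induction {motive : k[X][X] → Prop} (hC : ∀ c : k, motive (C (C c)))
    (hX : motive (C X)) (hY : motive X) (hadd : ∀ a b, motive a → motive b → motive (a + b))
    (hmul : ∀ a b, motive a → motive b → motive (a * b)) (a : k[X][X]) : motive a := by
  have hpow (b : k[X][X]) (hb : motive b) (n : ℕ) : motive (b ^ n) := by
    induction n with
    | zero => simpa using hC 1
    | succ n ih => exact pow_succ b n ▸ hmul _ _ ih hb
  have hC' (b : k[X]) : motive (C b) := by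
    induction b using Polynomial.induction_on' with
    | add p q hp hq => exact C_add (R := k[X]) ▸ hadd _ _ hp hq
    | monomial n c =>
      rw [← C_mul_X_pow_eq_monomial, C_mul, C_pow]
      exact hmul _ _ (hC c) (hpow _ hX n)
  induction a using Polynomial.induction_on' with
  | add p q hp hq => exact hadd _ _ hp hq
  | monomial n c =>
    rw [← C_mul_X_pow_eq_monomial]
    exact hmul _ _ (hC' c) (hpow _ hY n)

/-- The chain rule for the restriction of a polynomial to a parametrized curve. -/
theorem derivative_algHom (Dx : Derivation k k[X][X] k[X][X]) (hX : Dx (C X) = 1) (hY : Dx X = 0)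
    (ψ : k[X][X] →ₐ[k] k[X]) (a : k[X][X]) : derivative (ψ a) =
      ψ (Dx a) * derivative (ψ (C X)) + ψ (derivative a) * derivative (ψ X) := by
  have hCC (c : k) : (C (C c) : k[X][X]) = algebraMap k _ c := rfl
  induction a using bivariate_induction with
  | hC c =>
    rw [hCC, AlgHom.commutes, Derivation.map_algebraMap, ← hCC, derivative_C, map_zero,
      ← C_eq_algebraMap, derivative_C]
    simp
  | hX => simp [hX]
  | hY => simp [hY]
  | hadd a b ha hb =>
    rw [map_add, map_add, map_add, map_add, map_add, ha, hb, map_add]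
    ring
  | hmul a b ha hb =>
    rw [map_mul, derivative_mul, derivative_mul, Derivation.leibniz, ha, hb]
    simp only [map_add, map_mul, smul_eq_mul]
    ring

theorem emultiplicity_X_derivative [CharZero k] {G : k[X]} (h : X ∣ G) (hG : G ≠ 0) :
    emultiplicity X (derivative G) + 1 = emultiplicity X G := by
  obtain ⟨n, hn⟩ := ENat.ne_top_iff_exists.1 (finiteMultiplicity_iff_emultiplicity_ne_top.1
    (FiniteMultiplicity.of_prime_left prime_X hG))
  obtain ⟨h1, h2⟩ := emultiplicity_eq_coe.1 hn.symm
  obtain ⟨m, rfl⟩ : ∃ m, n = m + 1 := by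
    refine Nat.exists_eq_succ_of_ne_zero ?_
    rintro rfl
    exact h2 (by simpa using h)
  rw [← hn, Nat.cast_add, Nat.cast_one]
  congr 1
  rw [emultiplicity_eq_coe]
  rw [X_pow_dvd_iff] at h1 h2
  constructor <;> rw [X_pow_dvd_iff]
  · intro d hd
    rw [coeff_derivative, h1 _ (by omega), zero_mul]
  · intro hd
    refine h2 fun d hd' => ?_
    rcases Nat.lt_succ_iff_lt_or_eq.1 hd' with h3 | rfl
    · exact h1 d h3
    · have := hd m (by omega)
      rw [coeff_derivative, mul_eq_zero] at this
      exact this.resolve_right (by exact_mod_cast m.succ_ne_zero)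

variable {B : Type*} [CommRing B] [IsDedekindDomain B]

/-- The order of vanishing of `b` at the prime `p`. -/
def ordAt (p : Ideal B) (b : B) : ℕ∞ := emultiplicity p (Ideal.span {b})

theorem le_ordAt_iff {p : Ideal B} {b : B} {n : ℕ} : n ≤ ordAt p b ↔ b ∈ p ^ n := by
  rw [ordAt, ← pow_dvd_iff_le_emultiplicity, Ideal.dvd_iff_le, Ideal.span_singleton_le_iff_mem]

theorem ordAt_ne_top {p : Ideal B} (hp : p.IsMaximal) (hp0 : p ≠ ⊥) {b : B} (hb : b ≠ 0) :
    ordAt p b ≠ ⊤ :=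
  finiteMultiplicity_iff_emultiplicity_ne_top.1 (FiniteMultiplicity.of_prime_left
    (Ideal.prime_of_isPrime hp0 hp.isPrime) (by simpa using hb))

theorem ordAt_eq_count {p : Ideal B} (hp : p.IsMaximal) (hp0 : p ≠ ⊥) {b : B} (hb : b ≠ 0) :
    ordAt p b = (UniqueFactorizationMonoid.normalizedFactors (Ideal.span {b})).count p := by
  rw [ordAt, UniqueFactorizationMonoid.emultiplicity_eq_count_normalizedFactors
    (Ideal.prime_of_isPrime hp0 hp.isPrime).irreducible (by simpa using hb), normalize_eq]

theorem ordAt_eq_of_sub_mem {p : Ideal B} {b c : B} {N : ℕ} (h : b - c ∈ p ^ N)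
    (hb : ordAt p b < N) : ordAt p c = ordAt p b := by
  obtain ⟨n, hn⟩ := ENat.ne_top_iff_exists.1 (ne_top_of_lt hb)
  rw [← hn] at hb ⊢
  have hnN : n < N := by exact_mod_cast hb
  have key (m : ℕ) (hm : m ≤ N) : c ∈ p ^ m ↔ b ∈ p ^ m := by
    have := Ideal.pow_le_pow_right hm h
    exact ⟨fun hc => by simpa using add_mem this hc, fun hb => by simpa using sub_mem hb this⟩
  have h1 : n ≤ ordAt p c := by
    rw [le_ordAt_iff, key n hnN.le, ← le_ordAt_iff, hn]
  have h2 : ¬ (n + 1 : ℕ) ≤ ordAt p c := by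
    rw [le_ordAt_iff, key _ hnN, ← le_ordAt_iff, ← hn, Nat.cast_le]
    omega
  refine le_antisymm (not_lt.1 fun h3 => h2 ?_) h1
  rw [Nat.cast_add, Nat.cast_one]
  exact Order.add_one_le_of_lt h3

variable [Algebra k B] {p : Ideal B}

theorem pow_uniformizer_notMem (hp : p.IsMaximal) (hp0 : p ≠ ⊥) {t : B} (ht2 : t ∉ p ^ 2)
    (n : ℕ) : t ^ n ∉ p ^ (n + 1) := by
  have h1 : ordAt p t < 2 := by
    rw [← not_le]
    exact fun h => ht2 (le_ordAt_iff.1 h)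
  rw [← le_ordAt_iff, not_le, ordAt, ← Ideal.span_singleton_pow,
    emultiplicity_pow (Ideal.prime_of_isPrime hp0 hp.isPrime)]
  change (n : ℕ∞) * ordAt p t < _
  calc (n : ℕ∞) * ordAt p t ≤ n * 1 := by
        gcongr
        exact Order.le_of_lt_add_one (by simpa [one_add_one_eq_two] using h1)
    _ < _ := by
        rw [mul_one]
        exact_mod_cast n.lt_succ_self

/-- Write `G = X ^ m * H` with `H` of nonzero constant term: then `H(t)` is not in `p`, while `t ^
m` has order exactly `m`. -/
theorem ordAt_aeval (hp : p.IsMaximal) (hp0 : p ≠ ⊥) {t : B} (ht : t ∈ p) (ht2 : t ∉ p ^ 2)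
    (G : k[X]) : ordAt p (aeval t G) = emultiplicity X G := by
  refine emultiplicity_eq_emultiplicity_iff.2 fun n => ?_
  rw [Ideal.dvd_iff_le, Ideal.span_singleton_le_iff_mem]
  constructor
  · intro h
    by_cases hG : G = 0
    · simp [hG]
    obtain ⟨H, hH, hnd⟩ := (FiniteMultiplicity.of_prime_left (prime_X (R := k)) hG).exists_eq_pow_mul_and_not_dvd
    set m := multiplicity X G
    rw [hH]
    refine dvd_mul_of_dvd_left (pow_dvd_pow _ (not_lt.1 fun hmn => ?_)) _
    have h1 : aeval t H * t ^ m ∈ p ^ (m + 1) := by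
      rw [hH, map_mul, map_pow, aeval_X, mul_comm] at h
      exact Ideal.pow_le_pow_right hmn h
    rcases hp.isPrime.mul_mem_pow _ h1 with h2 | h2
    · rw [X_dvd_iff] at hnd
      rw [← divX_mul_X_add H, map_add, map_mul, aeval_X, aeval_C] at h2
      have h3 := (Ideal.add_mem_iff_right _ (p.mul_mem_left _ ht)).1 h2
      exact hp.ne_top (Ideal.eq_top_of_isUnit_mem _ h3 ((isUnit_iff_ne_zero.2 hnd).map _))
    · exact pow_uniformizer_notMem hp hp0 ht2 m h2
  · rintro ⟨H, rfl⟩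
    rw [map_mul, map_pow, aeval_X]
    exact Ideal.mul_mem_right _ _ (Ideal.pow_mem_pow ht n)

/-- The Taylor expansion in the uniformizer `t`, truncated at order `N`. Each new coefficient is
found in `k`, the residue field. -/
theorem exists_sub_aeval_mem_pow (hres : HasResidueField k B) (hp : p.IsMaximal) (hp0 : p ≠ ⊥)
    {t : B} (ht : t ∈ p) (ht2 : t ∉ p ^ 2) (b : B) (N : ℕ) :
    ∃ G : k[X], b - aeval t G ∈ p ^ N := by
  induction N with
  | zero => exact ⟨0, by simp⟩
  | succ N ih =>
    obtain ⟨G, hG⟩ := ih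
    have := hp.isPrime
    obtain ⟨d, e, he, hd⟩ := Ideal.exists_mul_add_mem_pow_succ hp0 (t ^ N) _
      (Ideal.pow_mem_pow ht N) (pow_uniformizer_notMem hp hp0 ht2 N) hG
    obtain ⟨c, hc⟩ := hres p hp hp0 d
    refine ⟨G + C c * X ^ N, ?_⟩
    have h1 : b - aeval t (G + C c * X ^ N) = t ^ N * (d - algebraMap k B c) + e := by
      rw [map_add, map_mul, map_pow, aeval_X, aeval_C, ← sub_sub, ← hd]
      ring
    rw [h1, pow_succ p N]
    exact add_mem (Ideal.mul_mem_mul (Ideal.pow_mem_pow ht N) hc) (pow_succ p N ▸ he)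

/-- Polynomial parametrizations of arbitrary precision of a branch of a plane curve. -/
theorem exists_parametrization (hres : HasResidueField k B) (hp : p.IsMaximal) (hp0 : p ≠ ⊥)
    {t : B} (ht : t ∈ p) (ht2 : t ∉ p ^ 2) (α : k[X][X] →ₐ[k] B) (N : ℕ) :
    ∃ ψ : k[X][X] →ₐ[k] k[X], ∀ a, α a - aeval t (ψ a) ∈ p ^ N := by
  obtain ⟨x, hx⟩ := exists_sub_aeval_mem_pow hres hp hp0 ht ht2 (α (C X)) N
  obtain ⟨y, hy⟩ := exists_sub_aeval_mem_pow hres hp hp0 ht ht2 (α X) N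
  refine ⟨aevalAeval x y, fun a => ?_⟩
  have hCC (c : k) : (C (C c) : k[X][X]) = algebraMap k _ c := rfl
  induction a using bivariate_induction with
  | hC c =>
    rw [hCC, AlgHom.commutes, AlgHom.commutes, AlgHom.commutes, sub_self]
    exact zero_mem _
  | hX => simpa using hx
  | hY => simpa using hy
  | hadd a b ha hb => simpa [add_sub_add_comm] using add_mem ha hb
  | hmul a b ha hb =>
    rw [map_mul, map_mul, map_mul, ← sub_add_sub_cancel _ (aeval t (aevalAeval x y a) * α b),
      ← sub_mul, ← mul_sub]
    exact add_mem (Ideal.mul_mem_right _ _ ha) (Ideal.mul_mem_left _ _ hb)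

/-- The truncated parametrization sees all orders below the precision `N` exactly, in both
directions, so that no completion at `p` is required. -/
theorem exists_parametrization_ordAt (hres : HasResidueField k B) (hp : p.IsMaximal) (hp0 : p ≠ ⊥)
    (α : k[X][X] →ₐ[k] B) (N : ℕ) : ∃ ψ : k[X][X] →ₐ[k] k[X],
      (∀ b, ordAt p (α b) < N → emultiplicity X (ψ b) = ordAt p (α b)) ∧
      (∀ b, emultiplicity X (ψ b) < N → ordAt p (α b) = emultiplicity X (ψ b)) := by
  obtain ⟨t, ht, ht2⟩ := Ideal.exists_mem_pow_notMem_pow_succ p hp0 hp.ne_top 1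
  rw [pow_one] at ht
  obtain ⟨ψ, hψ⟩ := exists_parametrization hres hp hp0 ht ht2 α N
  refine ⟨ψ, fun b hb => ?_, fun b hb => ?_⟩
  · rw [← ordAt_aeval hp hp0 ht ht2, ordAt_eq_of_sub_mem (hψ b) hb]
  · rw [← ordAt_aeval hp hp0 ht ht2] at hb ⊢
    refine ordAt_eq_of_sub_mem ?_ hb
    rw [← neg_sub]
    exact neg_mem (hψ b)

theorem emultiplicity_derivative_algHom [CharZero k] {α : k[X][X] →ₐ[k] B}
    {ψ : k[X][X] →ₐ[k] k[X]} {b : k[X][X]} (hb : α b ∈ p) (hn : ordAt p (α b) ≠ ⊤)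
    (h : emultiplicity X (ψ b) = ordAt p (α b)) :
    emultiplicity X (derivative (ψ b)) + 1 = ordAt p (α b) := by
  rw [← h] at hn ⊢
  refine emultiplicity_X_derivative ?_ ?_
  · rw [← pow_one (X : k[X]), pow_dvd_iff_le_emultiplicity, h, le_ordAt_iff, pow_one]
    exact hb
  · rintro h0
    rw [h0, emultiplicity_zero] at hn
    exact hn rfl

theorem derivative_algHom_X_sub_C (ψ : k[X][X] →ₐ[k] k[X]) (c : k) :
    derivative (ψ (C (X - C c))) = derivative (ψ (C X)) := by
  have hCC : (C (C c) : k[X][X]) = algebraMap k _ c := rfl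
  rw [C_sub, map_sub, hCC, AlgHom.commutes]
  simp

variable [CharZero k] (Dx : Derivation k k[X][X] k[X][X]) (hX : Dx (C X) = 1) (hY : Dx X = 0)
  (hres : HasResidueField k B) (hp : p.IsMaximal) (hp0 : p ≠ ⊥) (α : k[X][X] →ₐ[k] B)
  {F : k[X][X]} {c : k} (hc : α (C (X - C c)) ∈ p) (hc0 : α (C (X - C c)) ≠ 0)

include hX hY hres hp hp0 hc hc0

/-- Along a branch on which `F_Y` vanishes, the chain rule reads `F' = F_X x'`, and differentiation
lowers the orders of `F` and of `x - c` by one each. -/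
theorem ordAt_eq_of_derivative_eq_zero (hF : α F ∈ p) (hF0 : α F ≠ 0)
    (hF' : α (derivative F) = 0) :
    ordAt p (α F) = ordAt p (α (Dx F)) + ordAt p (α (C (X - C c))) := by
  have hFt := ordAt_ne_top hp hp0 hF0
  have hct := ordAt_ne_top hp hp0 hc0
  obtain ⟨a, ha⟩ := ENat.ne_top_iff_exists.1 hFt
  obtain ⟨e, he⟩ := ENat.ne_top_iff_exists.1 hct
  -- This precision exceeds `a` and `e`, so that `ψ` gives both orders exactly and the `F_Y` term,
  -- zero on the branch, has order greater than `a`.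
  obtain ⟨ψ, key, key'⟩ := exists_parametrization_ordAt hres hp hp0 α (a + e + 1)
  have hF1 := emultiplicity_derivative_algHom hF hFt (key F (by
    rw [← ha]
    exact_mod_cast (by omega)))
  have hc1 := emultiplicity_derivative_algHom hc hct (key _ (by
    rw [← he]
    exact_mod_cast (by omega)))
  have hchain := derivative_algHom Dx hX hY ψ F
  have hF'm : ((a + e + 1 : ℕ) : ℕ∞) ≤ emultiplicity X (ψ (derivative F) * derivative (ψ X)) := by
    refine le_trans (not_lt.1 fun h => ?_) (emultiplicity_le_emultiplicity_of_dvd_right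
      (dvd_mul_right _ _))
    have h1 := key' _ h
    rw [hF', ordAt, Ideal.span_singleton_zero, ← Ideal.zero_eq_bot, emultiplicity_zero] at h1
    exact not_top_lt (h1.symm ▸ h)
  have hlt : emultiplicity X (derivative (ψ F)) <
      emultiplicity X (-(ψ (derivative F) * derivative (ψ X))) := by
    rw [emultiplicity_neg]
    refine lt_of_lt_of_le ?_ hF'm
    refine lt_of_le_of_lt le_self_add (hF1.trans_lt ?_)
    rw [← ha]
    exact_mod_cast (by omega)
  -- The `F_Y` term has higher order than `(ψ F)'`, so removing it leaves the order unchanged.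
  have hprod : emultiplicity X (ψ (Dx F) * derivative (ψ (C X))) =
      emultiplicity X (derivative (ψ F)) := by
    rw [← emultiplicity_add_of_gt hlt, hchain]
    congr 1
    ring
  rw [emultiplicity_mul prime_X, ← derivative_algHom_X_sub_C ψ c] at hprod
  have hsum : ordAt p (α F) = emultiplicity X (ψ (Dx F)) + ordAt p (α (C (X - C c))) := by
    rw [← hF1, ← hc1, ← hprod, add_assoc]
  rw [hsum, key' (Dx F)]
  refine lt_of_le_of_lt le_self_add (hsum.symm.trans_lt ?_)
  rw [← ha]
  exact_mod_cast (by omega)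

/-- Along a branch of `F = 0` the chain rule gives `F_X x' = -F_Y y'`, and `x'` has order one less
than `x - c`. -/
theorem ordAt_derivative_add_one_le (hF : α F = 0) (hF' : α (derivative F) ≠ 0) :
    ordAt p (α (derivative F)) + 1 ≤ ordAt p (α (Dx F)) + ordAt p (α (C (X - C c))) := by
  have hFt := ordAt_ne_top hp hp0 hF'
  have hct := ordAt_ne_top hp hp0 hc0
  obtain ⟨a, ha⟩ := ENat.ne_top_iff_exists.1 hFt
  obtain ⟨e, he⟩ := ENat.ne_top_iff_exists.1 hct
  obtain ⟨ψ, key, key'⟩ := exists_parametrization_ordAt hres hp hp0 α (a + e + 1)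
  have hc1 := emultiplicity_derivative_algHom hc hct (key _ (by
    rw [← he]
    exact_mod_cast (by omega)))
  have hF'1 := key (derivative F) (by
    rw [← ha]
    exact_mod_cast (by omega))
  have hchain := derivative_algHom Dx hX hY ψ F
  have hFm : X ^ (a + e + 1) ∣ ψ F := by
    rw [pow_dvd_iff_le_emultiplicity]
    refine not_lt.1 fun h => ?_
    have h1 := key' _ h
    rw [hF, ordAt, Ideal.span_singleton_zero, ← Ideal.zero_eq_bot, emultiplicity_zero] at h1
    exact not_top_lt (h1.symm ▸ h)
  have h1 : X ^ a ∣ derivative (ψ F) := by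
    rw [X_pow_dvd_iff] at hFm ⊢
    intro d hd
    rw [coeff_derivative, hFm _ (by omega), zero_mul]
  have h2 : X ^ a ∣ ψ (derivative F) := by
    rw [pow_dvd_iff_le_emultiplicity, hF'1, ha]
  have h3 : X ^ a ∣ ψ (Dx F) * derivative (ψ (C X)) := by
    rw [← sub_eq_iff_eq_add.2 hchain]
    exact dvd_sub h1 (dvd_mul_of_dvd_left h2 _)
  rw [pow_dvd_iff_le_emultiplicity, emultiplicity_mul prime_X, ← derivative_algHom_X_sub_C ψ c]
    at h3
  rw [← hc1, ← add_assoc, ← ha]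
  gcongr
  -- If `ψ (Dx F)` vanishes to the full precision, so does `α (Dx F)`, and this alone exceeds the
  -- bound `a + 1`.
  rcases lt_or_ge (emultiplicity X (ψ (Dx F))) (a + e + 1 : ℕ) with h | h
  · rwa [key' _ h]
  · have h' : ((a + e + 1 : ℕ) : ℕ∞) ≤ ordAt p (α (Dx F)) :=
      not_lt.1 fun h' => (key _ h' ▸ h).not_gt h'
    refine le_trans ?_ (h'.trans le_self_add)
    exact_mod_cast (by omega)

end Order
end PlaneCurve
end

noncomputable section

namespace PlaneCurve

open Polynomial nonZeroDivisors

/-! ### Normalization of a domain finite over an integrally closed base. -/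

section FiniteOverLine

attribute [local instance] FractionRing.liftAlgebra FractionRing.isScalarTower_liftAlgebra

variable (P R : Type*) [CommRing P] [IsDomain P] [CommRing R] [IsDomain R] [Algebra P R]
  [Module.Finite P R] [FaithfulSMul P R]

instance : FaithfulSMul P (FractionRing R) := by
  rw [faithfulSMul_iff_algebraMap_injective, IsScalarTower.algebraMap_eq P R (FractionRing R)]
  exact (IsFractionRing.injective R (FractionRing R)).comp
    (FaithfulSMul.algebraMap_injective P R)

omit [FaithfulSMul P R] in
theorem exists_dvd_algebraMap {r : R} (hr : r ≠ 0) : ∃ p : P, p ≠ 0 ∧ r ∣ algebraMap P R p :=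
  (Algebra.IsAlgebraic.isAlgebraic (R := P) r).exists_nonzero_dvd (mem_nonZeroDivisors_of_ne_zero hr)

/-- Every nonzero element of `R` is algebraic over `P`, so it divides a nonzero element of `P`:
denominators can be taken in `P`. -/
instance : IsLocalization (Algebra.algebraMapSubmonoid R P⁰) (FractionRing R) where
  map_units := by
    rintro ⟨_, p, hp, rfl⟩
    refine IsUnit.mk0 _ ?_
    rw [← IsScalarTower.algebraMap_apply]
    exact (map_ne_zero_iff _ (FaithfulSMul.algebraMap_injective _ _)).2 (nonZeroDivisors.ne_zero hp)
  surj z := by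
    obtain ⟨a, b, hb, rfl⟩ := IsFractionRing.div_surjective (A := R) z
    obtain ⟨p, hp, c, hc⟩ := exists_dvd_algebraMap P R (nonZeroDivisors.ne_zero hb)
    refine ⟨⟨a * c, ⟨_, p, mem_nonZeroDivisors_of_ne_zero hp, rfl⟩⟩, ?_⟩
    have hb' : algebraMap R (FractionRing R) b ≠ 0 :=
      (map_ne_zero_iff _ (IsFractionRing.injective R _)).2 (nonZeroDivisors.ne_zero hb)
    dsimp only
    rw [hc, map_mul, map_mul]
    field_simp
  exists_of_eq h := ⟨1, by simpa using IsFractionRing.injective R _ h⟩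

instance : FiniteDimensional (FractionRing P) (FractionRing R) :=
  Module.Finite.of_isLocalization P R P⁰

instance : IsIntegralClosure (Normalization R) P (FractionRing R) where
  algebraMap_injective := Subtype.val_injective
  isIntegral_iff {x} := by
    have h : IsIntegral P x ↔ IsIntegral R x :=
      ⟨fun h => h.tower_top, fun h => isIntegral_trans x h⟩
    rw [h]
    exact IsIntegralClosure.isIntegral_iff (A := Normalization R)

instance : FaithfulSMul P (Normalization R) := by
  rw [faithfulSMul_iff_algebraMap_injective]
  intro x y hxy
  apply FaithfulSMul.algebraMap_injective P (FractionRing R)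
  exact congrArg Subtype.val hxy

variable [CharZero P]

theorem isDedekindDomain_normalization (P R : Type*) [CommRing P] [CommRing R] [IsDomain R]
    [Algebra P R] [Module.Finite P R] [FaithfulSMul P R] [CharZero P] [IsDedekindDomain P] :
    IsDedekindDomain (Normalization R) :=
  IsIntegralClosure.isDedekindDomain P (FractionRing P) (FractionRing R) (Normalization R)

instance [IsIntegrallyClosed P] [IsNoetherianRing P] : Module.Finite P (Normalization R) :=
  IsIntegralClosure.finite P (FractionRing P) (FractionRing R) (Normalization R)

theorem finite_normalization [IsIntegrallyClosed P] [IsNoetherianRing P] :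
    Module.Finite R (Normalization R) :=
  Module.Finite.of_restrictScalars_finite P R (Normalization R)

end FiniteOverLine

section Normalization

variable (R : Type*) [CommRing R] [IsDomain R]

omit [IsDomain R] in
theorem normalization_algebraMap_injective :
    Function.Injective (algebraMap R (Normalization R)) :=
  FaithfulSMul.algebraMap_injective R (Normalization R)

variable {R}

theorem exists_mul_mem_range (b : Normalization R) : ∃ r : R, r ≠ 0 ∧
    algebraMap R (Normalization R) r * b ∈ (algebraMap R (Normalization R)).range := by
  obtain ⟨a, d, hd, h⟩ := IsFractionRing.div_surjective (A := R) (b : FractionRing R)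
  have hd' : algebraMap R (FractionRing R) d ≠ 0 :=
    (map_ne_zero_iff _ (IsFractionRing.injective R _)).2 (nonZeroDivisors.ne_zero hd)
  refine ⟨d, nonZeroDivisors.ne_zero hd, a, Subtype.ext ?_⟩
  change algebraMap R (FractionRing R) a = algebraMap R (FractionRing R) d * b
  rw [← h]
  field_simp

end Normalization

/-! ### Residue fields and the different over the affine line. -/

section Line

theorem ne_bot_of_isMaximal (k : Type*) {B : Type*} [Field k] [CommRing B] [IsDomain B]
    [Algebra k[X] B] [Module.Finite k[X] B] [FaithfulSMul k[X] B] {p : Ideal B} (hp : p.IsMaximal) : p ≠ ⊥ := by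
  rintro rfl
  have h : (Ideal.comap (algebraMap k[X] B) ⊥).IsMaximal := Ideal.isMaximal_comap_of_isIntegral_of_isMaximal _
  rw [Ideal.comap_bot_of_injective _ (FaithfulSMul.algebraMap_injective _ _)] at h
  exact Polynomial.not_isField k (Ring.isField_iff_maximal_bot.2 h)

attribute [local instance] FractionRing.liftAlgebra FractionRing.isScalarTower_liftAlgebra

variable {k B : Type*} [Field k] [CommRing B] [Algebra k B]

/-- By the Nullstellensatz `B / p` is finite over `k`, hence equal to it. -/
theorem hasResidueField [IsAlgClosed k] [Algebra.FiniteType k B] : HasResidueField k B := by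
  intro p hp _ b
  let _ := Ideal.Quotient.field p
  have : Module.Finite k (B ⧸ p) := finite_of_finite_type_of_isJacobsonRing k (B ⧸ p)
  obtain ⟨c, hc⟩ := (IsAlgClosed.algebraMap_bijective_of_isIntegral (k := k) (K := B ⧸ p)).2
    (Ideal.Quotient.mk p b)
  exact ⟨c, Ideal.Quotient.eq.1 hc.symm⟩

variable [Algebra k[X] B] [IsScalarTower k k[X] B] [Module.Finite k[X] B] [FaithfulSMul k[X] B]

variable (k B) in
omit [FaithfulSMul k[X] B] in
theorem hasResidueField_of_finite [IsAlgClosed k] : HasResidueField k B := by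
  have : Algebra.FiniteType k B := Algebra.FiniteType.trans (S := k[X]) inferInstance inferInstance
  exact hasResidueField

variable [IsDedekindDomain B] [CharZero k]

omit [Algebra k B] [IsScalarTower k k[X] B] in
/-- The different at a prime, in the tamely ramified case. -/
theorem count_differentIdeal_add_one {p : Ideal B} (hp : p.IsMaximal) {c : k}
    (hc : algebraMap k[X] B (X - C c) ∈ p) :
    (UniqueFactorizationMonoid.normalizedFactors (differentIdeal k[X] B)).count p + 1 =
      (UniqueFactorizationMonoid.normalizedFactors
        (Ideal.span {algebraMap k[X] B (X - C c)})).count p := by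
  have hp0 : p ≠ ⊥ := ne_bot_of_isMaximal k hp
  have hprime := Ideal.prime_of_isPrime hp0 hp.isPrime
  have hXc : X - C c ≠ 0 := X_sub_C_ne_zero c
  have hx0 : algebraMap k[X] B (X - C c) ≠ 0 :=
    (map_ne_zero_iff _ (FaithfulSMul.algebraMap_injective _ _)).2 hXc
  set I := Ideal.span {algebraMap k[X] B (X - C c)} with hI
  have hI0 : I ≠ ⊥ := by simpa [hI] using hx0
  set p₀ : Ideal k[X] := Ideal.span {X - C c} with hp₀
  have hp₀m : p₀.IsMaximal := PrincipalIdealRing.isMaximal_of_irreducible (irreducible_X_sub_C c)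
  have hp₀0 : p₀ ≠ ⊥ := by simpa [hp₀] using hXc
  have hmap : p₀.map (algebraMap k[X] B) = I := by
    rw [hp₀, Ideal.map_span, Set.image_singleton]
  have : Algebra.IsSeparable (FractionRing k[X]) (FractionRing B) := inferInstance
  obtain ⟨Q, hQ, hnd⟩ :=
    (FiniteMultiplicity.of_prime_left hprime (show I ≠ 0 from hI0)).exists_eq_pow_mul_and_not_dvd
  set e := multiplicity p I
  have hcop : IsCoprime (p ^ e) Q := by
    refine IsCoprime.pow_left ?_
    rw [Ideal.isCoprime_iff_sup_eq]
    refine hp.out.2 _ (lt_of_le_of_ne le_sup_left fun h => hnd ?_)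
    rw [Ideal.dvd_iff_le, h]
    exact le_sup_right
  have he : e ≠ 0 := by
    intro h0
    apply hnd
    rw [h0, pow_zero, one_mul] at hQ
    rw [← hQ, Ideal.dvd_iff_le, hI, Ideal.span_singleton_le_iff_mem]
    exact hc
  -- This lower bound holds for any ramification; tameness enters only in the upper bound.
  have h1 : p ^ (e - 1) ∣ differentIdeal k[X] B :=
    pow_sub_one_dvd_differentIdeal k[X] p e hp₀0 (hmap ▸ hQ ▸ dvd_mul_right _ _)
  have h2 : ¬ p ^ e ∣ differentIdeal k[X] B := by
    have hPQ : p ^ e * Q = p₀.map (algebraMap k[X] B) := by rw [hmap, ← hQ]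
    let _ : Algebra (k[X] ⧸ p₀) (B ⧸ p ^ e) := Ideal.Quotient.algebraQuotientOfLEComap (by
      rw [← Ideal.map_le_iff_le_comap, ← hPQ]
      exact Ideal.mul_le_left)
    let _ : Algebra (k[X] ⧸ p₀) (B ⧸ Q) := Ideal.Quotient.algebraQuotientOfLEComap (by
      rw [← Ideal.map_le_iff_le_comap, ← hPQ]
      exact Ideal.mul_le_right)
    have : @IsScalarTower k[X] (k[X] ⧸ p₀) (B ⧸ Q) Algebra.toSMul Algebra.toSMul Algebra.toSMul :=
      .of_algebraMap_eq' rfl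
    have : @IsScalarTower k[X] (k[X] ⧸ p₀) (B ⧸ p ^ e) Algebra.toSMul Algebra.toSMul
      Algebra.toSMul := .of_algebraMap_eq' rfl
    have : Module.Finite (k[X] ⧸ p₀) (B ⧸ Q) := .of_restrictScalars_finite k[X] _ _
    have : Module.Finite (k[X] ⧸ p₀) (B ⧸ p ^ e) := .of_restrictScalars_finite k[X] _ _
    let _ := Ideal.Quotient.field p₀
    have : CharZero (k[X] ⧸ p₀) := charZero_of_injective_algebraMap (algebraMap k (k[X] ⧸ p₀)).injective
    have : Nontrivial (B ⧸ p ^ e) := Ideal.Quotient.nontrivial_iff.2 fun h =>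
      hp.ne_top (top_le_iff.1 (h ▸ Ideal.pow_le_self he))
    let E : (B ⧸ p₀.map (algebraMap k[X] B)) ≃ₐ[k[X] ⧸ p₀] ((B ⧸ p ^ e) × B ⧸ Q) :=
      { __ := (Ideal.quotEquivOfEq hPQ.symm).trans (Ideal.quotientMulEquivQuotientProd _ Q hcop),
        commutes' := Quotient.ind fun _ ↦ rfl }
    -- This idempotent has trace equal to the dimension of `B / p ^ e` over the residue field, which
    -- is nonzero in characteristic 0.
    obtain ⟨y, hy⟩ := Ideal.Quotient.mk_surjective (E.symm (1, 0))
    refine not_dvd_differentIdeal_of_intTrace_not_mem k[X] (p ^ e) Q hPQ y ?_ ?_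
    · have h3 : (E (Ideal.Quotient.mk _ y)).2 = 0 := by rw [hy, AlgEquiv.apply_symm_apply]
      exact Ideal.Quotient.eq_zero_iff_mem.1 h3
    · rw [← Ideal.Quotient.eq_zero_iff_mem, ← Algebra.trace_quotient_eq_of_isDedekindDomain,
        hy, Algebra.trace_eq_of_algEquiv, Algebra.trace_prod_apply, map_zero, add_zero,
        ← map_one (algebraMap (k[X] ⧸ p₀) (B ⧸ p ^ e)), Algebra.trace_algebraMap]
      simpa using Module.finrank_pos.ne'
  have hD0 : differentIdeal k[X] B ≠ ⊥ := by
    rintro h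
    exact h2 (h ▸ dvd_zero _)
  have hcount (J : Ideal B) (hJ : J ≠ ⊥) (n : ℕ) : p ^ n ∣ J ↔
      n ≤ (UniqueFactorizationMonoid.normalizedFactors J).count p := by
    rw [pow_dvd_iff_le_emultiplicity,
      UniqueFactorizationMonoid.emultiplicity_eq_count_normalizedFactors hprime.irreducible hJ,
      normalize_eq, Nat.cast_le]
  rw [hcount _ hD0] at h1 h2
  have h3 : (UniqueFactorizationMonoid.normalizedFactors I).count p = e := by
    refine le_antisymm ?_ ((hcount I hI0 e).1 ⟨Q, hQ⟩)
    rw [← not_lt]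
    intro h
    have h4 := (hcount I hI0 (e + 1)).2 h
    rw [hQ, pow_succ] at h4
    exact hnd ((mul_dvd_mul_iff_left (pow_ne_zero e hp0)).1 h4)
  omega

end Line
end PlaneCurve
end

noncomputable section

namespace PlaneCurve

open Polynomial UniqueFactorizationMonoid

/-! ### Intersection numbers on the normalization and Teissier's formula. -/

section CountEq

variable {S B : Type*} [CommRing S] [CommRing B] [IsDedekindDomain B] [Algebra S B]

theorem countOver_eq_add (Q : Ideal S) {I J K : Ideal B}
    (h : ∀ p : Ideal B, p.IsMaximal → p ≠ ⊥ → p.comap (algebraMap S B) = Q →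
      (normalizedFactors I).count p = (normalizedFactors J).count p +
        (normalizedFactors K).count p) :
    countOver Q I = countOver Q J + countOver Q K := by
  classical
  rw [countOver, countOver, countOver, Multiset.countP_eq_card_filter,
    Multiset.countP_eq_card_filter, Multiset.countP_eq_card_filter, ← Multiset.card_add]
  congr 1
  ext p
  rw [Multiset.count_add, Multiset.count_filter, Multiset.count_filter, Multiset.count_filter]
  split_ifs with hp
  · by_cases hpm : p.IsMaximal ∧ p ≠ ⊥
    · exact h p hpm.1 hpm.2 hp
    · have h0 (I : Ideal B) : (normalizedFactors I).count p = 0 := by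
        refine Multiset.count_eq_zero_of_notMem fun hmem => hpm ?_
        have hpr := prime_of_normalized_factor p hmem
        exact ⟨(Ideal.isPrime_of_prime hpr).isMaximal hpr.ne_zero, hpr.ne_zero⟩
      rw [h0, h0, h0]
  · rfl

end CountEq

theorem surjective_algebraMap_quotient {S : Type*} [CommRing S] (I : Ideal S) :
    Function.Surjective (algebraMap S (S ⧸ I)) :=
  Ideal.Quotient.mk_surjective

theorem ker_algebraMap_quotient {S : Type*} [CommRing S] (I : Ideal S) :
    RingHom.ker (algebraMap S (S ⧸ I)) = I :=
  Ideal.mk_ker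

section Quotient

variable {k D : Type*} [Field k] [CommRing D] [Algebra k[X] D]
  [Algebra k[X][X] D] [IsScalarTower k[X] k[X][X] D] {g : k[X][X]}

omit [Algebra k[X] D] [IsScalarTower k[X] k[X][X] D] in
theorem algebraMap_normalization_ne_zero [IsDomain D]
    (hker : RingHom.ker (algebraMap k[X][X] D) = Ideal.span {g}) {h : k[X][X]} (hh : ¬ g ∣ h) :
    algebraMap k[X][X] (Normalization D) h ≠ 0 := by
  rw [IsScalarTower.algebraMap_apply k[X][X] D,
    map_ne_zero_iff _ (normalization_algebraMap_injective D)]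
  intro h0
  rw [← RingHom.mem_ker, hker, Ideal.mem_span_singleton] at h0
  exact hh h0

omit [Algebra k[X] D] [IsScalarTower k[X] k[X][X] D] in
theorem algebraMap_normalization_eq_zero [IsDomain D]
    (hker : RingHom.ker (algebraMap k[X][X] D) = Ideal.span {g}) {h : k[X][X]} (hh : g ∣ h) :
    algebraMap k[X][X] (Normalization D) h = 0 := by
  rw [IsScalarTower.algebraMap_apply k[X][X] D, show algebraMap k[X][X] D h = 0 from ?_, map_zero]
  rwa [← RingHom.mem_ker, hker, Ideal.mem_span_singleton]

theorem finite_of_ker_eq_span (hsurj : Function.Surjective (algebraMap k[X][X] D))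
    (hker : RingHom.ker (algebraMap k[X][X] D) = Ideal.span {g}) (hg : IsUnit g.leadingCoeff) :
    Module.Finite k[X] D := by
  obtain ⟨u, hu⟩ := hg
  have hm : (C ((u⁻¹ : k[X]ˣ) : k[X]) * g).Monic := by
    rw [Monic, leadingCoeff_mul, leadingCoeff_C, ← hu, Units.inv_mul]
  have := hm.finite_quotient
  have hspan : Ideal.span {C ((u⁻¹ : k[X]ˣ) : k[X]) * g} = Ideal.span {g} :=
    Ideal.span_singleton_mul_left_unit (isUnit_C.2 (Units.isUnit _)) g
  rw [hspan] at this
  let φ : (k[X][X] ⧸ Ideal.span {g}) →ₐ[k[X]] D := Ideal.Quotient.liftₐ _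
    (IsScalarTower.toAlgHom k[X] k[X][X] D) (fun a ha => by rwa [← hker] at ha)
  refine Module.Finite.of_surjective φ.toLinearMap fun d => ?_
  obtain ⟨a, rfl⟩ := hsurj d
  exact ⟨Ideal.Quotient.mk _ a, rfl⟩

theorem faithfulSMul_of_ker_eq_span [Nontrivial D]
    (hker : RingHom.ker (algebraMap k[X][X] D) = Ideal.span {g}) (hg : IsUnit g.leadingCoeff) :
    FaithfulSMul k[X] D := by
  rw [faithfulSMul_iff_algebraMap_injective, injective_iff_map_eq_zero]
  intro a ha
  by_contra ha0
  rw [IsScalarTower.algebraMap_apply k[X] k[X][X] D, ← RingHom.mem_ker, hker,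
    Ideal.mem_span_singleton] at ha
  have hdeg : g.natDegree = 0 := by
    have := natDegree_le_of_dvd ha (by simpa using ha0)
    simpa using this
  rw [eq_C_of_natDegree_eq_zero hdeg, leadingCoeff_C] at hg
  have h1 : (1 : k[X][X]) ∈ RingHom.ker (algebraMap k[X][X] D) := by
    rw [hker, eq_C_of_natDegree_eq_zero hdeg, Ideal.span_singleton_eq_top.2 (isUnit_C.2 hg)]
    trivial
  rw [RingHom.mem_ker, map_one] at h1
  exact one_ne_zero h1

/-- Lying over: `Normalization D` is integral over `k[X][X]`, and the kernel, generated by `g`, is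
contained in `Q`. -/
theorem exists_isMaximal_comap_eq [IsDomain D] [CharZero k]
    (hsurj : Function.Surjective (algebraMap k[X][X] D))
    (hker : RingHom.ker (algebraMap k[X][X] D) = Ideal.span {g}) (hg : IsUnit g.leadingCoeff)
    (Q : Ideal k[X][X]) [Q.IsMaximal] (hgQ : g ∈ Q) : ∃ p : Ideal (Normalization D),
      p.IsMaximal ∧ p.comap (algebraMap k[X][X] (Normalization D)) = Q := by
  have := finite_of_ker_eq_span hsurj hker hg
  have := faithfulSMul_of_ker_eq_span hker hg
  have : Algebra.IsIntegral k[X][X] (Normalization D) := Algebra.IsIntegral.tower_top (R := k[X])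
  refine Ideal.exists_ideal_over_maximal_of_isIntegral (S := Normalization D) Q fun a ha => ?_
  by_contra haQ
  exact algebraMap_normalization_ne_zero hker (fun h => haQ (Q.mem_of_dvd h hgQ)) ha

end Quotient

section Intersection

variable {k D : Type*} [Field k] [IsAlgClosed k] [CharZero k] [CommRing D] [IsDomain D]
  [Algebra k D] [Algebra k[X] D] [IsScalarTower k k[X] D]
  [Algebra k[X][X] D] [IsScalarTower k[X] k[X][X] D] [IsScalarTower k k[X][X] D] {g : k[X][X]}


variable (hsurj : Function.Surjective (algebraMap k[X][X] D))
  (hker : RingHom.ker (algebraMap k[X][X] D) = Ideal.span {g}) (hg : IsUnit g.leadingCoeff)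

include hsurj hker hg

/-- The intersection multiplicity at a point of a plane curve `g` with another one is computed on
the normalization of `g`. -/
theorem locLength_pair_eq_countOver [IsDedekindDomain (Normalization D)] (Q : Ideal k[X][X])
    [Q.IsMaximal] {h : k[X][X]} (hh : ¬ g ∣ h) : locLength Q (k[X][X] ⧸ Ideal.span {g, h}) =
      countOver Q (Ideal.span {algebraMap k[X][X] (Normalization D) h}) := by
  have := finite_of_ker_eq_span hsurj hker hg
  have := faithfulSMul_of_ker_eq_span hker hg
  have := finite_normalization k[X] D
  rw [← locLength_quotient_span_pair Q hsurj hker, locLength_quotient_normalization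
    (hasResidueField_of_finite k (Normalization D)) Q (normalization_algebraMap_injective D)
    exists_mul_mem_range, ← IsScalarTower.algebraMap_apply]
  intro h0
  rw [← RingHom.mem_ker, hker, Ideal.mem_span_singleton] at h0
  exact hh h0

end Intersection

section Polar

variable {k : Type*} [Field k] [IsAlgClosed k] [CharZero k] {F : k[X][X]}
  (Dx : Derivation k k[X][X] k[X][X]) (hX : Dx (C X) = 1) (hY : Dx X = 0)
  (Q : Ideal k[X][X]) [hQ : Q.IsMaximal] {c : k} (hc : C (X - C c) ∈ Q)

omit [IsAlgClosed k] [CharZero k] in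
theorem not_dvd_C_X_sub_C {g : k[X][X]} (hg : Irreducible g) (hlead : IsUnit g.leadingCoeff)
    (c : k) : ¬ g ∣ C (X - C c) := by
  intro h
  have hdeg : g.natDegree = 0 := by
    have := natDegree_le_of_dvd h (C_ne_zero.2 (X_sub_C_ne_zero c))
    simpa using this
  rw [eq_C_of_natDegree_eq_zero hdeg, leadingCoeff_C] at hlead
  rw [eq_C_of_natDegree_eq_zero hdeg] at hg
  exact hg.not_isUnit (isUnit_C.2 hlead)

include hX hY hc

section Component

variable {D : Type*} [CommRing D] [IsDomain D]
  [Algebra k D] [Algebra k[X] D] [IsScalarTower k k[X] D]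
  [Algebra k[X][X] D] [IsScalarTower k[X] k[X][X] D] [IsScalarTower k k[X][X] D] {g : k[X][X]}
  (hsurj : Function.Surjective (algebraMap k[X][X] D))
  (hker : RingHom.ker (algebraMap k[X][X] D) = Ideal.span {g}) (hlead : IsUnit g.leadingCoeff)

include hsurj hker hlead

-- On the component `g` of the polar curve `F_Y` vanishes identically, which is the situation of
-- `ordAt_eq_of_derivative_eq_zero`.
omit hQ in
theorem ordAt_component [IsDedekindDomain (Normalization D)]
    (hF : F ∈ Q) (hg : Irreducible g) (hgF' : g ∣ derivative F) (hgF : ¬ g ∣ F)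
    (p : Ideal (Normalization D)) (hp : p.IsMaximal) (hp0 : p ≠ ⊥)
    (hpQ : p.comap (algebraMap k[X][X] (Normalization D)) = Q) :
    ordAt p (algebraMap k[X][X] (Normalization D) F) =
      ordAt p (algebraMap k[X][X] (Normalization D) (Dx F)) +
        ordAt p (algebraMap k[X][X] (Normalization D) (C (X - C c))) := by
  have := finite_of_ker_eq_span hsurj hker hlead
  have := faithfulSMul_of_ker_eq_span hker hlead
  refine ordAt_eq_of_derivative_eq_zero Dx hX hY (hasResidueField_of_finite k (Normalization D))
    hp hp0 (IsScalarTower.toAlgHom k k[X][X] (Normalization D)) ?_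
    (algebraMap_normalization_ne_zero hker (not_dvd_C_X_sub_C hg hlead c)) ?_
    (algebraMap_normalization_ne_zero hker hgF) (algebraMap_normalization_eq_zero hker hgF')
  · rwa [← hpQ] at hc
  · rwa [← hpQ] at hF

/-- The contribution of a component of the polar curve. -/
theorem locLength_component
    (hF : F ∈ Q) (hg : Irreducible g) (hgF' : g ∣ derivative F) (hgF : ¬ g ∣ F) (hgQ : g ∈ Q) :
    ¬ g ∣ Dx F ∧ locLength Q (k[X][X] ⧸ Ideal.span {g, F}) =
      locLength Q (k[X][X] ⧸ Ideal.span {g, Dx F}) +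
        locLength Q (k[X][X] ⧸ Ideal.span {g, C (X - C c)}) := by
  have := finite_of_ker_eq_span hsurj hker hlead
  have := faithfulSMul_of_ker_eq_span hker hlead
  have := isDedekindDomain_normalization k[X] D
  have hF0 := algebraMap_normalization_ne_zero hker hgF
  have hc0 := algebraMap_normalization_ne_zero hker (not_dvd_C_X_sub_C hg hlead c)
  have key := ordAt_component Dx hX hY Q hc hsurj hker hlead hF hg hgF' hgF
  -- Otherwise the right side of `key` is infinite at a prime over `Q`, whereas `F` does not vanish
  -- on `g`.
  have hDx : ¬ g ∣ Dx F := by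
    intro hdvd
    obtain ⟨p, hp, hpQ⟩ := exists_isMaximal_comap_eq hsurj hker hlead Q hgQ
    have hp0 := ne_bot_of_isMaximal k hp
    refine ordAt_ne_top hp hp0 hF0 ?_
    rw [key p hp hp0 hpQ, algebraMap_normalization_eq_zero hker hdvd, ordAt,
      Ideal.span_singleton_zero, ← Ideal.zero_eq_bot, emultiplicity_zero, top_add]
  have hDx0 := algebraMap_normalization_ne_zero hker hDx
  refine ⟨hDx, ?_⟩
  rw [locLength_pair_eq_countOver hsurj hker hlead Q hgF,
    locLength_pair_eq_countOver hsurj hker hlead Q hDx,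
    locLength_pair_eq_countOver hsurj hker hlead Q (not_dvd_C_X_sub_C hg hlead c), ← Nat.cast_add]
  congr 1
  refine countOver_eq_add Q fun p hp hp0 hpQ => ?_
  have h1 := key p hp hp0 hpQ
  rw [ordAt_eq_count hp hp0 hF0, ordAt_eq_count hp hp0 hDx0, ordAt_eq_count hp hp0 hc0] at h1
  exact_mod_cast h1

end Component

theorem locLength_component_quotient (hF : F ∈ Q) {g : k[X][X]} (hg : Irreducible g)
    (hlead : IsUnit g.leadingCoeff) (hgF' : g ∣ derivative F) (hgF : ¬ g ∣ F) (hgQ : g ∈ Q) :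
    ¬ g ∣ Dx F ∧ locLength Q (k[X][X] ⧸ Ideal.span {g, F}) =
      locLength Q (k[X][X] ⧸ Ideal.span {g, Dx F}) +
        locLength Q (k[X][X] ⧸ Ideal.span {g, C (X - C c)}) := by
  have : (Ideal.span {g}).IsPrime := (Ideal.span_singleton_prime hg.ne_zero).2 hg.prime
  have hsurj := surjective_algebraMap_quotient (Ideal.span {g})
  have hker := ker_algebraMap_quotient (Ideal.span {g})
  exact locLength_component Dx hX hY Q hc hsurj hker hlead hF hg hgF' hgF hgQ

/-- Teissier's formula for the intersection multiplicity with the polar curve. -/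
theorem locLength_polar (hF : F ∈ Q) {G : k[X][X]} (hlead : IsUnit G.leadingCoeff)
    (hG : G ∣ derivative F) (hco : ∀ g, Irreducible g → g ∣ G → ¬ g ∣ F) :
    locLength Q (k[X][X] ⧸ Ideal.span {G, F}) =
      locLength Q (k[X][X] ⧸ Ideal.span {G, Dx F}) +
        locLength Q (k[X][X] ⧸ Ideal.span {G, C (X - C c)}) := by
  induction G using UniqueFactorizationMonoid.induction_on_prime with
  | h₁ => simp at hlead
  | h₂ u hu =>
    have h0 (h : k[X][X]) : locLength Q (k[X][X] ⧸ Ideal.span {u, h}) = 0 := by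
      have : Ideal.span {u, h} = ⊤ :=
        Ideal.eq_top_of_isUnit_mem _ (Ideal.subset_span (by simp)) hu
      rw [this]
      exact locLength_eq_zero_of_subsingleton Q
    rw [h0, h0, h0, add_zero]
  | h₃ G g hG0 hg ih =>
    rw [leadingCoeff_mul, IsUnit.mul_iff] at hlead
    have ih' := ih hlead.2 ((dvd_mul_left G g).trans hG)
      fun q hq hqG => hco q hq (hqG.mul_left g)
    have hgF := hco g hg.irreducible (dvd_mul_right g G)
    rw [Set.pair_comm (g * G) F, Set.pair_comm (g * G) (Dx F), Set.pair_comm (g * G) (C (X - C c))]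
    rw [Set.pair_comm G F, Set.pair_comm G (Dx F), Set.pair_comm G (C (X - C c))] at ih'
    -- All three multiplicities are additive in the polar curve, so a component through `Q` adds its
    -- own identity and one that misses `Q` adds nothing.
    by_cases hgQ : g ∈ Q
    · obtain ⟨hgDx, hgeq⟩ := locLength_component_quotient Dx hX hY Q hc hF hg.irreducible hlead.1
        ((dvd_mul_right g G).trans hG) hgF hgQ
      rw [Set.pair_comm g F, Set.pair_comm g (Dx F), Set.pair_comm g (C (X - C c))] at hgeq
      have hreg (h : k[X][X]) (hh : ¬ g ∣ h) (x : k[X][X]) (hx : h ∣ g * x) : h ∣ x := by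
        obtain ⟨y, hy⟩ := hx
        obtain ⟨z, rfl⟩ := (hg.dvd_or_dvd (⟨x, hy.symm⟩ : g ∣ h * y)).resolve_left hh
        exact ⟨z, mul_left_cancel₀ hg.ne_zero (by rw [hy]; ring)⟩
      rw [locLength_quotient_pair_mul Q (hreg _ hgF), locLength_quotient_pair_mul Q (hreg _ hgDx),
        locLength_quotient_pair_mul Q (hreg _ (not_dvd_C_X_sub_C hg.irreducible hlead.1 c)), ih',
        hgeq]
      exact add_add_add_comm _ _ _ _
    · rw [locLength_quotient_pair_mul_of_notMem Q hgQ, locLength_quotient_pair_mul_of_notMem Q hgQ,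
        locLength_quotient_pair_mul_of_notMem Q hgQ, ih']

end Polar
end PlaneCurve
end

noncomputable section

namespace PlaneCurve

open Polynomial UniqueFactorizationMonoid nonZeroDivisors

/-! ### Multiplicities on a vertical line. -/

section Fiber

variable {k : Type*} [Field k] [IsAlgClosed k]

theorem exists_sub_C_mem (Q : Ideal k[X][X]) [hQ : Q.IsMaximal] (a : k[X][X]) :
    ∃ c : k, a - C (C c) ∈ Q := by
  let _ := Ideal.Quotient.field Q
  have : Algebra.FiniteType k k[X][X] := Algebra.FiniteType.trans (S := k[X]) inferInstance inferInstance
  have : Module.Finite k (k[X][X] ⧸ Q) := finite_of_finite_type_of_isJacobsonRing k _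
  obtain ⟨c, hc⟩ := (IsAlgClosed.algebraMap_bijective_of_isIntegral (k := k)
    (K := k[X][X] ⧸ Q)).2 (Ideal.Quotient.mk Q a)
  exact ⟨c, Ideal.Quotient.eq.1 hc.symm⟩

variable [CharZero k]

omit [IsAlgClosed k] in
theorem derivative_ne_zero_of_isRoot {h : k[X]} {d : k} (hd : h.IsRoot d) (h0 : h ≠ 0) :
    derivative h ≠ 0 := by
  intro hz
  have h2 := derivative_eq_zero.1 hz
  rw [eq_C_of_natDegree_eq_zero h2] at hd h0
  simp only [IsRoot.def, eval_C] at hd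
  rw [hd] at h0
  simp at h0

omit [IsAlgClosed k] in
theorem count_derivative_add_one {h : k[X]} {d : k} (hd : h.IsRoot d) (h0 : h ≠ 0) :
    (normalizedFactors (Ideal.span {h})).count (Ideal.span {X - C d}) =
      (normalizedFactors (Ideal.span {derivative h})).count (Ideal.span {X - C d}) + 1 := by
  have hp : Prime (Ideal.span {X - C d}) := Ideal.prime_of_isPrime
    (by simpa using X_sub_C_ne_zero d)
    ((Ideal.span_singleton_prime (X_sub_C_ne_zero d)).2 (prime_X_sub_C d))
  have h1 : 0 < h.rootMultiplicity d := (rootMultiplicity_pos h0).2 hd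
  have hd0 := derivative_ne_zero_of_isRoot hd h0
  have key (h : k[X]) (h0 : h ≠ 0) :
      (normalizedFactors (Ideal.span {h})).count (Ideal.span {X - C d}) =
        h.rootMultiplicity d := by
    have h3 := emultiplicity_eq_count_normalizedFactors hp.irreducible
      (show Ideal.span {h} ≠ 0 by simpa using h0)
    rw [normalize_eq] at h3
    classical
    rw [rootMultiplicity_eq_multiplicity, if_neg h0, ← Nat.cast_inj (R := ℕ∞), ← h3,
      ← (FiniteMultiplicity.of_prime_left (prime_X_sub_C d) h0).emultiplicity_eq_multiplicity]
    refine emultiplicity_eq_emultiplicity_iff.2 fun n => ?_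
    rw [Ideal.dvd_iff_le, Ideal.span_singleton_pow, Ideal.span_singleton_le_span_singleton]
  rw [key h h0, key _ hd0, derivative_rootMultiplicity_of_root hd]
  omega

/-- On the line `X = c` the multiplicity at `Q` is that of a root of `F(c, Y)`, which drops by one
under differentiation. -/
theorem locLength_fiber {F : k[X][X]} (Q : Ideal k[X][X]) [hQ : Q.IsMaximal] {c : k}
    (hc : C (X - C c) ∈ Q) (hF : F ∈ Q) (hF0 : F.map (evalRingHom c) ≠ 0) :
    locLength Q (k[X][X] ⧸ Ideal.span {C (X - C c), F}) =
      locLength Q (k[X][X] ⧸ Ideal.span {C (X - C c), derivative F}) + 1 := by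
  let _ : Algebra k[X][X] k[X] := (mapRingHom (evalRingHom c)).toAlgebra
  have hmap (a : k[X][X]) : algebraMap k[X][X] k[X] a = a.map (evalRingHom c) := rfl
  have : IsScalarTower k k[X][X] k[X] := by
    refine .of_algebraMap_eq fun x => ?_
    rw [hmap]
    change C x = (C (C x)).map _
    simp
  have hsurj : Function.Surjective (algebraMap k[X][X] k[X]) :=
    map_surjective _ fun x => ⟨C x, by simp⟩
  have hker : RingHom.ker (algebraMap k[X][X] k[X]) = Ideal.span {C (X - C c)} := by
    ext a
    rw [RingHom.mem_ker, Ideal.mem_span_singleton, C_dvd_iff_dvd_coeff, hmap, Polynomial.ext_iff]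
    refine forall_congr' fun i => ?_
    rw [coeff_map, coeff_zero, dvd_iff_isRoot]
    rfl
  have hres : HasResidueField k k[X] := hasResidueField
  obtain ⟨d, hd⟩ := exists_sub_C_mem Q X
  -- `Q` is the ideal of the point `(c, d)`: modulo `X - c` and `Y - d`, `a` equals its value there.
  have hmem (a : k[X][X]) : a ∈ Q ↔ (algebraMap k[X][X] k[X] a).IsRoot d := by
    set e := (algebraMap k[X][X] k[X] a).eval d with he
    obtain ⟨b, hb⟩ : X - C d ∣ algebraMap k[X][X] k[X] a - C e := X_sub_C_dvd_sub_C_eval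
    obtain ⟨b, rfl⟩ := hsurj b
    have h1 : a - C (C e) - (X - C (C d)) * b ∈ RingHom.ker (algebraMap k[X][X] k[X]) := by
      rw [RingHom.mem_ker, map_sub, map_sub, map_mul, hmap (X - _), hmap (C _)]
      simp only [Polynomial.map_sub, map_X, map_C, coe_evalRingHom, eval_C, hb, sub_self]
    rw [hker] at h1
    have h2 := (Ideal.span_singleton_le_iff_mem Q).2 hc h1
    have h3 : a - C (C e) ∈ Q := by simpa using Q.add_mem h2 (Q.mul_mem_right b hd)
    have h4 : a ∈ Q ↔ C (C e) ∈ Q :=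
      ⟨fun h => by simpa using Q.sub_mem h h3, fun h => by simpa using Q.add_mem h3 h⟩
    rw [h4, IsRoot.def, ← he]
    constructor
    · intro h
      by_contra he0
      exact hQ.ne_top (Ideal.eq_top_of_isUnit_mem _ h
        (isUnit_C.2 (isUnit_C.2 (isUnit_iff_ne_zero.2 he0))))
    · rintro h
      rw [h, C_0, C_0]
      exact zero_mem _
  have hroot := (hmem F).1 hF
  have hderiv : algebraMap k[X][X] k[X] (derivative F) = derivative (algebraMap k[X][X] k[X] F) := by
    rw [hmap, hmap, derivative_map]
  have hF0' := derivative_ne_zero_of_isRoot hroot hF0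
  rw [← locLength_quotient_span_pair Q hsurj hker, ← locLength_quotient_span_pair Q hsurj hker,
    locLength_quotient_ideal hres Q (by rwa [Ne, Ideal.span_singleton_eq_bot]), hderiv,
    locLength_quotient_ideal hres Q (by rwa [Ne, Ideal.span_singleton_eq_bot])]
  have hprime : Prime (Ideal.span {X - C d}) := Ideal.prime_of_isPrime
    (by simpa using X_sub_C_ne_zero d)
    ((Ideal.span_singleton_prime (X_sub_C_ne_zero d)).2 (prime_X_sub_C d))
  have hcomap : (Ideal.span {X - C d}).comap (algebraMap k[X][X] k[X]) = Q := by
    ext a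
    rw [Ideal.mem_comap, Ideal.mem_span_singleton, dvd_iff_isRoot, hmem]
  classical
  have h1 : countOver Q (Ideal.span {X - C d}) = 1 := by
    rw [countOver_prime Q hprime, if_pos hcomap]
  rw [← Nat.cast_one, ← Nat.cast_add, ← h1]
  congr 1
  refine countOver_eq_add Q fun p hp hp0 hpQ => ?_
  have hpd : Ideal.span {X - C d} = p := by
    have hmax : (Ideal.span {X - C d}).IsMaximal :=
      PrincipalIdealRing.isMaximal_of_irreducible (irreducible_X_sub_C d)
    refine hmax.eq_of_le hp.ne_top ((Ideal.span_singleton_le_iff_mem _).2 ?_)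
    rw [← hpQ, Ideal.mem_comap, hmap] at hd
    simpa using hd
  rw [← hpd, count_derivative_add_one hroot hF0, normalizedFactors_irreducible hprime.irreducible,
    normalize_eq, Multiset.count_singleton_self]

end Fiber

/-! ### The conductor, the different and the derivative. -/

section Conductor

attribute [local instance] FractionRing.liftAlgebra FractionRing.isScalarTower_liftAlgebra

variable {k R : Type*} [Field k] [CharZero k] [CommRing R] [IsDomain R] [Algebra k[X] R]
  [Algebra k[X][X] R] [IsScalarTower k[X] k[X][X] R] {F : k[X][X]}
  (hsurj : Function.Surjective (algebraMap k[X][X] R))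
  (hker : RingHom.ker (algebraMap k[X][X] R) = Ideal.span {F}) (hF : F.Monic) (hirr : Irreducible F)

include hsurj

omit [CharZero k] [IsDomain R] in
theorem adjoin_eq_range : (Algebra.adjoin k[X] {algebraMap k[X][X] (Normalization R) X} : Set (Normalization R)) =
    (algebraMap R (Normalization R)).range := by
  have h : IsScalarTower.toAlgHom k[X] k[X][X] (Normalization R) =
      aeval (algebraMap k[X][X] (Normalization R) X) := by
    ext
    simp
  ext z
  rw [Algebra.adjoin_singleton_eq_range_aeval, ← h]
  constructor
  · rintro ⟨a, rfl⟩
    exact ⟨algebraMap k[X][X] R a, (IsScalarTower.algebraMap_apply _ _ _ a).symm⟩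
  · rintro ⟨r, rfl⟩
    obtain ⟨a, rfl⟩ := hsurj r
    exact ⟨a, IsScalarTower.algebraMap_apply k[X][X] R _ a⟩

omit [CharZero k] in
theorem adjoin_fractionRing_eq_top [Module.Finite k[X] R] [FaithfulSMul k[X] R] :
    Algebra.adjoin (FractionRing k[X])
      {algebraMap (Normalization R) (FractionRing R)
        (algebraMap k[X][X] (Normalization R) X)} = ⊤ := by
  rw [eq_top_iff]
  intro z _
  set y := algebraMap k[X][X] (Normalization R) X
  have hmem (b : Normalization R) (hb : b ∈ Algebra.adjoin k[X] {y}) :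
      algebraMap (Normalization R) (FractionRing R) b ∈ Algebra.adjoin (FractionRing k[X])
        {algebraMap (Normalization R) (FractionRing R) y} := by
    induction hb using Algebra.adjoin_induction with
    | mem x hx =>
      rw [Set.mem_singleton_iff.1 hx]
      exact Algebra.subset_adjoin rfl
    | algebraMap r =>
      rw [← IsScalarTower.algebraMap_apply k[X] (Normalization R) (FractionRing R),
        IsScalarTower.algebraMap_apply k[X] (FractionRing k[X]) (FractionRing R)]
      exact Subalgebra.algebraMap_mem _ _
    | add x y _ _ hx hy => exact map_add (algebraMap (Normalization R) (FractionRing R)) x y ▸ add_mem hx hy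
    | mul x y _ _ hx hy => exact map_mul (algebraMap (Normalization R) (FractionRing R)) x y ▸ mul_mem hx hy
  obtain ⟨⟨r, ⟨_, p, hp, rfl⟩⟩, hr⟩ :=
    IsLocalization.surj (M := Algebra.algebraMapSubmonoid R k[X]⁰) z
  have hp' : algebraMap k[X] (FractionRing k[X]) p ≠ 0 :=
    (map_ne_zero_iff _ (IsFractionRing.injective _ _)).2 (nonZeroDivisors.ne_zero hp)
  have hz : z = (algebraMap k[X] (FractionRing k[X]) p)⁻¹ • algebraMap R (FractionRing R) r := by
    rw [← hr, eq_inv_smul_iff₀ hp', Algebra.smul_def, mul_comm]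
    congr 1
    exact (IsScalarTower.algebraMap_apply k[X] (FractionRing k[X]) _ p).symm.trans
      (IsScalarTower.algebraMap_apply k[X] R _ p)
  rw [hz, IsScalarTower.algebraMap_apply R (Normalization R) (FractionRing R)]
  refine Subalgebra.smul_mem _ (hmem _ ?_) _
  rw [← SetLike.mem_coe, adjoin_eq_range hsurj]
  exact ⟨r, rfl⟩

-- The image of `R` is `k[X][y]`, where `y` is integral with minimal polynomial `F` because `F` is
-- monic and irreducible. For such an order, conductor times different is generated by `F'(y)`.
include hker hF hirr in
theorem conductorOf_mul_differentIdeal [IsDedekindDomain (Normalization R)] [Module.Finite k[X] R]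
    [FaithfulSMul k[X] R] : conductorOf R (Normalization R) * differentIdeal k[X] (Normalization R) =
      Ideal.span {algebraMap k[X][X] (Normalization R) (derivative F)} := by
  set y := algebraMap k[X][X] (Normalization R) X with hy
  have haeval (a : k[X][X]) : aeval y a = algebraMap k[X][X] (Normalization R) a := by
    have h : IsScalarTower.toAlgHom k[X] k[X][X] (Normalization R) = aeval y := by
      ext
      simp [hy]
    rw [← h]
    rfl
  have hcond : conductor k[X] y = conductorOf R (Normalization R) := by
    ext b
    rw [mem_conductor_iff, mem_conductorOf]
    refine forall_congr' fun t => ?_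
    rw [← SetLike.mem_coe, adjoin_eq_range hsurj]
    rfl
  have hint : IsIntegral k[X] y := Algebra.IsIntegral.isIntegral y
  have hmin : minpoly k[X] y = F := by
    have hdvd : minpoly k[X] y ∣ F := by
      refine minpoly.isIntegrallyClosed_dvd hint ?_
      rw [haeval]
      exact algebraMap_normalization_eq_zero hker dvd_rfl
    refine eq_of_monic_of_associated (minpoly.monic hint) hF ?_
    exact (hirr.dvd_iff.1 hdvd).resolve_left (minpoly.not_isUnit _ _) |>.symm
  rw [← hcond, conductor_mul_differentIdeal k[X] (FractionRing k[X]) (FractionRing R) y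
    (adjoin_fractionRing_eq_top hsurj), hmin, haeval]

end Conductor
end PlaneCurve
end

noncomputable section

namespace PlaneCurve

open Polynomial UniqueFactorizationMonoid

/-! ### The local Milnor formula for a monic equation. -/

section Monic

variable {k : Type*} [Field k] [CharZero k] {F : k[X][X]} (hF : F.Monic) (hirr : Irreducible F)

include hF hirr

omit [CharZero k] in
theorem natDegree_pos_of_irreducible : 0 < F.natDegree :=
  Nat.pos_of_ne_zero fun h => hirr.not_isUnit (hF.natDegree_eq_zero.1 h ▸ isUnit_one)

/-- The leading coefficient is the degree of `F`, a nonzero constant in characteristic 0. This makes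
every component of the polar curve finite over the line. -/
theorem isUnit_leadingCoeff_derivative : IsUnit (derivative F).leadingCoeff := by
  have hpos := natDegree_pos_of_irreducible hF hirr
  rw [leadingCoeff, natDegree_derivative, coeff_derivative, Nat.sub_add_cancel hpos,
    hF.coeff_natDegree, one_mul, ← Nat.cast_succ, Nat.succ_eq_add_one, Nat.sub_add_cancel hpos]
  exact (isUnit_C.2 (isUnit_iff_ne_zero.2 (Nat.cast_ne_zero.2 hpos.ne')) : IsUnit (C (F.natDegree : k)))

theorem not_dvd_derivative : ¬ F ∣ derivative F := by
  intro h
  have h0 : derivative F ≠ 0 := by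
    intro h0
    have := isUnit_leadingCoeff_derivative hF hirr
    simp [h0] at this
  have h1 := natDegree_le_of_dvd h h0
  have h2 := natDegree_derivative_lt (natDegree_pos_of_irreducible hF hirr).ne'
  omega

end Monic

section Local

variable {k R : Type*} [Field k] [IsAlgClosed k] [CharZero k] [CommRing R] [IsDomain R]
  [Algebra k R] [Algebra k[X] R] [IsScalarTower k k[X] R]
  [Algebra k[X][X] R] [IsScalarTower k[X] k[X][X] R] [IsScalarTower k k[X][X] R] {F : k[X][X]}
  (hsurj : Function.Surjective (algebraMap k[X][X] R))
  (hker : RingHom.ker (algebraMap k[X][X] R) = Ideal.span {F}) (hF : F.Monic) (hirr : Irreducible F)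

section

variable [Module.Finite k[X] R] [FaithfulSMul k[X] R] [IsDedekindDomain (Normalization R)]

include hsurj hker hF hirr

omit [IsAlgClosed k] [Algebra k R] [IsScalarTower k k[X] R] [IsScalarTower k k[X][X] R] in
theorem conductorOf_ne_bot : conductorOf R (Normalization R) ≠ ⊥ := by
  intro h
  have h1 := conductorOf_mul_differentIdeal hsurj hker hF hirr
  rw [h, Ideal.bot_mul, eq_comm, Ideal.span_singleton_eq_bot] at h1
  exact algebraMap_normalization_ne_zero hker (not_dvd_derivative hF hirr) h1

omit [IsAlgClosed k] [Algebra k R] [IsScalarTower k k[X] R] [IsScalarTower k k[X][X] R] in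
theorem differentIdeal_normalization_ne_bot : differentIdeal k[X] (Normalization R) ≠ ⊥ := by
  intro h
  have h1 := conductorOf_mul_differentIdeal hsurj hker hF hirr
  rw [h, Ideal.mul_bot, eq_comm, Ideal.span_singleton_eq_bot] at h1
  exact algebraMap_normalization_ne_zero hker (not_dvd_derivative hF hirr) h1

omit [IsAlgClosed k] [Algebra k R] [IsScalarTower k k[X] R] [IsScalarTower k k[X][X] R] in
theorem derivative_mem_conductorOf :
    algebraMap k[X][X] (Normalization R) (derivative F) ∈ conductorOf R (Normalization R) := by
  have hle : conductorOf R (Normalization R) * differentIdeal k[X] (Normalization R) ≤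
      conductorOf R (Normalization R) := Ideal.mul_le_left
  refine hle ?_
  rw [conductorOf_mul_differentIdeal hsurj hker hF hirr]
  exact Ideal.mem_span_singleton_self _

/-- Where `X - c` has order `e` at a prime, `F_Y` has order that of the conductor plus `e - 1`. The
inequality `ord F_Y + 1 ≤ ord F_X + e` therefore says that `F_X` has at least the order of the
conductor. -/
theorem deriv_mem_conductorOf (Dx : Derivation k k[X][X] k[X][X]) (hX : Dx (C X) = 1)
    (hY : Dx X = 0) :
    algebraMap k[X][X] (Normalization R) (Dx F) ∈ conductorOf R (Normalization R) := by
  classical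
  have hres := hasResidueField_of_finite k (Normalization R)
  by_cases hDx : algebraMap k[X][X] (Normalization R) (Dx F) = 0
  · rw [hDx]
    exact zero_mem _
  have hc0 := conductorOf_ne_bot hsurj hker hF hirr
  have hd0 := differentIdeal_normalization_ne_bot hsurj hker hF hirr
  rw [← Ideal.span_singleton_le_iff_mem, ← Ideal.dvd_iff_le,
    dvd_iff_normalizedFactors_le_normalizedFactors hc0
      fun h => hDx (Ideal.span_singleton_eq_bot.1 h), Multiset.le_iff_count]
  intro p
  by_cases hmem : p ∈ normalizedFactors (conductorOf R (Normalization R))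
  · have hpr := prime_of_normalized_factor p hmem
    have hp0 : p ≠ ⊥ := hpr.ne_zero
    have hp : p.IsMaximal := (Ideal.isPrime_of_prime hpr).isMaximal hp0
    obtain ⟨c, hc⟩ := hres p hp hp0 (algebraMap k[X] (Normalization R) X)
    have hc' : algebraMap k[X] (Normalization R) (X - C c) ∈ p := by
      rw [map_sub, C_eq_algebraMap, ← IsScalarTower.algebraMap_apply]
      exact hc
    have hcc : algebraMap k[X] (Normalization R) (X - C c) =
        algebraMap k[X][X] (Normalization R) (C (X - C c)) :=
      IsScalarTower.algebraMap_apply k[X] k[X][X] _ _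
    have hxc0 := algebraMap_normalization_ne_zero hker
      (not_dvd_C_X_sub_C hirr (hF.leadingCoeff ▸ isUnit_one) c)
    have hF'0 := algebraMap_normalization_ne_zero hker (not_dvd_derivative hF hirr)
    have h1 := ordAt_derivative_add_one_le Dx hX hY hres hp hp0
      (IsScalarTower.toAlgHom k k[X][X] (Normalization R)) (F := F) (c := c) (hcc ▸ hc') hxc0
      (algebraMap_normalization_eq_zero hker dvd_rfl) hF'0
    have h2 := count_differentIdeal_add_one hp hc'
    have h3 := conductorOf_mul_differentIdeal hsurj hker hF hirr
    change ordAt p (algebraMap k[X][X] (Normalization R) (derivative F)) + 1 ≤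
      ordAt p (algebraMap k[X][X] (Normalization R) (Dx F)) +
        ordAt p (algebraMap k[X][X] (Normalization R) (C (X - C c))) at h1
    rw [ordAt_eq_count hp hp0 hF'0, ordAt_eq_count hp hp0 hDx, ordAt_eq_count hp hp0 hxc0,
      ← h3, normalizedFactors_mul hc0 hd0, Multiset.count_add, ← hcc, ← h2] at h1
    norm_cast at h1
    omega
  · rw [Multiset.count_eq_zero_of_notMem hmem]
    exact Nat.zero_le _

-- Each prime over `Q` divides `X - c`, because `X - c` lies in `Q`, and its exponent is one more
-- than in the different; the ones add up to the number of primes.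
omit [IsAlgClosed k] [Algebra k R] [IsScalarTower k k[X] R] [IsScalarTower k k[X][X] R]
  hsurj in
theorem countOver_fiber (Q : Ideal k[X][X]) {c : k} (hc : C (X - C c) ∈ Q) :
    (countOver Q (Ideal.span {algebraMap k[X][X] (Normalization R) (C (X - C c))}) : ℕ∞) =
      countOver Q (differentIdeal k[X] (Normalization R)) + 
      {p : Ideal (Normalization R) | p.IsMaximal ∧
        p.comap (algebraMap k[X][X] (Normalization R)) = Q}.encard := by
  classical
  have hcc : algebraMap k[X] (Normalization R) (X - C c) =
      algebraMap k[X][X] (Normalization R) (C (X - C c)) :=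
    IsScalarTower.algebraMap_apply k[X] k[X][X] _ _
  have hxc0 := algebraMap_normalization_ne_zero hker
    (not_dvd_C_X_sub_C hirr (hF.leadingCoeff ▸ isUnit_one) c)
  set I := Ideal.span {algebraMap k[X][X] (Normalization R) (C (X - C c))} with hI
  have hI0 : I ≠ 0 := by simpa [hI] using hxc0
  set T := (normalizedFactors I).toFinset.filter
    (fun p => p.comap (algebraMap k[X][X] (Normalization R)) = Q) with hT
  have hmem (p : Ideal (Normalization R)) (hp : p.IsMaximal)
      (hpQ : p.comap (algebraMap k[X][X] (Normalization R)) = Q) : 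
      algebraMap k[X][X] (Normalization R) (C (X - C c)) ∈ p := by rwa [← hpQ] at hc
  have hTset : {p : Ideal (Normalization R) | p.IsMaximal ∧
        p.comap (algebraMap k[X][X] (Normalization R)) = Q} = T := by
    ext p
    simp only [Set.mem_ofPred_eq, hT, Finset.coe_filter, Multiset.mem_toFinset]
    constructor
    · rintro ⟨hp, hpQ⟩
      refine ⟨?_, hpQ⟩
      rw [mem_normalizedFactors_iff hI0]
      refine ⟨Ideal.prime_of_isPrime (ne_bot_of_isMaximal k hp) hp.isPrime, ?_⟩
      rw [Ideal.dvd_iff_le, hI, Ideal.span_singleton_le_iff_mem]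
      exact hmem p hp hpQ
    · rintro ⟨hp, hpQ⟩
      have hpr := prime_of_normalized_factor p hp
      exact ⟨(Ideal.isPrime_of_prime hpr).isMaximal hpr.ne_zero, hpQ⟩
  rw [hTset, Set.encard_coe_eq_coe_finsetCard, ← Nat.cast_add]
  congr 1
  rw [countOver, countOver, Multiset.countP_eq_card_filter, Multiset.countP_eq_card_filter,
    ← Finset.card_val, ← Multiset.card_add]
  congr 1
  ext p
  rw [Multiset.count_add, Multiset.count_filter, Multiset.count_filter]
  by_cases hpT : p ∈ T
  · have hp : p ∈ {p : Ideal (Normalization R) | p.IsMaximal ∧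
        p.comap (algebraMap k[X][X] (Normalization R)) = Q} := hTset ▸ hpT
    rw [Multiset.count_eq_one_of_mem T.nodup hpT, if_pos hp.2, if_pos hp.2, hI, ← hcc]
    exact (count_differentIdeal_add_one hp.1 (hcc ▸ hmem p hp.1 hp.2)).symm
  · rw [Multiset.count_eq_zero_of_notMem hpT, add_zero]
    split_ifs with hpQ
    · have hnm : ¬ p.IsMaximal := fun h => hpT (show p ∈ (T : Set _) from hTset ▸ ⟨h, hpQ⟩)
      have h0 (J : Ideal (Normalization R)) : (normalizedFactors J).count p = 0 := by
        refine Multiset.count_eq_zero_of_notMem fun hp => hnm ?_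
        have hpr := prime_of_normalized_factor p hp
        exact (Ideal.isPrime_of_prime hpr).isMaximal hpr.ne_zero
      rw [h0, h0]
    · rfl

end

include hsurj hker hF hirr

/-- The Milnor number at a point, in terms of the conductor and the number of branches. -/
theorem locLength_jacobian (Dx : Derivation k k[X][X] k[X][X]) (hX : Dx (C X) = 1)
    (hY : Dx X = 0) (Q : Ideal k[X][X]) [Q.IsMaximal] (hFQ : F ∈ Q) :
    locLength Q (k[X][X] ⧸ Ideal.span {Dx F, derivative F}) +
      {p : Ideal (Normalization R) | p.IsMaximal ∧
        p.comap (algebraMap k[X][X] (Normalization R)) = Q}.encard =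
      locLength Q (Normalization R ⧸ conductorOf R (Normalization R)) + 1 := by
  have hlead : IsUnit F.leadingCoeff := hF.leadingCoeff ▸ isUnit_one
  have := finite_of_ker_eq_span hsurj hker hlead
  have := faithfulSMul_of_ker_eq_span hker hlead
  have := isDedekindDomain_normalization k[X] R
  have hres := hasResidueField_of_finite k (Normalization R)
  obtain ⟨c, hc⟩ := exists_sub_C_mem Q (C X)
  rw [← C_sub] at hc
  have hnd := not_dvd_derivative hF hirr
  -- A common irreducible factor of `F` and `F_Y` would be associated to `F`, which does not divide
  -- `F_Y`.
  have h1 := locLength_polar Dx hX hY Q hc hFQ (isUnit_leadingCoeff_derivative hF hirr) dvd_rfl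
    (fun g hg hgF' hgF => hnd (((hg.associated_of_dvd hirr hgF).symm.dvd).trans hgF'))
  have h2 := locLength_fiber Q hc hFQ (hF.map (evalRingHom c)).ne_zero
  have h3 := locLength_pair_eq_countOver hsurj hker hlead Q hnd
  have h4 := locLength_pair_eq_countOver hsurj hker hlead Q (not_dvd_C_X_sub_C hirr hlead c)
  have h5 := countOver_fiber hker hF hirr Q hc
  have hc0 := conductorOf_ne_bot hsurj hker hF hirr
  rw [← conductorOf_mul_differentIdeal hsurj hker hF hirr, countOver_mul Q hc0
    (differentIdeal_normalization_ne_bot hsurj hker hF hirr)] at h3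
  rw [Set.pair_comm F, h1] at h3
  rw [Set.pair_comm _ F, h4, h5, Set.pair_comm] at h2
  rw [locLength_quotient_ideal hres Q hc0, Set.pair_comm (Dx F)]
  -- What remains is to derive `a + n = e + 1` from `a + b = e + d` and `d + n = b + 1`. Since `d`
  -- and `e` are finite, so are `a`, `b` and `n`, and cancellation is allowed.
  generalize locLength Q (k[X][X] ⧸ Ideal.span {derivative F, Dx F}) = a at *
  generalize locLength Q (k[X][X] ⧸ Ideal.span {derivative F, C (X - C c)}) = b at *
  generalize Set.encard _ = n at *
  generalize countOver Q (differentIdeal k[X] (Normalization R)) = d at *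
  generalize countOver Q (conductorOf R (Normalization R)) = e at *
  have ha : a ≠ ⊤ := by
    rintro rfl
    rw [top_add] at h3
    exact ENat.natCast_ne_top (e + d) (by exact_mod_cast h3.symm)
  have hb : b ≠ ⊤ := by
    rintro rfl
    rw [add_top] at h3
    exact ENat.natCast_ne_top (e + d) (by exact_mod_cast h3.symm)
  lift a to ℕ using ha
  lift b to ℕ using hb
  have hn : n ≠ ⊤ := by
    rintro rfl
    rw [add_top] at h2
    exact ENat.natCast_ne_top (b + 1) (by exact_mod_cast h2.symm)
  lift n to ℕ using hn
  norm_cast at *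
  omega

end Local
end PlaneCurve
end

noncomputable section

namespace PlaneCurve

open Polynomial nonZeroDivisors

/-! ### Gorenstein duality for the conductor. -/

section Interval

variable {S V : Type*} [CommRing S] [AddCommGroup V] [Module S V]

/-- Length is the Krull dimension of an interval of submodules, a quantity that an order-reversing
bijection preserves. -/
theorem length_quotient_submoduleOf {M N : Submodule S V} (h : M ≤ N) :
    (Module.length S (N ⧸ M.submoduleOf N) : WithBot ℕ∞) = Order.krullDim (Set.Icc M N) := by
  rw [Module.coe_length, Order.krullDim_eq_of_orderIso
    (Submodule.comapMkQRelIso (M.submoduleOf N))]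
  let e : Set.Ici (M.submoduleOf N) ≃o Set.Icc M N :=
    { toFun x := ⟨x.1.map N.subtype, fun m hm => ⟨⟨m, h hm⟩, x.2 hm, rfl⟩,
        Submodule.map_subtype_le N x.1⟩
      invFun y := ⟨y.1.submoduleOf N, fun m hm => y.2.1 hm⟩
      left_inv x := Subtype.ext (Submodule.comap_map_eq_of_injective N.injective_subtype x.1)
      right_inv y := Subtype.ext (by
        simpa [Submodule.submoduleOf, Submodule.map_comap_subtype] using y.2.2)
      map_rel_iff' := Submodule.map_le_map_iff_of_injective N.injective_subtype _ _ }
  exact Order.krullDim_eq_of_orderIso e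

theorem length_quotient_submoduleOf_add {M N T : Submodule S V} (h : M ≤ N) (h' : N ≤ T) :
    Module.length S (T ⧸ M.submoduleOf T) =
      Module.length S (N ⧸ M.submoduleOf N) + Module.length S (T ⧸ N.submoduleOf T) := by
  have hle : M.submoduleOf T ≤ N.submoduleOf T := Submodule.comap_mono h
  refine Module.length_eq_add_of_exact
    (Submodule.mapQ (M.submoduleOf N) (M.submoduleOf T) (Submodule.inclusion h') fun x hx => hx)
    (Submodule.factor hle) ?_ (Submodule.factor_surjective hle) ?_
  · rw [injective_iff_map_eq_zero]
    intro x hx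
    obtain ⟨x, rfl⟩ := Submodule.Quotient.mk_surjective _ x
    have hx' : (x : V) ∈ M := (Submodule.Quotient.mk_eq_zero (M.submoduleOf T)).1 hx
    exact (Submodule.Quotient.mk_eq_zero _).2 hx'
  · intro x
    obtain ⟨x, rfl⟩ := Submodule.Quotient.mk_surjective _ x
    constructor
    · intro hx
      have hx' : (x : V) ∈ N := (Submodule.Quotient.mk_eq_zero (N.submoduleOf T)).1 hx
      exact ⟨Submodule.Quotient.mk ⟨x, hx'⟩, rfl⟩
    · rintro ⟨y, hy⟩
      obtain ⟨y, rfl⟩ := Submodule.Quotient.mk_surjective _ y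
      rw [← hy]
      exact (Submodule.Quotient.mk_eq_zero (N.submoduleOf T)).2 y.2

variable {L : Type*} [Field L] [Algebra S L]

theorem one_div_anti {M N : Submodule S L} (h : M ≤ N) : 1 / N ≤ 1 / M := by
  intro x hx
  rw [Submodule.mem_div_iff_forall_mul_mem] at hx ⊢
  exact fun y hy => hx y (h hy)

/-- If `N ↦ (S : N)` is an involution between `(S : T)` and `T`, then `T / S` and `S / (S : T)`
have the same length. -/
theorem length_quotient_one {T : Submodule S L} (hT : 1 ≤ T)
    (h : ∀ N, 1 / T ≤ N → N ≤ T → 1 / (1 / N) = N) :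
    Module.length S (T ⧸ (1 : Submodule S L).submoduleOf T) =
      Module.length S ((1 : Submodule S L) ⧸ (1 / T).submoduleOf 1) := by
  have h11 : (1 : Submodule S L) / 1 = 1 := by
    refine le_antisymm (fun x hx => ?_) ?_
    · simpa using Submodule.mem_div_iff_forall_mul_mem.1 hx 1 (Submodule.one_le.1 le_rfl)
    · rw [Submodule.le_div_iff_mul_le, mul_one]
  have hT1 : 1 / T ≤ 1 := (one_div_anti hT).trans h11.le
  rw [← WithBot.coe_inj, length_quotient_submoduleOf hT, length_quotient_submoduleOf hT1,
    ← Order.krullDim_orderDual]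
  let e : (Set.Icc 1 T)ᵒᵈ ≃o Set.Icc (1 / T) 1 :=
    { toFun x := ⟨1 / (OrderDual.ofDual x).1, one_div_anti (OrderDual.ofDual x).2.2,
        (one_div_anti (OrderDual.ofDual x).2.1).trans h11.le⟩
      invFun y := OrderDual.toDual ⟨1 / y.1, h11.symm.le.trans (one_div_anti y.2.2),
        (one_div_anti y.2.1).trans (h T (hT1.trans hT) le_rfl).le⟩
      left_inv x := Subtype.ext (h _ (hT1.trans x.2.1) x.2.2)
      right_inv y := Subtype.ext (h _ y.2.1 (y.2.2.trans hT))
      map_rel_iff' := by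
        intro x y
        refine ⟨fun hxy => ?_, fun hxy => one_div_anti hxy⟩
        have h1 := one_div_anti (show 1 / (OrderDual.ofDual x).1 ≤ 1 / (OrderDual.ofDual y).1 from hxy)
        exact (h _ (hT1.trans y.2.1) y.2.2).symm.le.trans (h1.trans (h _ (hT1.trans x.2.1) x.2.2).le) }
  exact Order.krullDim_eq_of_orderIso e

end Interval

section Lattice

variable (P K : Type*) {R L : Type*} [CommRing P] [IsDomain P] [IsPrincipalIdealRing P] [Field K]
  [Algebra P K] [IsFractionRing P K] [CommRing R] [Field L] [Algebra P R] [Algebra P L]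
  [Algebra R L] [Algebra K L] [IsScalarTower P R L] [IsScalarTower P K L] [Module.Finite P R]
  [FiniteDimensional K L] [Algebra.IsSeparable K L]
  [IsLocalization (Algebra.algebraMapSubmonoid R P⁰) L]

/-- A monogenic order is Gorenstein: duality `N ↦ (R : N)` is an involution on its lattices. -/
theorem one_div_one_div {x : L} (hx : IsIntegral P x) (hxK : Algebra.adjoin K {x} = ⊤)
    (hR : (Algebra.adjoin P {x} : Set L) = (algebraMap R L).range) {N : Submodule R L}
    (hN : N.FG) (hN0 : N ≠ ⊥) : 1 / (1 / N) = N := by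
  -- Euler's formula: the trace dual of `P[x]` is `w P[x]`.
  set w : L := (aeval x (derivative (minpoly K x)))⁻¹ with hw
  have hint : IsIntegral K x := hx.tower_top
  have hw0 : w ≠ 0 := inv_ne_zero
    ((Algebra.IsSeparable.isSeparable K x).aeval_derivative_ne_zero (minpoly.aeval K x))
  set T := Algebra.traceForm K L with hT
  have hdual (z : L) : z ∈ (1 : Submodule R L) ↔ ∀ r : R, T (w * z) (algebraMap R L r) ∈ (1 : Submodule P K) := by
    have h1 : z ∈ (1 : Submodule R L) ↔ z ∈ Subalgebra.toSubmodule (Algebra.adjoin P {x}) := by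
      rw [Subalgebra.mem_toSubmodule, ← SetLike.mem_coe (p := Algebra.adjoin P {x}), hR, Submodule.mem_one]
      rfl
    have h2 : z ∈ Subalgebra.toSubmodule (Algebra.adjoin P {x}) ↔
        w * z ∈ T.dualSubmodule (Subalgebra.toSubmodule (Algebra.adjoin P {x})) := by
      rw [traceForm_dualSubmodule_adjoin P K hxK hx, ← hw,
        Submodule.mem_smul_pointwise_iff_exists]
      exact ⟨fun h => ⟨z, h, rfl⟩, fun ⟨b, hb, h⟩ => mul_left_cancel₀ hw0 h ▸ hb⟩
    rw [h1, h2, LinearMap.BilinForm.mem_dualSubmodule]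
    constructor
    · intro h r
      refine h _ ?_
      rw [Subalgebra.mem_toSubmodule, ← SetLike.mem_coe (p := Algebra.adjoin P {x}), hR]
      exact ⟨r, rfl⟩
    · intro h y hy
      rw [Subalgebra.mem_toSubmodule, ← SetLike.mem_coe (p := Algebra.adjoin P {x}), hR] at hy
      obtain ⟨r, rfl⟩ := hy
      exact h r
  -- Thus `(R : M)` is `w⁻¹` times the trace dual of `M`, and the claim reduces to biduality for the
  -- trace form.
  have hmem (M : Submodule R L) (y : L) :
      y ∈ 1 / M ↔ w * y ∈ T.dualSubmodule (M.restrictScalars P) := by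
    rw [Submodule.mem_div_iff_forall_mul_mem, LinearMap.BilinForm.mem_dualSubmodule]
    constructor
    · intro h m hm
      have h1 := (hdual _).1 (h m hm) 1
      rwa [hT, Algebra.traceForm_apply, map_one, mul_one, ← mul_assoc] at h1
    · intro h m hm
      rw [hdual]
      intro r
      have h1 := h (r • m) (M.smul_mem r hm)
      rw [hT, Algebra.traceForm_apply] at h1 ⊢
      rw [Algebra.smul_def] at h1
      convert h1 using 2
      ring
  -- A nonzero finitely generated `N` is a full lattice: `l / c` has a denominator in `P`, so a
  -- single nonzero `c` in `N` already spans `L`. Over the principal ideal domain `P` it is then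
  -- free, which gives biduality.
  have hlat : Submodule.IsLattice K (N.restrictScalars P) := by
    refine ⟨?_, ?_⟩
    · have : Module.Finite R N := Module.Finite.iff_fg.2 hN
      have : Module.Finite P N := Module.Finite.trans R N
      exact Module.Finite.iff_fg.1 (inferInstanceAs (Module.Finite P N))
    · obtain ⟨c, hc, hc0⟩ := (Submodule.ne_bot_iff N).1 hN0
      rw [eq_top_iff]
      intro l _
      obtain ⟨⟨r, ⟨_, p, hp, rfl⟩⟩, hr⟩ :=
        IsLocalization.surj (M := Algebra.algebraMapSubmonoid R P⁰) (l / c)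
      have hp' : algebraMap P K p ≠ 0 :=
        (map_ne_zero_iff _ (IsFractionRing.injective _ _)).2 (nonZeroDivisors.ne_zero hp)
      have hl : l = (algebraMap P K p)⁻¹ • (r • c) := by
        rw [eq_inv_smul_iff₀ hp', Algebra.smul_def, Algebra.smul_def, ← hr,
          ← IsScalarTower.algebraMap_apply P K L, ← IsScalarTower.algebraMap_apply P R L]
        field_simp
      rw [hl]
      exact Submodule.smul_mem _ _ (Submodule.subset_span (N.smul_mem r hc))
  have hdd : T.dualSubmodule (T.dualSubmodule (N.restrictScalars P)) = N.restrictScalars P := by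
    have : Module.IsTorsionFree P K := inferInstance
    have : Module.Free P (N.restrictScalars P) := Submodule.IsLattice.free K _
    have b := Module.Free.chooseBasis P (N.restrictScalars P)
    have hb : Submodule.span P (Set.range (b.extendOfIsLattice K)) = N.restrictScalars P := by
      have h1 : Set.range (b.extendOfIsLattice K) =
          (N.restrictScalars P).subtype '' Set.range b := by
        rw [← Set.range_comp]
        congr 1
        ext i
        simp
      rw [h1, ← Submodule.map_span, b.span_eq, Submodule.map_subtype_top]
    rw [← hb]
    exact LinearMap.BilinForm.dualSubmodule_dualSubmodule_of_basis _
      (traceForm_nondegenerate K L) (Algebra.traceForm_isSymm K) _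
  ext z
  rw [hmem, ← Submodule.restrictScalars_mem P N z, ← hdd,
    LinearMap.BilinForm.mem_dualSubmodule, LinearMap.BilinForm.mem_dualSubmodule]
  -- As `u` runs through `(R : N)`, `w * u` runs through the dual of `N`; moving `w` across the form
  -- turns the double quotient into the double dual.
  have hswap (u : L) : T (w * z) u = T z (w * u) := by
    rw [hT, Algebra.traceForm_apply, Algebra.traceForm_apply]
    congr 1
    ring
  constructor
  · intro h u hu
    have h1 := h (w⁻¹ * u) ((hmem N _).2 (by rwa [mul_inv_cancel_left₀ hw0]))
    rwa [hswap, mul_inv_cancel_left₀ hw0] at h1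
  · intro h u hu
    rw [hswap]
    exact h _ ((hmem N u).1 hu)

end Lattice

section Normalization

variable {R : Type*} [CommRing R]

theorem algebraMap_mem_conductorOf {r : R} :
    algebraMap R (Normalization R) r ∈ conductorOf R (Normalization R) ↔ r ∈ conductorIdeal R := by
  refine forall_congr' fun t => ?_
  exact ⟨fun ⟨s, hs⟩ => ⟨s, hs.symm⟩, fun ⟨s, hs⟩ => ⟨s, hs.symm⟩⟩

theorem mem_conductorInNormalization {b : Normalization R} :
    b ∈ conductorInNormalization R ↔ b ∈ conductorOf R (Normalization R) := by
  constructor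
  · rintro ⟨r, hr, rfl⟩
    exact algebraMap_mem_conductorOf.2 hr
  · intro hb
    obtain ⟨r, hr⟩ := hb 1
    rw [mul_one] at hr
    rw [← hr] at hb
    exact ⟨r, algebraMap_mem_conductorOf.1 hb, hr⟩

variable [IsDomain R]

-- The conductor is the dual of the normalization, which brings it within reach of
-- `length_quotient_one`.
omit [IsDomain R] in
theorem mem_one_div_normalization {b : FractionRing R} :
    b ∈ (1 / Subalgebra.toSubmodule (integralClosure R (FractionRing R)) : Submodule R _) ↔
      ∃ r ∈ conductorIdeal R, algebraMap R (FractionRing R) r = b := by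
  rw [Submodule.mem_div_iff_forall_mul_mem]
  constructor
  · intro h
    obtain ⟨r, hr⟩ := Submodule.mem_one.1 (h 1 (one_mem (integralClosure R (FractionRing R))))
    rw [mul_one] at hr
    refine ⟨r, fun t => ?_, hr⟩
    obtain ⟨s, hs⟩ := Submodule.mem_one.1 (h t t.2)
    rw [← hr] at hs
    exact ⟨s, Subtype.ext hs.symm⟩
  · rintro ⟨r, hr, rfl⟩ t ht
    obtain ⟨s, hs⟩ := hr ⟨t, ht⟩
    exact Submodule.mem_one.2 ⟨s, (congrArg Subtype.val hs).symm⟩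

/-- The Gorenstein equality for a domain with involutive duality. -/
theorem length_normalization_quotient_conductor
    (h : ∀ N : Submodule R (FractionRing R), N.FG → N ≠ ⊥ → 1 / (1 / N) = N) [IsNoetherianRing R]
    [Module.Finite R (Normalization R)] (hc : conductorIdeal R ≠ ⊥) :
    Module.length R (Normalization R ⧸ conductorInNormalization R) =
      2 * Module.length R (R ⧸ conductorIdeal R) := by
  set T := Subalgebra.toSubmodule (integralClosure R (FractionRing R)) with hT
  have h1T : 1 ≤ T := by
    intro b hb
    obtain ⟨r, rfl⟩ := Submodule.mem_one.1 hb
    exact (algebraMap R (Normalization R) r).2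
  have hT1 : 1 / T ≤ 1 := by
    intro b hb
    obtain ⟨r, -, hr⟩ := mem_one_div_normalization.1 hb
    exact Submodule.mem_one.2 ⟨r, hr⟩
  have hfin : Module.Finite R T := inferInstanceAs (Module.Finite R (Normalization R))
  have hdual (N : Submodule R (FractionRing R)) (hN : 1 / T ≤ N) (hNT : N ≤ T) :
      1 / (1 / N) = N := by
    refine h N ?_ ?_
    · have : IsNoetherian R T := isNoetherian_of_isNoetherianRing_of_finite R T
      exact Submodule.FG.of_le (Module.Finite.iff_fg.1 hfin) hNT
    · obtain ⟨r, hr, hr0⟩ := (Submodule.ne_bot_iff _).1 hc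
      refine (Submodule.ne_bot_iff _).2 ⟨algebraMap R _ r, hN ?_, ?_⟩
      · exact mem_one_div_normalization.2 ⟨r, hr, rfl⟩
      · exact (map_ne_zero_iff _ (IsFractionRing.injective R _)).2 hr0
  have h1 : Module.length R (Normalization R ⧸ conductorInNormalization R) =
      Module.length R (T ⧸ (1 / T).submoduleOf T) := by
    refine (Submodule.Quotient.equiv _ _ (Subalgebra.toSubmoduleEquiv _).symm ?_).length_eq
    ext b
    rw [Submodule.mem_map_equiv]
    change _ ↔ (b : FractionRing R) ∈ 1 / T
    rw [mem_one_div_normalization]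
    refine exists_congr fun r => and_congr_right fun _ => ?_
    exact Subtype.ext_iff
  have h2 : Module.length R (R ⧸ conductorIdeal R) =
      Module.length R ((1 : Submodule R (FractionRing R)) ⧸ (1 / T).submoduleOf 1) := by
    let φ : R →ₗ[R] (1 : Submodule R (FractionRing R)) ⧸ (1 / T).submoduleOf 1 :=
      (Submodule.mkQ _) ∘ₗ (Algebra.linearMap R (FractionRing R)).codRestrict 1
        fun r => Submodule.mem_one.2 ⟨r, rfl⟩
    have hφ : Function.Surjective φ := by
      intro x
      obtain ⟨⟨x, hx⟩, rfl⟩ := Submodule.Quotient.mk_surjective _ x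
      obtain ⟨r, rfl⟩ := Submodule.mem_one.1 hx
      exact ⟨r, rfl⟩
    have hker : LinearMap.ker φ = conductorIdeal R := by
      ext r
      have h3 : r ∈ LinearMap.ker φ ↔ algebraMap R (FractionRing R) r ∈ 1 / T :=
        Submodule.Quotient.mk_eq_zero _
      rw [h3, mem_one_div_normalization]
      constructor
      · rintro ⟨s, hs, hrs⟩
        rwa [← IsFractionRing.injective R _ hrs]
      · intro hr
        exact ⟨r, hr, rfl⟩
    exact (Submodule.quotEquivOfEq _ _ hker.symm ≪≫ₗ φ.quotKerEquivOfSurjective hφ).length_eq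
  -- The quotient by the conductor is cut at `R`, and duality matches the upper part with the lower
  -- one.
  rw [h1, length_quotient_submoduleOf_add hT1 h1T, length_quotient_one h1T hdual, ← h2, two_mul]

end Normalization

section Curve

attribute [local instance] FractionRing.liftAlgebra FractionRing.isScalarTower_liftAlgebra

variable {k R : Type*} [Field k] [CharZero k] [CommRing R] [IsDomain R] [Algebra k[X] R]
  [Module.Finite k[X] R] [FaithfulSMul k[X] R]

theorem conductorIdeal_ne_bot (k R : Type*) [Field k] [CharZero k] [CommRing R] [IsDomain R]
    [Algebra k[X] R] [Module.Finite k[X] R] [FaithfulSMul k[X] R] : conductorIdeal R ≠ ⊥ := by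
  have := finite_normalization k[X] R
  obtain ⟨d, hd, hdc⟩ := exists_algebraMap_mem_conductorOf (R := R) exists_mul_mem_range
  exact (Submodule.ne_bot_iff _).2 ⟨d, algebraMap_mem_conductorOf.1 hdc, hd⟩

/-- `R` is Noetherian of dimension at most one, so its quotient by a nonzero element of the
conductor has finite length. -/
theorem isFiniteLength_quotient_conductorIdeal (k R : Type*) [Field k] [CharZero k] [CommRing R]
    [IsDomain R] [Algebra k[X] R] [Module.Finite k[X] R] [FaithfulSMul k[X] R] :
    IsFiniteLength R (R ⧸ conductorIdeal R) := by
  obtain ⟨d, hd, hd0⟩ := (Submodule.ne_bot_iff _).1 (conductorIdeal_ne_bot k R)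
  have : IsNoetherianRing R := IsNoetherianRing.of_finite k[X] R
  have : Ring.DimensionLEOne R := Ring.DimensionLEOne.of_isIntegral k[X] R
  have h := isFiniteLength_quotient_span_singleton R (mem_nonZeroDivisors_of_ne_zero hd0)
  have hle : Ideal.span {d} ≤ conductorIdeal R := (Ideal.span_singleton_le_iff_mem _).2 hd
  exact h.of_surjective (Submodule.factor_surjective hle)

variable [Algebra k[X][X] R] [IsScalarTower k[X] k[X][X] R]

theorem length_curve_conductor (hsurj : Function.Surjective (algebraMap k[X][X] R)) :
    Module.length R (Normalization R ⧸ conductorInNormalization R) =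
      2 * Module.length R (R ⧸ conductorIdeal R) := by
  have : IsNoetherianRing R := IsNoetherianRing.of_finite k[X] R
  have := finite_normalization k[X] R
  refine length_normalization_quotient_conductor (fun N hN hN0 => ?_) (conductorIdeal_ne_bot k R)
  have hint : IsIntegral k[X] (algebraMap k[X][X] (Normalization R) X) :=
    Algebra.IsIntegral.isIntegral _
  refine one_div_one_div k[X] (FractionRing k[X])
    (x := algebraMap (Normalization R) (FractionRing R) (algebraMap k[X][X] (Normalization R) X))
    hint.algebraMap (adjoin_fractionRing_eq_top hsurj) ?_ hN hN0
  have h1 : Algebra.adjoin k[X] {algebraMap (Normalization R) (FractionRing R)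
      (algebraMap k[X][X] (Normalization R) X)} =
      (Algebra.adjoin k[X] {algebraMap k[X][X] (Normalization R) X}).map
        (IsScalarTower.toAlgHom k[X] (Normalization R) (FractionRing R)) := by
    rw [AlgHom.map_adjoin_singleton]
    rfl
  rw [h1, Subalgebra.coe_map, adjoin_eq_range hsurj]
  ext z
  constructor
  · rintro ⟨_, ⟨r, rfl⟩, rfl⟩
    exact ⟨r, rfl⟩
  · rintro ⟨r, rfl⟩
    exact ⟨_, ⟨r, rfl⟩, rfl⟩

end Curve
end PlaneCurve
end

noncomputable section

namespace PlaneCurve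

/-! ### Places of a function field and primes of the normalization. -/

section ValuationSubrings

variable {B L : Type*} [CommRing B] [IsDedekindDomain B] [Field L] [Algebra B L] [IsFractionRing B L]

/-- The localization of a Dedekind domain at a nonzero prime, as a valuation subring. -/
def valuationSubringAt (p : Ideal B) [p.IsPrime] (hp : p ≠ ⊥) :
    ValuationSubring L where
  carrier := {x | ∃ a b : B, b ∉ p ∧ x * algebraMap B L b = algebraMap B L a}
  mul_mem' := by
    rintro x y ⟨a, b, hb, h⟩ ⟨c, d, hd, h'⟩
    exact ⟨a * c, b * d, Ideal.IsPrime.mul_notMem ‹_› hb hd, by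
      rw [map_mul, map_mul, ← h, ← h']; ring⟩
  one_mem' := ⟨1, 1, Ideal.one_notMem p, by simp⟩
  add_mem' := by
    rintro x y ⟨a, b, hb, h⟩ ⟨c, d, hd, h'⟩
    exact ⟨a * d + c * b, b * d, Ideal.IsPrime.mul_notMem ‹_› hb hd, by
      rw [map_add, map_mul, map_mul, map_mul, ← h, ← h']; ring⟩
  zero_mem' := ⟨0, 1, Ideal.one_notMem p, by simp⟩
  neg_mem' := by
    rintro x ⟨a, b, hb, h⟩
    exact ⟨-a, b, hb, by rw [map_neg, ← h, neg_mul]⟩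
  mem_or_inv_mem' := by
    intro x
    have := IsLocalization.AtPrime.isDiscreteValuationRing_of_dedekind_domain B hp
      (Localization.AtPrime p)
    obtain ⟨a, b, hb, rfl⟩ := IsFractionRing.div_surjective (A := B) x
    have hinj := IsFractionRing.injective B L
    have hb0 := nonZeroDivisors.ne_zero hb
    have hb' : algebraMap B L b ≠ 0 := (map_ne_zero_iff _ hinj).2 hb0
    have key (a b : B) (h : algebraMap B (Localization.AtPrime p) a ∣ algebraMap B _ b) :
        ∃ c d : B, d ∉ p ∧ b * d = a * c := by
      obtain ⟨z, hz⟩ := h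
      obtain ⟨c, d, rfl⟩ := IsLocalization.exists_mk'_eq p.primeCompl z
      refine ⟨c, d, d.2, IsLocalization.injective (Localization.AtPrime p)
        p.primeCompl_le_nonZeroDivisors ?_⟩
      rw [map_mul, hz, map_mul, mul_assoc, IsLocalization.mk'_spec]
    rcases ValuationRing.dvd_total (algebraMap B (Localization.AtPrime p) a) (algebraMap B _ b)
      with h | h
    · right
      obtain ⟨c, d, hd, hcd⟩ := key a b h
      refine ⟨c, d, hd, ?_⟩
      have ha0 : algebraMap B L a ≠ 0 := by
        rintro ha
        rw [map_eq_zero_iff _ hinj] at ha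
        rw [ha, zero_mul] at hcd
        rcases mul_eq_zero.1 hcd with h | h
        · exact hb0 h
        · exact hd (h ▸ zero_mem p)
      have := congrArg (algebraMap B L) hcd
      rw [map_mul, map_mul] at this
      field_simp
      linear_combination this
    · left
      obtain ⟨c, d, hd, hcd⟩ := key b a h
      refine ⟨c, d, hd, ?_⟩
      have := congrArg (algebraMap B L) hcd
      rw [map_mul, map_mul] at this
      field_simp
      linear_combination this

theorem mem_valuationSubringAt {p : Ideal B} [p.IsPrime] {hp : p ≠ ⊥}
    {x : L} : x ∈ valuationSubringAt p hp ↔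
      ∃ a b : B, b ∉ p ∧ x * algebraMap B L b = algebraMap B L a := Iff.rfl

theorem algebraMap_mem_nonunits_valuationSubringAt {p : Ideal B} [p.IsPrime]
    {hp : p ≠ ⊥} {b : B} :
    algebraMap B L b ∈ (valuationSubringAt p hp : ValuationSubring L).nonunits ↔ b ∈ p := by
  have hinj := IsFractionRing.injective B L
  rw [ValuationSubring.mem_nonunits_iff_or, mem_valuationSubringAt, map_eq_zero_iff _ hinj]
  constructor
  · rintro (rfl | h)
    · exact zero_mem p
    · by_contra hb
      refine h ⟨1, b, hb, ?_⟩
      rw [map_one, inv_mul_cancel₀]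
      rw [map_ne_zero_iff _ hinj]
      rintro rfl
      exact hb (zero_mem p)
  · intro hb
    rw [or_iff_not_imp_left]
    rintro hb0 ⟨c, d, hd, h⟩
    have hb0' : algebraMap B L b ≠ 0 := (map_ne_zero_iff _ hinj).2 hb0
    rw [inv_mul_eq_iff_eq_mul₀ hb0', ← map_mul] at h
    exact hd (hinj h ▸ p.mul_mem_right _ hb)

/-- `V` dominates the localization of `B` at `p`, and a valuation ring is maximal for domination. -/
theorem eq_valuationSubringAt {p : Ideal B} [p.IsPrime] (hp : p ≠ ⊥)
    {V : ValuationSubring L} (hV : ∀ b : B, algebraMap B L b ∈ V)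
    (hp' : ∀ b : B, algebraMap B L b ∈ V.nonunits ↔ b ∈ p) : V = valuationSubringAt p hp := by
  have hle : ∀ x ∈ (valuationSubringAt p hp : ValuationSubring L), x ∈ V := by
    rintro x ⟨a, b, hb, h⟩
    rw [← hp', ValuationSubring.mem_nonunits_iff_or, not_or, not_not] at hb
    rw [← eq_mul_inv_iff_mul_eq₀ hb.1] at h
    exact h ▸ V.mul_mem _ _ (hV a) hb.2
  refine le_antisymm (fun x hx => ?_) hle
  by_contra hx'
  rcases (valuationSubringAt p hp).mem_or_inv_mem x with h | ⟨a, b, hb, h⟩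
  · exact hx' h
  · have hb0 : algebraMap B L b ≠ 0 := by
      rw [map_ne_zero_iff _ (IsFractionRing.injective B L)]
      rintro rfl
      exact hb (zero_mem p)
    have hx0 : x ≠ 0 := by
      rintro rfl
      exact hx' (zero_mem _)
    rw [inv_mul_eq_iff_eq_mul₀ hx0] at h
    by_cases ha : a ∈ p
    · rw [← hp', ValuationSubring.mem_nonunits_iff_or] at hb ha
      rw [not_or, not_not] at hb
      rcases ha with ha | ha
      · rw [ha, mul_zero] at h
        exact hb0 h
      · refine ha ?_
        have : (algebraMap B L a)⁻¹ = x * (algebraMap B L b)⁻¹ := by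
          rw [h, mul_inv, mul_inv_cancel_left₀ hx0]
        exact this ▸ V.mul_mem _ _ hx hb.2
    · exact hx' ⟨b, a, ha, h.symm⟩

/-- The valuation subrings containing a Dedekind domain `B` with center over `q` correspond to the
primes of `B` over `q`. -/
theorem encard_valuationSubring {R : Type*} [CommRing R] [Algebra R B]
    [Algebra.IsIntegral R B] [Algebra R L] [IsScalarTower R B L] (q : Ideal R) [q.IsMaximal]
    (hB : ∀ p : Ideal B, p.IsMaximal → p ≠ ⊥) :
    {V : ValuationSubring L | (∀ b : B, algebraMap B L b ∈ V) ∧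
      ∀ r : R, algebraMap R L r ∈ V.nonunits ↔ r ∈ q}.encard =
    {p : Ideal B | p.IsMaximal ∧ p.comap (algebraMap R B) = q}.encard := by
  symm
  refine Set.encard_congr (Equiv.ofBijective (fun p => ⟨have := p.2.1.isPrime
    valuationSubringAt p.1 (hB _ p.2.1), ?_, ?_⟩) ⟨?_, ?_⟩)
  · exact fun b => ⟨b, 1, (Ideal.ne_top_iff_one _).1 p.2.1.ne_top, by simp⟩
  · have := p.2.1.isPrime
    intro r
    rw [IsScalarTower.algebraMap_apply R B L, algebraMap_mem_nonunits_valuationSubringAt,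
      ← Ideal.mem_comap, p.2.2]
  · intro p p' h
    have := p.2.1.isPrime
    have := p'.2.1.isPrime
    have h1 := congrArg Subtype.val h
    dsimp only at h1
    refine Subtype.ext (Ideal.ext fun b => ?_)
    rw [← algebraMap_mem_nonunits_valuationSubringAt (L := L) (hp := hB _ p.2.1), h1,
      algebraMap_mem_nonunits_valuationSubringAt]
  -- The prime sought is the center of `V` on `B`; it is maximal because it lies over the maximal
  -- ideal `q` in an integral extension.
  · rintro ⟨V, hV, hVq⟩
    let φ : B →+* V := (algebraMap B L).codRestrict V hV
    have hmem (b : B) : algebraMap B L b ∈ V.nonunits ↔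
        b ∈ (IsLocalRing.maximalIdeal V).comap φ := by
      rw [Ideal.mem_comap, ← ValuationSubring.coe_mem_nonunits_iff]
      rfl
    have hcomap : ((IsLocalRing.maximalIdeal V).comap φ).comap (algebraMap R B) = q := by
      ext r
      rw [Ideal.mem_comap, ← hmem, ← IsScalarTower.algebraMap_apply, hVq]
    have hmax : ((IsLocalRing.maximalIdeal V).comap φ).IsMaximal :=
      Ideal.isMaximal_of_isIntegral_of_isMaximal_comap _ (hcomap.symm ▸ ‹q.IsMaximal›)
    exact ⟨⟨_, hmax, hcomap⟩, Subtype.ext (eq_valuationSubringAt (hB _ hmax) hV hmem).symm⟩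

end ValuationSubrings

/-! ### Normalization, conductor and branches under localization. -/

section NormalizationMap

variable {R : Type*} [CommRing R] [IsDomain R] (q : Ideal R) [q.IsPrime]
  (Rq : Type*) [CommRing Rq] [IsDomain Rq] [Algebra R Rq] [IsLocalization.AtPrime Rq q]

/-- The fraction fields of a domain and of its localization at a prime agree. -/
def fractionRingEquiv : FractionRing R ≃ₐ[R] FractionRing Rq := by
  let g : Rq →+* FractionRing R := IsLocalization.lift (M := q.primeCompl)
    (g := algebraMap R (FractionRing R)) fun s => by
      rw [isUnit_iff_ne_zero, map_ne_zero_iff _ (IsFractionRing.injective R (FractionRing R))]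
      exact fun h => s.2 (h ▸ zero_mem q)
  let _ : Algebra Rq (FractionRing R) := g.toAlgebra
  have : IsScalarTower R Rq (FractionRing R) :=
    .of_algebraMap_eq fun r => (IsLocalization.lift_eq (M := q.primeCompl) _ r).symm
  have := IsFractionRing.isFractionRing_of_isDomain_of_isLocalization q.primeCompl Rq
    (FractionRing R)
  exact ((FractionRing.algEquiv Rq (FractionRing R)).restrictScalars R).symm

/-- The map of normalizations induced by localization. -/
def normalizationMap : Normalization R →ₐ[R] Normalization Rq :=
  AlgHom.codRestrict ((fractionRingEquiv q Rq).toAlgHom.comp (IsScalarTower.toAlgHom R (Normalization R) (FractionRing R)))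
    ((integralClosure Rq (FractionRing Rq)).restrictScalars R)
    fun b => (IsIntegral.map (fractionRingEquiv q Rq) b.2).tower_top

omit [IsDomain Rq] in
theorem coe_normalizationMap (b : Normalization R) :
    (normalizationMap q Rq b : FractionRing Rq) =
      fractionRingEquiv q Rq (b : FractionRing R) := rfl

omit [IsDomain Rq] in
theorem normalizationMap_injective : Function.Injective (normalizationMap q Rq) := by
  intro a b h
  have h1 := congrArg Subtype.val h
  rw [coe_normalizationMap, coe_normalizationMap] at h1
  exact Subtype.ext ((fractionRingEquiv q Rq).injective h1)

omit [IsDomain Rq] in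
theorem exists_smul_eq_normalizationMap (t : Normalization Rq) :
    ∃ s : q.primeCompl, ∃ b, s • t = normalizationMap q Rq b := by
  obtain ⟨s, hs⟩ := IsIntegral.exists_multiple_integral_of_isLocalization q.primeCompl
    (t : FractionRing Rq) t.2
  refine ⟨s, ⟨(fractionRingEquiv q Rq).symm (s • (t : FractionRing Rq)),
    hs.map (fractionRingEquiv q Rq).symm⟩, Subtype.ext ?_⟩
  rw [coe_normalizationMap]
  exact ((fractionRingEquiv q Rq).apply_symm_apply _).symm

instance : IsLocalizedModule q.primeCompl (normalizationMap q Rq).toLinearMap where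
  map_units s := by
    have h : IsUnit (algebraMap R (Normalization Rq) s) := by
      rw [IsScalarTower.algebraMap_apply R Rq]
      exact (IsLocalization.map_units Rq s).map _
    refine (Module.End.isUnit_iff _).2 ⟨fun x y hxy => ?_, fun x => ?_⟩
    · refine h.mul_left_cancel ?_
      rw [← Algebra.smul_def, ← Algebra.smul_def]
      exact hxy
    · obtain ⟨u, hu⟩ := h
      refine ⟨↑u⁻¹ * x, ?_⟩
      rw [Module.algebraMap_end_apply, Algebra.smul_def, ← hu, Units.mul_inv_cancel_left]
  surj t := by
    obtain ⟨s, b, h⟩ := exists_smul_eq_normalizationMap q Rq t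
    exact ⟨(b, s), h⟩
  exists_of_eq h := ⟨1, congrArg _ (normalizationMap_injective q Rq h)⟩

variable {Rq} in
omit [IsDomain Rq] in
theorem normalizationMap_mem_range {b : Normalization R}
    (h : normalizationMap q Rq b ∈ (algebraMap Rq (Normalization Rq)).range) :
    ∃ s : q.primeCompl, s • b ∈ (algebraMap R (Normalization R)).range := by
  obtain ⟨u, hu⟩ := h
  obtain ⟨a, s, rfl⟩ := IsLocalization.exists_mk'_eq q.primeCompl u
  refine ⟨s, a, normalizationMap_injective q Rq ?_⟩
  rw [AlgHom.commutes, Submonoid.smul_def, map_smul, ← hu, ← algebraMap_smul Rq (s : R),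
    Algebra.smul_def, ← map_mul, mul_comm, IsLocalization.mk'_spec]
  exact IsScalarTower.algebraMap_apply R Rq _ a

-- Denominators for a finite set of generators multiply to one that serves all of the normalization
-- at once.
omit [IsDomain R] in
theorem exists_mul_mem_conductorIdeal [Module.Finite R (Normalization R)] (M : Submonoid R) (r : R)
    (h : ∀ b : Normalization R, ∃ s : M,
      s • (algebraMap R (Normalization R) r * b) ∈ (algebraMap R (Normalization R)).range) :
    ∃ s : M, s * r ∈ conductorIdeal R := by
  classical
  obtain ⟨T, hT⟩ := Module.Finite.fg_top (R := R) (M := Normalization R)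
  choose σ hσ using h
  refine ⟨∏ b ∈ T, σ b, ?_⟩
  rw [← algebraMap_mem_conductorOf]
  intro t
  have ht : t ∈ Submodule.span R (T : Set (Normalization R)) := hT ▸ Submodule.mem_top
  induction ht using Submodule.span_induction with
  | mem b hb =>
    rw [← Finset.prod_erase_mul T σ hb, Submonoid.coe_mul, mul_assoc, map_mul, map_mul, mul_assoc,
      mul_assoc, ← Algebra.smul_def (σ b : R)]
    exact mul_mem ⟨_, rfl⟩ (hσ b)
  | zero =>
    rw [mul_zero]
    exact zero_mem _
  | add x y _ _ hx hy =>
    rw [mul_add]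
    exact add_mem hx hy
  | smul a x _ hx =>
    rw [mul_smul_comm, Algebra.smul_def]
    exact mul_mem ⟨_, rfl⟩ hx

-- The inclusion of the left side in the right needs a common denominator, hence the finiteness of
-- the normalization; the other inclusion only clears denominators.
omit [IsDomain Rq] in
include q in
theorem conductorIdeal_localization [Module.Finite R (Normalization R)] :
    conductorIdeal Rq = (conductorIdeal R).map (algebraMap R Rq) := by
  ext u
  rw [IsLocalization.mem_map_algebraMap_iff q.primeCompl]
  constructor
  · intro hu
    obtain ⟨r, s, rfl⟩ := IsLocalization.exists_mk'_eq q.primeCompl u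
    obtain ⟨s', hs'⟩ := exists_mul_mem_conductorIdeal q.primeCompl r fun b => by
      refine normalizationMap_mem_range q (Rq := Rq) ?_
      obtain ⟨w, hw⟩ := hu (normalizationMap q Rq b)
      refine ⟨algebraMap R Rq s * w, ?_⟩
      rw [map_mul, ← hw, ← mul_assoc, ← map_mul, mul_comm (algebraMap R Rq s),
        IsLocalization.mk'_spec, map_mul, AlgHom.commutes]
      rfl
    refine ⟨⟨⟨s' * r, hs'⟩, s' * s⟩, ?_⟩
    rw [Submonoid.coe_mul, map_mul, map_mul, mul_left_comm, IsLocalization.mk'_spec]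
  · rintro ⟨⟨⟨i, hi⟩, s⟩, hu⟩ t
    obtain ⟨s', b, hb⟩ := exists_smul_eq_normalizationMap q Rq t
    obtain ⟨a, ha⟩ := hi b
    have ha' := congrArg (normalizationMap q Rq) ha
    rw [map_mul, AlgHom.commutes, AlgHom.commutes, ← hb] at ha'
    have hunit : IsUnit (algebraMap R Rq (s * s')) := IsLocalization.map_units Rq (s * s')
    refine ⟨IsLocalization.mk' Rq a (s * s'), ?_⟩
    refine (hunit.map (algebraMap Rq (Normalization Rq))).mul_left_cancel ?_
    rw [← map_mul, mul_comm _ (IsLocalization.mk' Rq a (s * s')), ← Submonoid.coe_mul,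
      IsLocalization.mk'_spec]
    refine Eq.trans ?_ (ha'.trans (IsScalarTower.algebraMap_apply R Rq (Normalization Rq) a))
    rw [IsScalarTower.algebraMap_apply R Rq (Normalization Rq) i, ← hu, Submonoid.smul_def,
      Algebra.smul_def, IsScalarTower.algebraMap_apply R Rq (Normalization Rq) s',
      Submonoid.coe_mul, map_mul, map_mul, map_mul]
    ring

omit [IsDomain Rq] in
theorem localized_conductorInNormalization [Module.Finite R (Normalization R)] :
    (conductorInNormalization R).localized' Rq q.primeCompl (normalizationMap q Rq).toLinearMap =
      conductorInNormalization Rq := by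
  ext t
  rw [Submodule.mem_localized']
  constructor
  · rintro ⟨_, ⟨r, hr, rfl⟩, s, rfl⟩
    refine ⟨IsLocalization.mk' Rq r s, ?_, ?_⟩
    · rw [conductorIdeal_localization q Rq]
      exact (IsLocalization.mem_map_algebraMap_iff q.primeCompl Rq).2
        ⟨⟨⟨r, hr⟩, s⟩, IsLocalization.mk'_spec _ _ _⟩
    · rw [eq_comm, IsLocalizedModule.mk'_eq_iff, Submonoid.smul_def,
        ← algebraMap_smul Rq (s : R), ← map_smul, smul_eq_mul, mul_comm, IsLocalization.mk'_spec]
      exact ((normalizationMap q Rq).commutes r).trans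
        (IsScalarTower.algebraMap_apply R Rq (Normalization Rq) r)
  · rintro ⟨u, hu, rfl⟩
    have hu' : u ∈ conductorIdeal Rq := hu
    rw [conductorIdeal_localization q Rq, IsLocalization.mem_map_algebraMap_iff q.primeCompl] at hu'
    obtain ⟨⟨⟨i, hi⟩, s⟩, h⟩ := hu'
    refine ⟨_, ⟨i, hi, rfl⟩, s, ?_⟩
    rw [IsLocalizedModule.mk'_eq_iff, Submonoid.smul_def,
        ← algebraMap_smul Rq (s : R), ← map_smul, smul_eq_mul, mul_comm, h]
    exact ((normalizationMap q Rq).commutes i).trans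
        (IsScalarTower.algebraMap_apply R Rq (Normalization Rq) i)

omit [IsDomain Rq] in
theorem length_conductorInNormalization [Module.Finite R (Normalization R)] :
    Module.length R (Normalization Rq ⧸ conductorInNormalization Rq) =
      locLength q (Normalization R ⧸ conductorInNormalization R) := by
  rw [locLength_eq_length q (Submodule.toLocalizedQuotient' Rq q.primeCompl
    (normalizationMap q Rq).toLinearMap (conductorInNormalization R)),
    localized_conductorInNormalization]

/-- A valuation ring containing `R` is integrally closed, so it contains the normalization; places
centered at `Rq` are then counted by the primes over `q`. -/
theorem encard_branches [IsLocalRing Rq] [IsDedekindDomain (Normalization R)] [q.IsMaximal] (hB : ∀ p : Ideal (Normalization R), p.IsMaximal → p ≠ ⊥) :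
    (branches Rq).encard = {p : Ideal (Normalization R) | p.IsMaximal ∧ p.comap (algebraMap R (Normalization R)) = q}.encard := by
  let _ : Algebra (Normalization R) (FractionRing Rq) :=
    ((fractionRingEquiv q Rq).toRingHom.comp
      (algebraMap (Normalization R) (FractionRing R))).toAlgebra
  have : IsFractionRing (Normalization R) (FractionRing Rq) :=
    IsFractionRing.of_algEquiv (K := FractionRing R)
      { fractionRingEquiv q Rq with commutes' _ := rfl }
  have htower : IsScalarTower R (Normalization R) (FractionRing Rq) :=
    .of_algebraMap_eq fun r => ((fractionRingEquiv q Rq).commutes r).symm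
  rw [← encard_valuationSubring (L := FractionRing Rq) q hB]
  congr 1
  ext V
  have hbR (r : R) : algebraMap R (FractionRing Rq) r = algebraMap Rq (FractionRing Rq) (algebraMap R Rq r) :=
    IsScalarTower.algebraMap_apply _ _ _ r
  have hmax (r : R) : algebraMap R Rq r ∈ IsLocalRing.maximalIdeal Rq ↔ r ∈ q :=
    IsLocalization.AtPrime.to_map_mem_maximal_iff Rq q r
  constructor
  · intro hV
    refine ⟨fun b => ?_, fun r => ?_⟩
    · have hb : IsIntegral V (algebraMap (Normalization R) (FractionRing Rq) b) :=
        IsIntegral.map_of_comp_eq ((algebraMap R (FractionRing Rq)).codRestrict V fun r => by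
          rw [hbR]
          exact (hV _).1) (fractionRingEquiv q Rq).toRingHom
          (RingHom.ext fun r => ((fractionRingEquiv q Rq).commutes r).symm) b.2
      obtain ⟨y, hy⟩ := IsIntegrallyClosed.isIntegral_iff.1 hb
      exact hy ▸ y.2
    · rw [hbR, (hV _).2, hmax]
  · rintro ⟨hV, hVq⟩
    have hVR (r : R) : algebraMap Rq (FractionRing Rq) (algebraMap R Rq r) ∈ V := by
      rw [← hbR, htower.algebraMap_apply]
      exact hV _
    intro u
    obtain ⟨r, s, rfl⟩ := IsLocalization.exists_mk'_eq q.primeCompl u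
    -- An element outside `q` is a unit of `V`, so the conditions on `R` extend to all fractions in
    -- `Rq`.
    have hs : V.valuation (algebraMap Rq (FractionRing Rq) (algebraMap R Rq s)) = 1 := by
      refine le_antisymm ((V.valuation_le_one_iff _).2 (hVR _)) (not_lt.1 fun h => s.2 ?_)
      exact (hVq s).1 (by rwa [hbR])
    have hval : V.valuation (algebraMap Rq (FractionRing Rq) (IsLocalization.mk' Rq r s)) =
        V.valuation (algebraMap R (FractionRing Rq) r) := by
      rw [hbR, ← IsLocalization.mk'_spec Rq r s, map_mul, map_mul, hs, mul_one]
    rw [← V.valuation_le_one_iff, V.mem_nonunits_iff, hval,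
      IsLocalization.AtPrime.mk'_mem_maximal_iff Rq q, V.valuation_le_one_iff, ← V.mem_nonunits_iff,
      hVq, hbR]
    exact ⟨hVR r, Iff.rfl⟩

end NormalizationMap
end PlaneCurve
end

noncomputable section

namespace PlaneCurve

open Polynomial

/-! ### Change of coordinates to a monic equation. -/

section Coordinates

variable {k : Type*} [Field k] (N : ℕ)

/-- The automorphism `X ↦ X + Y ^ N`, `Y ↦ Y` of the plane, with values in `k[X][Y]`. -/
def shear : MvPolynomial (Fin 2) k ≃ₐ[k] k[X][X] :=
  AlgEquiv.ofRingEquiv (f := RingEquiv.ofRingHom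
    (MvPolynomial.aeval ![C X + X ^ N, X] : MvPolynomial (Fin 2) k →ₐ[k] k[X][X]).toRingHom
    (eval₂RingHom (aeval (MvPolynomial.X 0 - MvPolynomial.X 1 ^ N :
      MvPolynomial (Fin 2) k)).toRingHom (MvPolynomial.X 1))
    (by ext <;> simp)
    (by
      refine MvPolynomial.ringHom_ext (fun c => by simp) fun i => ?_
      fin_cases i <;> simp)) fun c => by
    simp

theorem shear_X_zero : shear N (MvPolynomial.X 0) = (C X + X ^ N : k[X][X]) := by
  simp [shear]

theorem shear_X_one : shear N (MvPolynomial.X 1) = (X : k[X][X]) := by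
  simp [shear]

theorem leadingCoeff_shear_monomial {N : ℕ} (hN : 0 < N) (v : Fin 2 →₀ ℕ) {a : k} (ha : a ≠ 0) :
    (shear N (MvPolynomial.monomial v a)).leadingCoeff = C a ∧
      (shear N (MvPolynomial.monomial v a)).natDegree = N * v 0 + v 1 := by
  have h1 : shear N (MvPolynomial.monomial v a) = C (C a) * ((X ^ N + C X) ^ v 0 * X ^ v 1) := by
    rw [MvPolynomial.monomial_eq, Finsupp.prod_fintype _ _ (fun i => pow_zero _), map_mul,
      Fin.prod_univ_two, map_mul, map_pow, map_pow, shear_X_zero, shear_X_one, add_comm (C X)]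
    congr 1
    exact (shear N).commutes a
  have hm : (X ^ N + C X : k[X][X]).Monic := monic_X_pow_add_C _ hN.ne'
  have hm' := (hm.pow (v 0)).mul (monic_X_pow (R := k[X]) (v 1))
  rw [h1]
  constructor
  · rw [leadingCoeff_mul_monic hm', leadingCoeff_C]
  · rw [natDegree_C_mul (C_ne_zero.2 ha), (hm.pow _).natDegree_mul (monic_X_pow _),
      hm.natDegree_pow, natDegree_X_pow_add_C, natDegree_X_pow, mul_comm]

/-- With `N` larger than the degree of `f` in `Y`, the weight `N * v 0 + v 1` determines `v` by its
digits in base `N`. So exactly one monomial reaches the top degree in `Y`, and its leading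
coefficient is constant. -/
theorem exists_leadingCoeff_shear {f : MvPolynomial (Fin 2) k} (hf : f ≠ 0) :
    ∃ N, ∃ a : k, a ≠ 0 ∧ (shear N f).leadingCoeff = C a := by
  classical
  set N := f.degreeOf 1 + 1 with hN
  have hN0 : 0 < N := Nat.succ_pos _
  refine ⟨N, ?_⟩
  set g := fun v => shear N (MvPolynomial.monomial v (f.coeff v)) with hg
  obtain ⟨v, hv, hmax⟩ := Finset.exists_max_image f.support (fun v => N * v 0 + v 1)
    (MvPolynomial.support_nonempty.2 hf)
  have hv0 := MvPolynomial.mem_support_iff.1 hv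
  have hgv := leadingCoeff_shear_monomial hN0 v hv0
  have hlt (w : Fin 2 →₀ ℕ) (hw : w ∈ f.support.erase v) : (g w).degree < (g v).degree := by
    obtain ⟨hne, hw⟩ := Finset.mem_erase.1 hw
    refine degree_lt_degree ?_
    rw [hgv.2, (leadingCoeff_shear_monomial hN0 w (MvPolynomial.mem_support_iff.1 hw)).2]
    refine lt_of_le_of_ne (hmax w hw) fun h => hne ?_
    have h1 : w 1 < N := Nat.lt_succ_of_le (MvPolynomial.monomial_le_degreeOf 1 hw)
    have h2 : v 1 < N := Nat.lt_succ_of_le (MvPolynomial.monomial_le_degreeOf 1 hv)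
    have h3 : w 0 = v 0 := by
      have := congrArg (· / N) h
      simpa [Nat.mul_add_div hN0, Nat.div_eq_of_lt h1, Nat.div_eq_of_lt h2] using this
    have h4 : w 1 = v 1 := by
      rw [h3] at h
      exact Nat.add_left_cancel h
    ext i
    fin_cases i
    · exact h3
    · exact h4
  have hsum : shear N f = ∑ w ∈ f.support.erase v, g w + g v := by
    conv_lhs => rw [← f.support_sum_monomial_coeff]
    rw [map_sum, Finset.sum_erase_add _ _ hv]
  refine ⟨f.coeff v, hv0, ?_⟩
  rw [hsum, leadingCoeff_add_of_degree_lt, hgv.1]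
  refine (degree_sum_le _ _).trans_lt ((Finset.sup_lt_iff ?_).2 hlt)
  rw [bot_lt_iff_ne_bot, Ne, degree_eq_bot, ← leadingCoeff_eq_zero, hgv.1, C_eq_zero]
  exact hv0

/-- The derivation corresponding to the partial derivative `i` under `shear N`. -/
def shearDeriv (i : Fin 2) : Derivation k k[X][X] k[X][X] :=
  Derivation.mk' ((shear N).toLinearMap ∘ₗ (MvPolynomial.pderiv i).toLinearMap ∘ₗ
    (shear N).symm.toLinearMap) fun a b => by
      simp [Derivation.leibniz]

theorem shearDeriv_shear (i : Fin 2) (a : MvPolynomial (Fin 2) k) :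
    shearDeriv N i (shear N a) = shear N (MvPolynomial.pderiv i a) := by
  change shear N (MvPolynomial.pderiv i ((shear N).symm (shear N a))) = _
  rw [AlgEquiv.symm_apply_apply]

theorem shearDeriv_one_X : shearDeriv N 1 (X : k[X][X]) = 1 := by
  rw [← shear_X_one N, shearDeriv_shear, MvPolynomial.pderiv_X_self, map_one]

theorem shearDeriv_zero_X : shearDeriv N 0 (X : k[X][X]) = 0 := by
  rw [← shear_X_one N, shearDeriv_shear, MvPolynomial.pderiv_X_of_ne (by decide), map_zero]

theorem shearDeriv_zero_C_X : shearDeriv N 0 (C X : k[X][X]) = 1 := by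
  have h := shearDeriv_shear N 0 (MvPolynomial.X 0 : MvPolynomial (Fin 2) k)
  rwa [MvPolynomial.pderiv_X_self, map_one, shear_X_zero, map_add, Derivation.leibniz_pow,
    shearDeriv_zero_X, smul_zero, smul_zero, add_zero] at h

theorem shearDeriv_one_C_X : shearDeriv N 1 (C X : k[X][X]) = -((N : k[X][X]) * X ^ (N - 1)) := by
  have h := shearDeriv_shear N 1 (MvPolynomial.X 0 : MvPolynomial (Fin 2) k)
  rw [MvPolynomial.pderiv_X_of_ne (by decide), map_zero, shear_X_zero, map_add,
    Derivation.leibniz_pow, shearDeriv_one_X] at h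
  rw [eq_neg_of_add_eq_zero_left h]
  simp

/-- The chain rule for the shear: old and new gradients differ by a unitriangular matrix, so they
generate the same ideal. -/
theorem derivative_eq_shearDeriv (a : k[X][X]) :
    derivative a = shearDeriv N 1 a + (N : k[X][X]) * X ^ (N - 1) * shearDeriv N 0 a := by
  induction a using bivariate_induction with
  | hC c =>
    have h (i : Fin 2) : shearDeriv N i (C (C c)) = 0 := (shearDeriv N i).map_algebraMap c
    rw [h, h, derivative_C, mul_zero, add_zero]
  | hX => rw [derivative_C, shearDeriv_zero_C_X, shearDeriv_one_C_X, mul_one, neg_add_cancel]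
  | hY => rw [derivative_X, shearDeriv_zero_X, shearDeriv_one_X, mul_zero, add_zero]
  | hadd a b ha hb =>
    rw [derivative_add, ha, hb, map_add, map_add]
    ring
  | hmul a b ha hb =>
    rw [derivative_mul, ha, hb, Derivation.leibniz, Derivation.leibniz]
    simp only [smul_eq_mul]
    ring

theorem map_jacobianIdeal (f : MvPolynomial (Fin 2) k) {F : k[X][X]} {c : k} (hc : c ≠ 0)
    (hF : shear N f = C (C c) * F) : (jacobianIdeal f).map (shear N) =
      Ideal.span {shearDeriv N 0 F, derivative F} := by
  have hc' : C (C c⁻¹) * C (C c) = (1 : k[X][X]) := by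
    rw [← C_mul, ← C_mul, inv_mul_cancel₀ hc, C_1, C_1]
  -- Here the factor must be constant: the gradient of `u * F` with `u` not constant would also
  -- involve multiples of `F`.
  have h (i : Fin 2) : shear N (MvPolynomial.pderiv i f) = C (C c) * shearDeriv N i F := by
    rw [← shearDeriv_shear, hF, Derivation.leibniz,
      show shearDeriv N i (C (C c)) = 0 from (shearDeriv N i).map_algebraMap c, smul_zero, add_zero,
      smul_eq_mul]
  rw [jacobianIdeal, Ideal.map_span, Set.image_pair, h, h, derivative_eq_shearDeriv N]
  refine le_antisymm ?_ ?_ <;> rw [Ideal.span_le]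
  · rintro _ (rfl | rfl)
    · exact Ideal.mem_span_pair.2 ⟨C (C c), 0, by ring⟩
    · exact Ideal.mem_span_pair.2 ⟨-(C (C c) * ((N : k[X][X]) * X ^ (N - 1))), C (C c), by ring⟩
  · rintro _ (rfl | rfl)
    · exact Ideal.mem_span_pair.2 ⟨C (C c⁻¹), 0, by linear_combination shearDeriv N 0 F * hc'⟩
    · exact Ideal.mem_span_pair.2 ⟨C (C c⁻¹) * ((N : k[X][X]) * X ^ (N - 1)), C (C c⁻¹), by
        linear_combination (shearDeriv N 1 F + N * X ^ (N - 1) * shearDeriv N 0 F) * hc'⟩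

end Coordinates
end PlaneCurve
end

noncomputable section

namespace PlaneCurve

open Polynomial

/-! ### Transfer between the plane and the curve. -/

section BaseChange

variable {S S' : Type*} [CommRing S] [CommRing S']

theorem locLength_comap [Algebra S S'] (h : Function.Surjective (algebraMap S S'))
    (q : Ideal S') [q.IsPrime] (M : Type*) [AddCommGroup M] [Module S M] [Module S' M]
    [IsScalarTower S S' M] :
    locLength (q.comap (algebraMap S S')) M = locLength q M := by
  have htower : IsScalarTower S S' (LocalizedModule q.primeCompl M) := inferInstance
  have hloc : IsLocalizedModule (q.comap (algebraMap S S')).primeCompl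
      ((LocalizedModule.mkLinearMap q.primeCompl M).restrictScalars S) := by
    have hmem {s : S} {t : q.primeCompl} (h : algebraMap S S' s = t) :
        s ∈ (q.comap (algebraMap S S')).primeCompl :=
      show algebraMap S S' s ∈ q.primeCompl from h ▸ t.2
    refine ⟨fun s => ?_, fun y => ?_, fun {x y} hxy => ?_⟩
    · have h1 := IsLocalizedModule.map_units (LocalizedModule.mkLinearMap q.primeCompl M)
        (⟨algebraMap S S' s, show _ ∈ q.primeCompl from s.2⟩ : q.primeCompl)
      rw [Module.End.isUnit_iff] at h1 ⊢
      convert h1 using 1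
      ext x
      exact (algebraMap_smul S' (s : S) x).symm
    · obtain ⟨⟨m, s⟩, hm⟩ := IsLocalizedModule.surj q.primeCompl
        (LocalizedModule.mkLinearMap q.primeCompl M) y
      obtain ⟨t, ht⟩ := h s
      refine ⟨⟨m, ⟨t, hmem ht⟩⟩, Eq.trans ?_ hm⟩
      change t • y = (s : S') • y
      rw [← ht, algebraMap_smul]
    · obtain ⟨s, hs⟩ := IsLocalizedModule.exists_of_eq (S := q.primeCompl)
        (f := LocalizedModule.mkLinearMap q.primeCompl M) hxy
      obtain ⟨t, ht⟩ := h s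
      have ht' (m : M) : t • m = (s : S') • m := by rw [← ht, algebraMap_smul]
      exact ⟨⟨t, hmem ht⟩, (ht' x).trans (hs.trans (ht' y).symm)⟩
  rw [locLength_eq_length _ ((LocalizedModule.mkLinearMap q.primeCompl M).restrictScalars S),
    locLength]
  exact Module.length_eq_of_surjective (R := S') (S := S) (M := LocalizedModule q.primeCompl M) h

theorem locLength_quotient_map (φ : S →+* S') (hφ : Function.Surjective φ) (q : Ideal S')
    [q.IsPrime] {I : Ideal S} (hI : RingHom.ker φ ≤ I) :
    locLength (q.comap φ) (S ⧸ I) = locLength q (S' ⧸ I.map φ) := by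
  let _ : Algebra S S' := φ.toAlgebra
  rw [← locLength_comap (S := S) (S' := S') hφ q (S' ⧸ I.map φ)]
  let ψ : S →ₗ[S] S' ⧸ I.map φ := Algebra.linearMap S (S' ⧸ I.map φ)
  have hψ : Function.Surjective ψ := Ideal.Quotient.mk_surjective.comp hφ
  have hker : LinearMap.ker ψ = I := by
    ext x
    have h1 : x ∈ LinearMap.ker ψ ↔ x ∈ (I.map φ).comap φ := Ideal.Quotient.eq_zero_iff_mem
    rw [h1, Ideal.comap_map_of_surjective φ hφ]
    rw [← RingHom.ker_eq_comap_bot, sup_eq_left.2 hI]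
  exact locLength_congr _ (Submodule.quotEquivOfEq _ _ hker.symm ≪≫ₗ
    ψ.quotKerEquivOfSurjective hψ)

end BaseChange

/-- For `I` the image of the Jacobian ideal, the last term is the local Zariski number. -/
theorem locLength_quotient_eq_add_lengthBetween {R : Type*} [CommRing R] [IsDomain R] (q : Ideal R)
    [q.IsMaximal] (Rq : Type*) [CommRing Rq] [Algebra R Rq] [IsLocalization.AtPrime Rq q]
    [Module.Finite R (Normalization R)] {I : Ideal R} (hI : I ≤ conductorIdeal R) :
    locLength q (R ⧸ I) = locLength q (R ⧸ conductorIdeal R) +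
      lengthBetween (I.map (algebraMap R Rq)) (conductorIdeal Rq) := by
  rw [conductorIdeal_localization q Rq, ← length_localization_quotient q Rq,
    ← length_localization_quotient q Rq, length_quotient_eq_add (Ideal.map_mono hI)]

section Local

variable {k R : Type*} [Field k] [IsAlgClosed k] [CharZero k] [CommRing R] [IsDomain R]
  [Algebra k R] [Algebra k[X] R] [IsScalarTower k k[X] R]
  [Algebra k[X][X] R] [IsScalarTower k[X] k[X][X] R] [IsScalarTower k k[X][X] R] {F : k[X][X]}
  (hsurj : Function.Surjective (algebraMap k[X][X] R))
  (hker : RingHom.ker (algebraMap k[X][X] R) = Ideal.span {F}) (hF : F.Monic) (hirr : Irreducible F)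
  (Dx : Derivation k k[X][X] k[X][X]) (hX : Dx (C X) = 1) (hY : Dx X = 0)

include hsurj hker hF hirr hX hY

theorem map_jacobian_le_conductorIdeal :
    (Ideal.span {Dx F, derivative F}).map (algebraMap k[X][X] R) ≤ conductorIdeal R := by
  have hlead : IsUnit F.leadingCoeff := hF.leadingCoeff ▸ isUnit_one
  have := finite_of_ker_eq_span hsurj hker hlead
  have := faithfulSMul_of_ker_eq_span hker hlead
  have := isDedekindDomain_normalization k[X] R
  rw [Ideal.map_le_iff_le_comap, Ideal.span_le]
  rintro _ (rfl | rfl)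
  · rw [SetLike.mem_coe, Ideal.mem_comap, ← algebraMap_mem_conductorOf,
      ← IsScalarTower.algebraMap_apply]
    exact deriv_mem_conductorOf hsurj hker hF hirr Dx hX hY
  · rw [SetLike.mem_coe, Ideal.mem_comap, ← algebraMap_mem_conductorOf,
      ← IsScalarTower.algebraMap_apply]
    exact derivative_mem_conductorOf hsurj hker hF hirr

/-- A form of `locLength_jacobian` intrinsic to `Rq`: primes of the normalization become branches,
and the conductor quotient is localized. -/
theorem locLength_jacobian_add_encard_branches (q : Ideal R) [q.IsMaximal]
    (Rq : Type*) [CommRing Rq] [IsDomain Rq] [IsLocalRing Rq] [Algebra R Rq]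
    [IsLocalization.AtPrime Rq q] :
    locLength (q.comap (algebraMap k[X][X] R)) (k[X][X] ⧸ Ideal.span {Dx F, derivative F}) +
      (branches Rq).encard =
      Module.length R (Normalization Rq ⧸ conductorInNormalization Rq) + 1 := by
  have hlead : IsUnit F.leadingCoeff := hF.leadingCoeff ▸ isUnit_one
  have := finite_of_ker_eq_span hsurj hker hlead
  have := faithfulSMul_of_ker_eq_span hker hlead
  have := isDedekindDomain_normalization k[X] R
  have := finite_normalization k[X] R
  have hmax : (q.comap (algebraMap k[X][X] R)).IsMaximal :=
    Ideal.comap_isMaximal_of_surjective _ hsurj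
  have hFQ : F ∈ q.comap (algebraMap k[X][X] R) := by
    have h : F ∈ RingHom.ker (algebraMap k[X][X] R) := hker ▸ Ideal.mem_span_singleton_self F
    rw [RingHom.mem_ker] at h
    rw [Ideal.mem_comap, h]
    exact zero_mem q
  have h1 := locLength_jacobian hsurj hker hF hirr Dx hX hY (q.comap (algebraMap k[X][X] R)) hFQ
  have h2 : {p : Ideal (Normalization R) | p.IsMaximal ∧
        p.comap (algebraMap k[X][X] (Normalization R)) = q.comap (algebraMap k[X][X] R)} =
      {p : Ideal (Normalization R) | p.IsMaximal ∧ p.comap (algebraMap R (Normalization R)) = q} := by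
    ext p
    refine and_congr_right fun _ => ?_
    rw [IsScalarTower.algebraMap_eq k[X][X] R (Normalization R), ← Ideal.comap_comap]
    exact (Ideal.comap_injective_of_surjective _ hsurj).eq_iff
  have h3 : locLength (q.comap (algebraMap k[X][X] R))
      (Normalization R ⧸ conductorOf R (Normalization R)) =
      locLength q (Normalization R ⧸ conductorInNormalization R) := by
    rw [locLength_comap hsurj]
    refine locLength_congr q ((Submodule.Quotient.restrictScalarsEquiv R
      (conductorOf R (Normalization R))).symm ≪≫ₗ Submodule.quotEquivOfEq _ _ ?_)
    ext b
    exact mem_conductorInNormalization.symm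
  rw [h2, h3] at h1
  rw [encard_branches q Rq fun p hp => ne_bot_of_isMaximal k hp,
    length_conductorInNormalization q Rq, h1]

end Local
end PlaneCurve
end

noncomputable section

namespace PlaneCurve

open Polynomial

variable {k : Type*} [Field k]

/-! ### Points of the curve and summation of the invariants. -/

section Points

variable {f : MvPolynomial (Fin 2) k}

theorem Point.comap_imageIdeal (Q : Point f) :
    Q.imageIdeal.comap (Ideal.Quotient.mk (Ideal.span {f})) = Q.ideal := by
  rw [Ideal.comap_map_of_surjective _ Ideal.Quotient.mk_surjective, ← RingHom.ker_eq_comap_bot,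
    Ideal.mk_ker, sup_eq_left, Ideal.span_singleton_le_iff_mem]
  exact Q.2

/-- The points of the curve are the maximal ideals of its coordinate ring. -/
def pointEquiv (f : MvPolynomial (Fin 2) k) : Point f ≃ MaximalSpectrum (CoordinateRing f) :=
  Equiv.ofBijective (fun Q => ⟨Q.imageIdeal, inferInstance⟩) ⟨fun Q Q' h => by
    have h1 : Q.imageIdeal = Q'.imageIdeal := congrArg MaximalSpectrum.asIdeal h
    refine Subtype.ext (MaximalSpectrum.ext ?_)
    rw [← Point.ideal, ← Q.comap_imageIdeal, h1, Q'.comap_imageIdeal],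
  fun q => by
    have hq := q.isMaximal
    refine ⟨⟨⟨q.asIdeal.comap (Ideal.Quotient.mk (Ideal.span {f})),
      Ideal.comap_isMaximal_of_surjective _ Ideal.Quotient.mk_surjective⟩, ?_⟩,
      MaximalSpectrum.ext (Ideal.map_comap_of_surjective _ Ideal.Quotient.mk_surjective _)⟩
    rw [Ideal.mem_comap, Ideal.Quotient.eq_zero_iff_mem.2 (Ideal.mem_span_singleton_self f)]
    exact zero_mem _⟩

theorem tsum_point {M : Type*} [AddCommGroup M] [Module (CoordinateRing f) M]
    (hM : IsFiniteLength (CoordinateRing f) M) :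
    ∑' Q : Point f, locLength Q.imageIdeal M = Module.length (CoordinateRing f) M := by
  rw [← tsum_locLength hM]
  exact (pointEquiv f).tsum_eq fun q => locLength q.asIdeal M

theorem tsum_add_enat {ι : Type*} (g h : ι → ℕ∞) :
    ∑' i, (g i + h i) = ∑' i, g i + ∑' i, h i :=
  (hasSum_enat g).summable.tsum_add (hasSum_enat h).summable

theorem map_tjurinaIdeal : (tjurinaIdeal f).map (Ideal.Quotient.mk (Ideal.span {f})) =
    (jacobianIdeal f).map (Ideal.Quotient.mk (Ideal.span {f})) := by
  rw [tjurinaIdeal, Ideal.map_sup, Ideal.map_quotient_self, bot_sup_eq]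

theorem milnorAt_eq_locLength (Q : Point f) :
    milnorAt Q = locLength Q.ideal (MvPolynomial (Fin 2) k ⧸ jacobianIdeal f) :=
  length_localization_quotient Q.ideal Q.PlaneLocalRing (jacobianIdeal f)

/-- As `f` lies in the Tjurina ideal, the quotient can be formed on the curve, where only the
partial derivatives remain. -/
theorem tjurinaAt_eq_locLength (Q : Point f) :
    tjurinaAt Q = locLength Q.imageIdeal
      (CoordinateRing f ⧸ (jacobianIdeal f).map (Ideal.Quotient.mk (Ideal.span {f}))) := by
  have h1 : tjurinaAt Q = locLength Q.ideal (MvPolynomial (Fin 2) k ⧸ tjurinaIdeal f) :=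
    length_localization_quotient Q.ideal Q.PlaneLocalRing (tjurinaIdeal f)
  have h2 := locLength_quotient_map (Ideal.Quotient.mk (Ideal.span {f}))
    Ideal.Quotient.mk_surjective Q.imageIdeal (I := tjurinaIdeal f)
    (by rw [Ideal.mk_ker]; exact le_sup_left)
  rw [h1, ← map_tjurinaIdeal, ← h2]
  congr 1
  exact Q.comap_imageIdeal.symm

end Points

section Curve

variable [IsAlgClosed k] [CharZero k] (f : MvPolynomial (Fin 2) k) [hf : Fact (Irreducible f)]

/-- The local and global relations between the invariants, before summation. -/
theorem curve_relations :
    (∀ Q : Point f, milnorAt Q + numBranchesAt Q = conductorLengthAt Q + 1) ∧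
    (∀ Q : Point f, conductorLengthAt Q = locLength Q.imageIdeal
      (Normalization (CoordinateRing f) ⧸ conductorInNormalization (CoordinateRing f))) ∧
    (∀ Q : Point f, tjurinaAt Q = locLength Q.imageIdeal
      (CoordinateRing f ⧸ conductorIdeal (CoordinateRing f)) + zariskiAt Q) ∧
    IsFiniteLength (CoordinateRing f) (CoordinateRing f ⧸ conductorIdeal (CoordinateRing f)) ∧
    Module.length (CoordinateRing f)
      (Normalization (CoordinateRing f) ⧸ conductorInNormalization (CoordinateRing f)) =
      2 * Module.length (CoordinateRing f)
        (CoordinateRing f ⧸ conductorIdeal (CoordinateRing f)) := by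
  obtain ⟨N, a, ha, hlc⟩ := exists_leadingCoeff_shear hf.out.ne_zero
  set F : k[X][X] := C (C a⁻¹) * shear N f with hFdef
  have hunit : IsUnit (C (C a⁻¹) : k[X][X]) :=
    isUnit_C.2 (isUnit_C.2 (isUnit_iff_ne_zero.2 (inv_ne_zero ha)))
  have hfF : shear N f = C (C a) * F := by
    rw [hFdef, ← mul_assoc, ← C_mul, ← C_mul, mul_inv_cancel₀ ha, C_1, C_1, one_mul]
  have hF : F.Monic := by
    rw [Monic, hFdef, leadingCoeff_mul, hlc, leadingCoeff_C, ← C_mul, inv_mul_cancel₀ ha, C_1]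
  have hirr : Irreducible F := by
    rw [hFdef, irreducible_isUnit_mul hunit, MulEquiv.irreducible_iff]
    exact hf.out
  have hspan : (Ideal.span {F} : Ideal k[X][X]) = (Ideal.span {f}).map (shear N) := by
    rw [Ideal.map_span, Set.image_singleton, hFdef, Ideal.span_singleton_mul_left_unit hunit]
  set R := CoordinateRing f
  let mk : MvPolynomial (Fin 2) k →+* R := Ideal.Quotient.mk (Ideal.span {f})
  -- The coordinate ring is read in the sheared coordinates, in which its equation is the monic `F`.
  let _ : Algebra k[X][X] R := (mk.comp (shear N).symm.toRingHom).toAlgebra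
  let _ : Algebra k[X] R := ((algebraMap k[X][X] R).comp C).toAlgebra
  have halg (x) : algebraMap k[X][X] R (shear N x) = mk x :=
    congrArg mk ((shear N).symm_apply_apply x)
  have htower1 : IsScalarTower k[X] k[X][X] R := .of_algebraMap_eq' rfl
  have htower2 : IsScalarTower k k[X][X] R := .of_algebraMap_eq fun c =>
    (halg _).symm.trans (congrArg _ ((shear N).commutes c))
  have htower3 : IsScalarTower k k[X] R := .of_algebraMap_eq fun c =>
    IsScalarTower.algebraMap_apply k k[X][X] R c
  have hsurj : Function.Surjective (algebraMap k[X][X] R) :=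
    Ideal.Quotient.mk_surjective.comp (shear N).symm.surjective
  have hker : RingHom.ker (algebraMap k[X][X] R) = Ideal.span {F} := by
    ext x
    obtain ⟨x, rfl⟩ := (shear N).surjective x
    rw [RingHom.mem_ker, halg, Ideal.Quotient.eq_zero_iff_mem, hspan, Ideal.mem_span_singleton,
      Ideal.map_span, Set.image_singleton, Ideal.mem_span_singleton]
    exact (map_dvd_iff (shear N)).symm
  have hlead : IsUnit F.leadingCoeff := hF.leadingCoeff ▸ isUnit_one
  have := finite_of_ker_eq_span hsurj hker hlead
  have := faithfulSMul_of_ker_eq_span hker hlead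
  have := finite_normalization k[X] R
  have hX := shearDeriv_zero_C_X (k := k) N
  have hY := shearDeriv_zero_X (k := k) N
  have hJ := map_jacobianIdeal N f ha hfF
  have hcl (Q : Point f) : conductorLengthAt Q = locLength Q.imageIdeal
      (Normalization R ⧸ conductorInNormalization R) :=
    length_conductorInNormalization Q.imageIdeal Q.CurveLocalRing
  have hcomp : (algebraMap k[X][X] R).comp (shear N).toRingEquiv.toRingHom = mk := RingHom.ext halg
  have hmap : ((jacobianIdeal f).map mk) ≤ conductorIdeal R := by
    have h := map_jacobian_le_conductorIdeal hsurj hker hF hirr (shearDeriv N 0) hX hY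
    rw [← hJ] at h
    rw [← hcomp, ← Ideal.map_map]
    exact h
  refine ⟨fun Q => ?_, hcl, fun Q => ?_, isFiniteLength_quotient_conductorIdeal k R,
    length_curve_conductor hsurj⟩
  · have h := locLength_jacobian_add_encard_branches hsurj hker hF hirr (shearDeriv N 0) hX hY
      Q.imageIdeal Q.CurveLocalRing
    refine Eq.trans ?_ h
    rw [milnorAt_eq_locLength, numBranchesAt]
    congr 1
    have h2 := locLength_quotient_map (shear N).toRingEquiv.toRingHom (shear N).surjective
      (Q.imageIdeal.comap (algebraMap k[X][X] R)) (I := jacobianIdeal f)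
      (((RingHom.injective_iff_ker_eq_bot _).1 (shear N).injective).le.trans bot_le)
    rw [← hJ]
    refine Eq.trans ?_ h2
    congr 1
    rw [Ideal.comap_comap, hcomp]
    exact Q.comap_imageIdeal.symm
  · rw [tjurinaAt_eq_locLength]
    exact locLength_quotient_eq_add_lengthBetween Q.imageIdeal Q.CurveLocalRing hmap

theorem conductorLengthAt_eq (Q : Point f) : conductorLengthAt Q = milnorAt Q + chiBarAt Q := by
  have h := (curve_relations f).1 Q
  have h1 : chiBarAt Q + 1 = numBranchesAt Q := tsub_add_cancel_of_le (one_le_numBranchesAt Q)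
  rw [← h1, ← add_assoc] at h
  exact (ENat.add_left_injective_of_ne_top (ENat.natCast_ne_top 1) h).symm

theorem conductorLength_eq : conductorLength f = milnor f + chiBar f := by
  rw [milnor, chiBar, ← tsum_add_enat]
  exact tsum_congr (conductorLengthAt_eq f)

/-- Here `n` is the length of `R` modulo its conductor. The duality is global, so the local
identities are summed and compared with it. -/
theorem exists_conductorLength_eq : ∃ n : ℕ, conductorLength f = 2 * n ∧
    milnor f = n + zariski f + defect f := by
  obtain ⟨-, h2, h3, h4, h5⟩ := curve_relations f
  have hlen := Module.length_ne_top_iff.2 h4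
  obtain ⟨n, hn⟩ := ENat.ne_top_iff_exists.1 hlen
  have hB : IsFiniteLength (CoordinateRing f) (Normalization (CoordinateRing f) ⧸
      conductorInNormalization (CoordinateRing f)) := by
    rw [← Module.length_ne_top_iff, h5, ← hn]
    exact ENat.natCast_ne_top (2 * n)
  refine ⟨n, ?_, ?_⟩
  · rw [conductorLength, hn, ← h5, ← tsum_point hB]
    exact tsum_congr h2
  · rw [milnor, zariski, defect, hn, ← tsum_point h4, ← tsum_add_enat, ← tsum_add_enat]
    exact tsum_congr fun Q => by rw [milnorAt_eq, h3]

end Curve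

end PlaneCurve
end

theorem lemma3p4 {k : Type*} [Field k] [IsAlgClosed k] [CharZero k]
    (f : MvPolynomial (Fin 2) k) [Fact (Irreducible f)] :
    (PlaneCurve.conductorLength f ≠ ⊤ ∧ PlaneCurve.milnor f ≠ ⊤ ∧ PlaneCurve.zariski f ≠ ⊤ ∧
      PlaneCurve.defect f ≠ ⊤ ∧ PlaneCurve.chiBar f ≠ ⊤) ∧
    ((PlaneCurve.conductorLength f).toNat : ℚ) =
      (PlaneCurve.milnor f).toNat + (PlaneCurve.chiBar f).toNat ∧
    ((PlaneCurve.milnor f).toNat : ℚ) + (PlaneCurve.chiBar f).toNat =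
      ((PlaneCurve.conductorLength f).toNat : ℚ) / 2 + (PlaneCurve.zariski f).toNat +
        (PlaneCurve.defect f).toNat + (PlaneCurve.chiBar f).toNat ∧
    ((PlaneCurve.conductorLength f).toNat : ℚ) / 2 - (PlaneCurve.zariski f).toNat =
      (PlaneCurve.defect f).toNat + (PlaneCurve.chiBar f).toNat := by
  obtain ⟨n, hC, hM⟩ := PlaneCurve.exists_conductorLength_eq f
  have hCM := PlaneCurve.conductorLength_eq f
  generalize PlaneCurve.conductorLength f = c at *
  generalize PlaneCurve.milnor f = m at *
  generalize PlaneCurve.zariski f = z at *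
  generalize PlaneCurve.defect f = d at *
  generalize PlaneCurve.chiBar f = χ at *
  -- Every other invariant is a summand of the finite `c`, or of `m`, which is itself one.
  have hc : c ≠ ⊤ := hC ▸ ENat.natCast_ne_top (2 * n)
  obtain ⟨hm, hχ⟩ : m ≠ ⊤ ∧ χ ≠ ⊤ := by simpa [hCM] using hc
  obtain ⟨⟨-, hz⟩, hd⟩ : ((n : ℕ∞) ≠ ⊤ ∧ z ≠ ⊤) ∧ d ≠ ⊤ := by simpa [hM] using hm
  refine ⟨⟨hc, hm, hz, hd, hχ⟩, ?_⟩
  lift c to ℕ using hc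
  lift m to ℕ using hm
  lift z to ℕ using hz
  lift d to ℕ using hd
  lift χ to ℕ using hχ
  norm_cast at hC hM hCM
  simp only [ENat.toNat_natCast]
  have hC' : (c : ℚ) = 2 * n := by exact_mod_cast hC
  have hM' : (m : ℚ) = n + z + d := by exact_mod_cast hM
  have hCM' : (c : ℚ) = m + χ := by exact_mod_cast hCM
  refine ⟨hCM', ?_, ?_⟩ <;> linarith
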